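/- Fix smooth even functions $\chi,\varphi:\mathbb R\to[0,1]$ with $\operatorname{supp}\chi\subset\{|\xi|\le 4/3\}$, $\operatorname{supp}\varphi\subset\{3/4\le|\xi|\le 8/3\}$ and, for all $\xi\in\mathbb R$, $$\chi(\xi)+\sum_{j\ge0}\varphi(2^{-j}\xi)=1,\qquad \tfrac12\le\chi^2(\xi)+\sum_{j\ge0}\varphi^2(2^{-j}\xi)\le1 .$$ For a tempered distribution $f$ on $\mathbb R$ put $\Delta_{-1}f=\chi(D)f$, $\Delta_jf=\varphi(2^{-j}D)f$ for $j\ge0$, and, for $\sigma\in\mathbb R$, $$\|f\|_{B^{\sigma}_{2,\infty}}=\sup_{j\ge-1}2^{\sigma j}\|\Delta_jf\|_{L^2(\mathbb R)}\in[0,\infty].$$ For $\alpha\in[0,1]$ consider the Camassa-Holm equation $$\partial_tu+u\,\partial_xu=-\partial_x(1-\alpha^2\partial_x^2)^{-1}\Big(u^2+\tfrac{\alpha^2}{2}(\partial_xu)^2\Big),\qquad u(0,\cdot)=v_0. \qquad (\mathrm{CH}_\alpha)$$ Here $(1-\alpha^2\partial_x^2)^{-1}$ is the Fourier multiplier with symbol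 $(1+\alpha^2\xi^2)^{-1}$. For $s>\frac32$, a solution on $[0,\tau]$ is a family $(v(t))_{t\in[0,\tau]}$ of real-valued distributions, bounded in $B^s_{2,\infty}(\mathbb R)$, that satisfies the time-integrated equation $v(t)=v_0+\int_0^t\partial_tv$ for all $t\in[0,\tau]$ in the sense of tempered distributions in $x$, where $\partial_tv$ is the expression that $(\mathrm{CH}_\alpha)$ prescribes. Finally let $$\mathbf E_0(\alpha,v_0)=-3v_0\,\partial_xv_0-\alpha^2\partial_x^3(1-\alpha^2\partial_x^2)^{-1}(v_0^2)-\tfrac{\alpha^2}{2}\partial_x(1-\alpha^2\partial_x^2)^{-1}\big((\partial_xv_0)^2\big).$$ **Proposition.** Let $s>\frac32$ and $R\ge0$. There are a time $T>0$ and a constant $C\ge0$, which depend only on $s$, $R$ (and on the choice of $\chi,\varphi$), such that the following holds for every $\alpha\in[0,1]$, every real-valued $v_0\in B^s_{2,\infty}(\mathbb R)$ with $\|v_0\|_{B^s_{2,\infty}}\le R$, and every $\tau\in[0,T]$: if $v(t)=\mathbf S^\alpha_t(v_0)$ is a solution of $(\mathrm{CH}_\alpha)$ on $[0,\tau]$ with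 initial value $v_0$, then $$\big\|\mathbf S^\alpha_t(v_0)-v_0-t\,\mathbf E_0(\alpha,v_0)\big\|_{B^{s-2}_{2,\infty}}\le C\,t^2\qquad\text{for all }t\in[0,\tau].$$ -/

import Mathlib

open MeasureTheory Set
open scoped SchwartzMap ENNReal NNReal ContDiff

/-- `(χ, φ)` is a Littlewood-Paley pair on the line: smooth even functions with values in `[0,1]`,
supported in `|ξ| ≤ 4/3` and `3/4 ≤ |ξ| ≤ 8/3` respectively, with
`χ(ξ) + ∑_{j ≥ 0} φ(2^{-j} ξ) = 1` and `1/2 ≤ χ(ξ)^2 + ∑_{j ≥ 0} φ(2^{-j} ξ)^2 ≤ 1`. -/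
structure IsLittlewoodPaleyPair (χ φ : ℝ → ℝ) : Prop where
  contDiff_low : ContDiff ℝ ∞ χ
  contDiff_high : ContDiff ℝ ∞ φ
  even_low : ∀ ξ, χ (-ξ) = χ ξ
  even_high : ∀ ξ, φ (-ξ) = φ ξ
  range_low : ∀ ξ, χ ξ ∈ Icc (0 : ℝ) 1
  range_high : ∀ ξ, φ ξ ∈ Icc (0 : ℝ) 1
  support_low : ∀ ξ, χ ξ ≠ 0 → |ξ| ≤ 4 / 3
  support_high : ∀ ξ, φ ξ ≠ 0 → 3 / 4 ≤ |ξ| ∧ |ξ| ≤ 8 / 3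
  sum_eq_one : ∀ ξ, HasSum (fun j : ℕ => φ ((2 : ℝ) ^ (-(j : ℤ)) * ξ)) (1 - χ ξ)
  half_le_sum_sq : ∀ ξ, 1 / 2 ≤ χ ξ ^ 2 + ∑' j : ℕ, φ ((2 : ℝ) ^ (-(j : ℤ)) * ξ) ^ 2
  sum_sq_le_one : ∀ ξ, χ ξ ^ 2 + ∑' j : ℕ, φ ((2 : ℝ) ^ (-(j : ℤ)) * ξ) ^ 2 ≤ 1

noncomputable section

/-- The Fourier multiplier `m(D)` on tempered distributions, for a real symbol `m` that is written
in the angular frequency `ξ` of `𝓕 f (ξ) = ∫ e^{-ixξ} f(x) dx`. Mathlib's Fourier transform uses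
`e^{-2πixη}`, so that `ξ = 2πη`; thus `∂ₓ` corresponds to `iξ`. -/
def multiplierD (m : ℝ → ℝ) : 𝓢'(ℝ, ℂ) →L[ℂ] 𝓢'(ℝ, ℂ) :=
  TemperedDistribution.fourierMultiplierCLM ℂ (fun η : ℝ => ((m (2 * Real.pi * η) : ℝ) : ℂ))

/-- The dyadic blocks: `Δ_j = 0` for `j ≤ -2`, `Δ_{-1} = χ(D)`, and `Δ_j = φ(2^{-j} D)`
for `j ≥ 0`. -/
def dyadicBlock (χ φ : ℝ → ℝ) (j : ℤ) (f : 𝓢'(ℝ, ℂ)) : 𝓢'(ℝ, ℂ) :=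
  if j ≤ -2 then 0
  else if j = -1 then multiplierD χ f
  else multiplierD (fun ξ => φ ((2 : ℝ) ^ (-j) * ξ)) f

/-- The `L²` norm of a tempered distribution; it is `∞` if the distribution is not given by
a square-integrable function. -/
def l2Norm (f : 𝓢'(ℝ, ℂ)) : ℝ≥0∞ :=
  ⨅ (g : Lp ℂ 2 (volume : Measure ℝ)) (_ : (g : 𝓢'(ℝ, ℂ)) = f), ‖g‖ₑ

/-- The norm `sup_{j ≥ -1} 2^{sj} ‖Δ_j f‖_{L²}` of the Besov space `B^s_{2,∞}(ℝ)`, with value `∞`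
if `f` does not belong to that space. -/
def besovNorm (χ φ : ℝ → ℝ) (s : ℝ) (f : 𝓢'(ℝ, ℂ)) : ℝ≥0∞ :=
  ⨆ (j : ℤ) (_ : -1 ≤ j), ENNReal.ofReal ((2 : ℝ) ^ (s * (j : ℝ))) * l2Norm (dyadicBlock χ φ j f)

/-- A tempered distribution is real-valued if it takes real values on real test functions. -/
def IsRealDistribution (f : 𝓢'(ℝ, ℂ)) : Prop :=
  ∀ ψ : 𝓢(ℝ, ℂ), (∀ x, (ψ x).im = 0) → (f ψ).im = 0

open Classical in
/-- The square-integrable function that represents `f` (and `0` if there is none). -/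
def l2Rep (f : 𝓢'(ℝ, ℂ)) : Lp ℂ 2 (volume : Measure ℝ) :=
  if h : ∃ g : Lp ℂ 2 (volume : Measure ℝ), (g : 𝓢'(ℝ, ℂ)) = f then h.choose else 0

/-- The pointwise product of two square-integrable functions, an integrable function, as
a tempered distribution. For `s > 3/2` every element of `B^s_{2,∞}(ℝ)` and its derivative are
square-integrable. -/
def l2Mul (f g : 𝓢'(ℝ, ℂ)) : 𝓢'(ℝ, ℂ) :=
  ((l2Rep f • l2Rep g : Lp ℂ 1 (volume : Measure ℝ)) : 𝓢'(ℝ, ℂ))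

/-- The distributional derivative `∂ₓ`. -/
def dx : 𝓢'(ℝ, ℂ) →L[ℂ] 𝓢'(ℝ, ℂ) := TemperedDistribution.derivCLM ℂ

/-- The operator `(1 - α² ∂ₓ²)⁻¹`, with symbol `1 / (1 + α² ξ²)`. -/
def helmholtzInv (α : ℝ) : 𝓢'(ℝ, ℂ) →L[ℂ] 𝓢'(ℝ, ℂ) :=
  multiplierD (fun ξ => (1 + α ^ 2 * ξ ^ 2)⁻¹)

/-- The value of `∂ₜ u` prescribed by the Camassa-Holm equation
`∂ₜ u + u ∂ₓ u = -∂ₓ (1 - α² ∂ₓ²)⁻¹ (u² + (α²/2) (∂ₓ u)²)`. -/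
def camassaHolmRHS (α : ℝ) (u : 𝓢'(ℝ, ℂ)) : 𝓢'(ℝ, ℂ) :=
  -l2Mul u (dx u)
    - dx (helmholtzInv α (l2Mul u u + ((α : ℂ) ^ 2 / 2) • l2Mul (dx u) (dx u)))

/-- `E₀(α, u) = -3 u ∂ₓ u - α² ∂ₓ³ (1 - α² ∂ₓ²)⁻¹ (u²) - (α²/2) ∂ₓ (1 - α² ∂ₓ²)⁻¹ (∂ₓ u)²`. -/
def camassaHolmE (α : ℝ) (u : 𝓢'(ℝ, ℂ)) : 𝓢'(ℝ, ℂ) :=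
  -((3 : ℂ) • l2Mul u (dx u))
    - ((α : ℂ) ^ 2) • dx (dx (dx (helmholtzInv α (l2Mul u u))))
    - ((α : ℂ) ^ 2 / 2) • dx (helmholtzInv α (l2Mul (dx u) (dx u)))

/-- `v` is a real-valued solution on `[0, T]`, of class `L^∞(0, T; B^s_{2,∞})`, of
the Camassa-Holm equation with parameter `α` and initial value `v₀`. The equation is meant in
the sense of distributions in `x` and is integrated in time; this makes `v` weakly continuous, so
that the bound in `B^s_{2,∞}` for almost every `t` is the same as the bound for every `t`. -/
structure IsCamassaHolmSolution (χ φ : ℝ → ℝ) (s α T : ℝ) (v₀ : 𝓢'(ℝ, ℂ))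
    (v : ℝ → 𝓢'(ℝ, ℂ)) : Prop where
  real : ∀ t ∈ Icc 0 T, IsRealDistribution (v t)
  bounded : ∃ M : ℝ≥0, ∀ t ∈ Icc 0 T, besovNorm χ φ s (v t) ≤ M
  integrable : ∀ ψ : 𝓢(ℝ, ℂ), ∀ t ∈ Icc 0 T,
    IntervalIntegrable (fun τ => camassaHolmRHS α (v τ) ψ) volume 0 t
  equation : ∀ ψ : 𝓢(ℝ, ℂ), ∀ t ∈ Icc 0 T,
    v t ψ = v₀ ψ + ∫ τ in (0 : ℝ)..t, camassaHolmRHS α (v τ) ψ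

end

/-!
The proof runs on the Fourier side. A distribution in `B^s_{2,∞}` with `s > 0` has a square-integrable
Fourier transform `f`, and its Besov norm is comparable to `bn s ‖f‖ₑ`, the supremum over dyadic
shells of weighted `L²` integrals (`IsLittlewoodPaleyPair.exists_hasFT`, `exists_besovNorm_le`).
Products become convolutions, and both the right-hand side of the Camassa-Holm equation and `E₀`
become the value `chForm α f f` of one bilinear form: for `E₀` this is the identity
`α²ξ² / (1 + α²ξ²) = 1 - 1 / (1 + α²ξ²)`. So `E₀(α, v₀) = ∂ₜv(0)`, and the claim is a Taylor
expansion of order two, with a remainder that has to be bounded uniformly in `α`.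

*A priori bound.* The hypothesis gives a bound for `v` in `B^s_{2,∞}` of unknown size, while the
constants may only depend on `R`. A bound in terms of `R` comes from energy estimates with the
truncated weights `V k i ξ = min (1 + |2πξ|) (2 ^ i) ^ k`, `k > s`. They are bounded functions, so
that the energies of a weak solution can be differentiated, and their growth as `i → ∞` characterizes
`B^s_{2,∞}` (`exists_lintegral_V_le`, `bn_le_of_lintegral_V_le`). The transport term loses one
derivative; symmetrizing the trilinear form in the two factors that carry the weight gains it back
(`kernel_bound`, `transport_energy_le`). In the term with `(∂ₓu)²` the symbol
`α²ξ / (1 + α²ξ²)` gains a derivative, uniformly in `α ∈ [0, 1]` (`symbol_mul_br_le`). Thus all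
energies grow at a rate bounded by the cube of the norm, and a continuation argument gives
`IsFourierSolution.exists_apriori`.

*Expansion.* The bilinear form maps `B^s × B^s` to `B^{s-1}`, so that `v(t) - v₀ = O(t)` in
`B^{s-1}`. It also maps `B^{s-1} × B^s` to `B^{s-2}` (`exists_bn_chForm_le_of_lower`); with
`B(f, f) - B(g, g) = B(f - g, f + g)` this shows that `∂ₜv(t) - E₀ = O(t)` in `B^{s-2}`, and
integrating in time gives `O(t²)`.

The equation only holds integrated in time and against test functions. The passage from there to
norms and energies is made in an abstract Hilbert space (`HasWeakIntegral.norm_sub_le`,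
`HasWeakIntegral.re_inner_le`).
-/

/-! ### Dyadic shells and the squared Besov norm on the Fourier side -/

/-- The inhomogeneous weight `1 + |2πξ|`, a function of the angular frequency `2πξ`. -/
noncomputable def br (ξ : ℝ) : ℝ := 1 + 2 * Real.pi * |ξ|

lemma one_le_br (ξ : ℝ) : 1 ≤ br ξ := by
  have := Real.pi_pos
  have : 0 ≤ 2 * Real.pi * |ξ| := by positivity
  unfold br; linarith

lemma br_pos (ξ : ℝ) : 0 < br ξ := lt_of_lt_of_le one_pos (one_le_br ξ)

lemma br_le_add (ξ ζ : ℝ) : br ξ ≤ br ζ + br (ξ - ζ) := by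
  have h : |ξ| ≤ |ζ| + |ξ - ζ| := by
    have := abs_add_le ζ (ξ - ζ); simpa using this
  have := mul_le_mul_of_nonneg_left h (by positivity : (0:ℝ) ≤ 2 * Real.pi)
  unfold br; linarith

lemma br_neg (ξ : ℝ) : br (-ξ) = br ξ := by simp [br]

lemma continuous_br : Continuous br := by unfold br; fun_prop

lemma measurable_br : Measurable br := continuous_br.measurable

lemma one_add_norm_le_br (ξ : ℝ) : 1 + ‖ξ‖ ≤ br ξ := by
  have h1 := Real.pi_gt_three
  have h2 := abs_nonneg ξ
  rw [Real.norm_eq_abs]; unfold br; nlinarith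

lemma abs_angular_le_br (ξ : ℝ) : |2 * Real.pi * ξ| ≤ br ξ := by
  rw [abs_mul, abs_of_pos (by positivity : 0 < 2 * Real.pi)]; unfold br; linarith

/-- The frequency shells `2^j ≤ 1 + |2πξ| < 2^(j+1)`, which partition the line. -/
def shell (j : ℕ) : Set ℝ := {ξ | 2 ^ j ≤ br ξ ∧ br ξ < 2 ^ (j + 1)}

lemma measurableSet_shell (j : ℕ) : MeasurableSet (shell j) :=
  (measurableSet_le measurable_const measurable_br).inter
    (measurableSet_lt measurable_br measurable_const)

lemma exists_mem_shell (ξ : ℝ) : ∃ j, ξ ∈ shell j :=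
  exists_nat_pow_near (one_le_br ξ) one_lt_two

lemma iUnion_shell : ⋃ j, shell j = univ := by
  ext ξ; simpa using exists_mem_shell ξ

lemma pairwise_disjoint_shell : Pairwise (Function.onFun Disjoint shell) := by
  have key : ∀ i j ξ, ξ ∈ shell i → ξ ∈ shell j → i ≤ j := by
    intro i j ξ hi hj
    have h : (2:ℝ) ^ i < 2 ^ (j + 1) := hi.1.trans_lt hj.2
    have := (pow_lt_pow_iff_right₀ (one_lt_two (α := ℝ))).1 h
    omega
  intro i j hij
  rw [Function.onFun, Set.disjoint_left]
  intro ξ hi hj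
  exact hij (le_antisymm (key i j ξ hi hj) (key j i ξ hj hi))

lemma lintegral_eq_tsum_shell (F : ℝ → ℝ≥0∞) :
    ∫⁻ ξ, F ξ = ∑' j, ∫⁻ ξ in shell j, F ξ := by
  rw [← lintegral_iUnion measurableSet_shell pairwise_disjoint_shell, iUnion_shell,
    setLIntegral_univ]

lemma volume_shell_le (j : ℕ) : volume (shell j) ≤ ENNReal.ofReal (2 ^ (j + 1)) := by
  have hsub : shell j ⊆ Icc (-(2 ^ j)) (2 ^ j) := by
    intro ξ hξ
    have h1 := hξ.2
    have h2 := Real.pi_gt_three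
    have h3 := abs_nonneg ξ
    rw [pow_succ] at h1
    unfold br at h1
    have h4 : |ξ| ≤ 2 ^ j := by nlinarith
    exact abs_le.1 h4
  refine (measure_mono hsub).trans ?_
  rw [Real.volume_Icc]
  apply ENNReal.ofReal_le_ofReal
  rw [pow_succ]; linarith

/-- The square of the norm `sup_j 2^(σj) ‖F‖_{L²(shell j)}`, a version of the `B^σ_{2,∞}` norm of
a function whose Fourier transform has absolute value `F`. -/
noncomputable def bn (σ : ℝ) (F : ℝ → ℝ≥0∞) : ℝ≥0∞ :=
  ⨆ j : ℕ, ENNReal.ofReal ((2:ℝ) ^ (2 * σ * j)) * ∫⁻ ξ in shell j, F ξ ^ 2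

lemma ofReal_two_rpow_mul_neg (x : ℝ) :
    ENNReal.ofReal ((2:ℝ) ^ (-x)) * ENNReal.ofReal ((2:ℝ) ^ x) = 1 := by
  rw [← ENNReal.ofReal_mul (by positivity), ← Real.rpow_add (by norm_num)]; simp

lemma ofReal_two_rpow_mul (x y : ℝ) :
    ENNReal.ofReal ((2:ℝ) ^ x) * ENNReal.ofReal ((2:ℝ) ^ y) = ENNReal.ofReal ((2:ℝ) ^ (x + y)) := by
  rw [← ENNReal.ofReal_mul (by positivity), ← Real.rpow_add (by norm_num)]

lemma setLIntegral_shell_le (σ : ℝ) (F : ℝ → ℝ≥0∞) (j : ℕ) :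
    ∫⁻ ξ in shell j, F ξ ^ 2 ≤ ENNReal.ofReal ((2:ℝ) ^ (-(2 * σ * j))) * bn σ F := by
  have h : ENNReal.ofReal ((2:ℝ) ^ (2 * σ * j)) * ∫⁻ ξ in shell j, F ξ ^ 2 ≤ bn σ F :=
    le_iSup (fun j : ℕ => ENNReal.ofReal ((2:ℝ) ^ (2 * σ * j)) * ∫⁻ ξ in shell j, F ξ ^ 2) j
  calc ∫⁻ ξ in shell j, F ξ ^ 2
      = ENNReal.ofReal ((2:ℝ) ^ (-(2 * σ * j))) *
        (ENNReal.ofReal ((2:ℝ) ^ (2 * σ * j)) * ∫⁻ ξ in shell j, F ξ ^ 2) := by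
          rw [← mul_assoc, ofReal_two_rpow_mul_neg, one_mul]
    _ ≤ _ := by gcongr

lemma bn_le {σ : ℝ} {F : ℝ → ℝ≥0∞} {B : ℝ≥0∞}
    (h : ∀ j : ℕ, ∫⁻ ξ in shell j, F ξ ^ 2 ≤ ENNReal.ofReal ((2:ℝ) ^ (-(2 * σ * j))) * B) :
    bn σ F ≤ B := by
  refine iSup_le fun j => ?_
  calc _ ≤ ENNReal.ofReal ((2:ℝ) ^ (2 * σ * j)) *
        (ENNReal.ofReal ((2:ℝ) ^ (-(2 * σ * j))) * B) := by gcongr; exact h j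
    _ = B := by rw [← mul_assoc, mul_comm (ENNReal.ofReal _), ofReal_two_rpow_mul_neg, one_mul]

lemma bn_mono {σ : ℝ} {F G : ℝ → ℝ≥0∞} (h : ∀ᵐ ξ, F ξ ≤ G ξ) : bn σ F ≤ bn σ G := by
  refine iSup_mono fun j => ?_
  refine mul_le_mul_right (lintegral_mono_ae ?_) _
  filter_upwards [ae_restrict_of_ae h] with ξ hξ
  gcongr

lemma bn_mono_left {σ τ : ℝ} (h : σ ≤ τ) (F : ℝ → ℝ≥0∞) : bn σ F ≤ bn τ F := by
  refine iSup_mono fun j => ?_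
  gcongr
  norm_num

lemma bn_const_mul {σ : ℝ} {c : ℝ≥0∞} (hc : c ≠ ⊤) (F : ℝ → ℝ≥0∞) :
    bn σ (fun ξ => c * F ξ) = c ^ 2 * bn σ F := by
  unfold bn
  rw [ENNReal.mul_iSup]
  congr 1; ext j
  simp_rw [mul_pow]
  rw [lintegral_const_mul' _ _ (by finiteness)]
  ring

lemma bn_add_le {σ : ℝ} {F : ℝ → ℝ≥0∞} (hF : Measurable F) (G : ℝ → ℝ≥0∞) :
    bn σ (fun ξ => F ξ + G ξ) ≤ 2 * bn σ F + 2 * bn σ G := by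
  refine bn_le fun j => ?_
  calc ∫⁻ ξ in shell j, (F ξ + G ξ) ^ 2 ≤ ∫⁻ ξ in shell j, (2 * F ξ ^ 2 + 2 * G ξ ^ 2) := by
        refine lintegral_mono fun ξ => ?_
        have := ENNReal.rpow_add_le_mul_rpow_add_rpow (F ξ) (G ξ) (p := 2) (by norm_num)
        norm_num at this
        rw [← mul_add]; exact this
    _ = 2 * (∫⁻ ξ in shell j, F ξ ^ 2) + 2 * ∫⁻ ξ in shell j, G ξ ^ 2 := by
        rw [lintegral_add_left (by fun_prop), lintegral_const_mul' _ _ (by norm_num),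
          lintegral_const_mul' _ _ (by norm_num)]
    _ ≤ 2 * (ENNReal.ofReal ((2:ℝ) ^ (-(2 * σ * j))) * bn σ F) +
        2 * (ENNReal.ofReal ((2:ℝ) ^ (-(2 * σ * j))) * bn σ G) := by
        gcongr <;> exact setLIntegral_shell_le _ _ _
    _ = _ := by ring

/-- A factor `(1 + |2πξ|)^a` shifts the regularity index by `a`. -/
lemma bn_rpow_mul_le (σ : ℝ) {a : ℝ} (ha : 0 ≤ a) (F : ℝ → ℝ≥0∞) :
    bn σ (fun ξ => ENNReal.ofReal (br ξ ^ a) * F ξ) ≤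
      ENNReal.ofReal ((2:ℝ) ^ (2 * a)) * bn (σ + a) F := by
  refine bn_le fun j => ?_
  calc ∫⁻ ξ in shell j, (ENNReal.ofReal (br ξ ^ a) * F ξ) ^ 2
      ≤ ∫⁻ ξ in shell j, ENNReal.ofReal ((2:ℝ) ^ (2 * a * (j + 1))) * F ξ ^ 2 := by
        refine setLIntegral_mono' (measurableSet_shell j) fun ξ hξ => ?_
        rw [mul_pow, ← ENNReal.ofReal_pow (by have := br_pos ξ; positivity)]
        gcongr
        calc (br ξ ^ a) ^ 2 ≤ (((2:ℝ) ^ (j + 1)) ^ a) ^ 2 := by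
              have := (br_pos ξ).le
              gcongr; exact hξ.2.le
          _ = (2:ℝ) ^ (2 * a * (j + 1)) := by
              rw [← Real.rpow_natCast 2 (j + 1), ← Real.rpow_mul (by norm_num),
                ← Real.rpow_natCast _ 2, ← Real.rpow_mul (by norm_num)]
              congr 1; push_cast; ring
    _ ≤ ENNReal.ofReal ((2:ℝ) ^ (2 * a * (j + 1))) *
        (ENNReal.ofReal ((2:ℝ) ^ (-(2 * (σ + a) * j))) * bn (σ + a) F) := by
        rw [lintegral_const_mul' _ _ (by finiteness)]
        gcongr; exact setLIntegral_shell_le _ _ _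
    _ = _ := by
        rw [← mul_assoc, ← mul_assoc, ofReal_two_rpow_mul, ofReal_two_rpow_mul]
        congr 3; ring

lemma lintegral_weight_le (σ : ℝ) {w : ℝ → ℝ≥0∞} {c : ℕ → ℝ≥0∞} (hc : ∀ j, c j ≠ ⊤)
    (hw : ∀ j, ∀ ξ ∈ shell j, w ξ ≤ c j) (F : ℝ → ℝ≥0∞) :
    ∫⁻ ξ, w ξ * F ξ ^ 2 ≤ (∑' j : ℕ, c j * ENNReal.ofReal ((2:ℝ) ^ (-(2 * σ * j)))) * bn σ F := by
  rw [lintegral_eq_tsum_shell, ← ENNReal.tsum_mul_right]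
  refine ENNReal.tsum_le_tsum fun j => ?_
  calc ∫⁻ ξ in shell j, w ξ * F ξ ^ 2 ≤ ∫⁻ ξ in shell j, c j * F ξ ^ 2 := by
        refine setLIntegral_mono' (measurableSet_shell j) fun ξ hξ => ?_
        gcongr; exact hw j ξ hξ
    _ ≤ c j * (ENNReal.ofReal ((2:ℝ) ^ (-(2 * σ * j))) * bn σ F) := by
        rw [lintegral_const_mul' _ _ (hc j)]
        gcongr; exact setLIntegral_shell_le _ _ _
    _ = _ := by ring

lemma tsum_two_rpow_ne_top {a : ℝ} (ha : 0 < a) :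
    ∑' j : ℕ, ENNReal.ofReal ((2:ℝ) ^ (-(a * j))) ≠ ⊤ := by
  have h : ∀ j : ℕ, ENNReal.ofReal ((2:ℝ) ^ (-(a * j))) = ENNReal.ofReal ((2:ℝ) ^ (-a)) ^ j := by
    intro j
    rw [← ENNReal.ofReal_pow (by positivity), ← Real.rpow_natCast, ← Real.rpow_mul (by norm_num)]
    congr 2; ring
  simp_rw [h]
  rw [ENNReal.tsum_geometric]
  have : ENNReal.ofReal ((2:ℝ) ^ (-a)) < 1 := by
    rw [← ENNReal.ofReal_one]
    exact (ENNReal.ofReal_lt_ofReal_iff one_pos).2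
      (Real.rpow_lt_one_of_one_lt_of_neg one_lt_two (by linarith))
  rw [Ne, ENNReal.inv_eq_top]
  exact (tsub_pos_of_lt this).ne'

lemma exists_lintegral_sq_le {σ : ℝ} (hσ : 0 < σ) :
    ∃ C : ℝ≥0, ∀ F : ℝ → ℝ≥0∞, ∫⁻ ξ, F ξ ^ 2 ≤ C * bn σ F := by
  have hS := tsum_two_rpow_ne_top (mul_pos two_pos hσ)
  refine ⟨(∑' j : ℕ, ENNReal.ofReal ((2:ℝ) ^ (-(2 * σ * j)))).toNNReal, fun F => ?_⟩
  rw [ENNReal.coe_toNNReal hS]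
  simpa using lintegral_weight_le σ (w := fun _ => 1) (c := fun _ => 1) (by simp) (by simp) F

lemma sq_lintegral_mul_le {α : Type*} [MeasurableSpace α] {μ : Measure α} {f g : α → ℝ≥0∞}
    (hf : AEMeasurable f μ) (hg : AEMeasurable g μ) :
    (∫⁻ x, f x * g x ∂μ) ^ 2 ≤ (∫⁻ x, f x ^ 2 ∂μ) * ∫⁻ x, g x ^ 2 ∂μ := by
  have h := ENNReal.lintegral_mul_le_Lp_mul_Lq μ Real.HolderConjugate.two_two hf hg
  have h2 := pow_le_pow_left' h 2
  refine h2.trans (le_of_eq ?_)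
  rw [mul_pow, ← ENNReal.rpow_natCast, ← ENNReal.rpow_mul, ← ENNReal.rpow_natCast,
    ← ENNReal.rpow_mul]
  norm_num

/-- For `σ > 1/2` the Fourier transform of an element of `B^σ_{2,∞}` is integrable. -/
lemma exists_sq_lintegral_le {σ : ℝ} (hσ : 1 / 2 < σ) :
    ∃ C : ℝ≥0, ∀ F : ℝ → ℝ≥0∞, Measurable F → (∫⁻ ξ, F ξ) ^ 2 ≤ C * bn σ F := by
  obtain ⟨a, ha, haσ⟩ := exists_between hσ
  have hI : ∫⁻ ξ, ENNReal.ofReal (br ξ ^ (-(a))) ^ 2 ≠ ⊤ := by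
    have h := finite_integral_one_add_norm (E := ℝ) (μ := volume) (r := 2 * a)
      (by simp; linarith)
    refine ((lintegral_mono fun ξ => ?_).trans_lt h).ne
    have hb := br_pos ξ
    rw [← ENNReal.ofReal_pow (by positivity), ← Real.rpow_natCast, ← Real.rpow_mul hb.le]
    apply ENNReal.ofReal_le_ofReal
    rw [show -a * ((2:ℕ):ℝ) = -(2 * a) by push_cast; ring]
    exact Real.rpow_le_rpow_of_nonpos (by positivity) (one_add_norm_le_br ξ) (by linarith)
  have hS := tsum_two_rpow_ne_top (mul_pos two_pos (sub_pos.2 haσ))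
  set S := ∑' j : ℕ, ENNReal.ofReal ((2:ℝ) ^ (-(2 * (σ - a) * j)))
  refine ⟨((∫⁻ ξ, ENNReal.ofReal (br ξ ^ (-a)) ^ 2) *
    (ENNReal.ofReal ((2:ℝ) ^ (2 * a)) * S)).toNNReal, fun F hF => ?_⟩
  rw [ENNReal.coe_toNNReal (by finiteness)]
  have hmul : ∀ ξ, ENNReal.ofReal (br ξ ^ (-a)) * (ENNReal.ofReal (br ξ ^ a) * F ξ) = F ξ := by
    intro ξ
    have hb := br_pos ξ
    rw [← mul_assoc, ← ENNReal.ofReal_mul (by positivity), ← Real.rpow_add hb]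
    simp
  calc (∫⁻ ξ, F ξ) ^ 2
      = (∫⁻ ξ, ENNReal.ofReal (br ξ ^ (-a)) * (ENNReal.ofReal (br ξ ^ a) * F ξ)) ^ 2 := by
        simp_rw [hmul]
    _ ≤ (∫⁻ ξ, ENNReal.ofReal (br ξ ^ (-a)) ^ 2) *
        ∫⁻ ξ, (ENNReal.ofReal (br ξ ^ a) * F ξ) ^ 2 := by
        have := measurable_br
        exact sq_lintegral_mul_le (by fun_prop) (by fun_prop)
    _ ≤ _ := by
        rw [mul_assoc]
        gcongr
        have h1 := lintegral_weight_le (σ - a) (w := fun _ => 1) (c := fun _ => 1)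
          (by simp) (by simp) (fun ξ => ENNReal.ofReal (br ξ ^ a) * F ξ)
        simp only [one_mul] at h1
        have h2 := bn_rpow_mul_le (σ - a) (by linarith : 0 ≤ a) F
        rw [sub_add_cancel] at h2
        calc _ ≤ _ := h1
          _ ≤ S * (ENNReal.ofReal ((2:ℝ) ^ (2 * a)) * bn σ F) := by gcongr
          _ = _ := by ring

/-! ### Truncated polynomial weights -/

/-- The bounded weights `min(1 + |2πξ|, 2^i)^k`. -/
noncomputable def V (k i : ℕ) (ξ : ℝ) : ℝ := min (br ξ) (2 ^ i) ^ k

lemma min_br_pos (i : ℕ) (ξ : ℝ) : 0 < min (br ξ) (2 ^ i) := lt_min (br_pos ξ) (by positivity)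

lemma V_pos (k i : ℕ) (ξ : ℝ) : 0 < V k i ξ := pow_pos (min_br_pos i ξ) k

lemma measurable_V (k i : ℕ) : Measurable (V k i) := by
  unfold V; exact (measurable_br.min measurable_const).pow_const k

lemma V_le (k i : ℕ) (ξ : ℝ) : V k i ξ ≤ (2 ^ i) ^ k :=
  pow_le_pow_left₀ (min_br_pos i ξ).le (min_le_right _ _) k


/-- `br ξ ≤ c · br ζ` with `c ≥ 1` passes to the weights. -/
lemma V_le_of_br_le (k i : ℕ) {c ξ ζ : ℝ} (hc : 1 ≤ c) (h : br ξ ≤ c * br ζ) :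
    V k i ξ ≤ c ^ k * V k i ζ := by
  unfold V
  rw [← mul_pow]
  refine pow_le_pow_left₀ (min_br_pos i ξ).le ?_ k
  rw [mul_min_of_nonneg _ _ (by linarith)]
  refine min_le_min h ?_
  have : (0:ℝ) < 2 ^ i := by positivity
  nlinarith

lemma V_le_add (k i : ℕ) (ξ ζ : ℝ) : V k i ξ ≤ 2 ^ k * (V k i ζ + V k i (ξ - ζ)) := by
  have h := br_le_add ξ ζ
  have h1 := V_pos k i ζ
  have h2 := V_pos k i (ξ - ζ)
  rcases le_total (br ζ) (br (ξ - ζ)) with h3 | h3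
  · have := V_le_of_br_le k i one_le_two (show br ξ ≤ 2 * br (ξ - ζ) by linarith)
    have : 0 < (2:ℝ) ^ k * V k i ζ := by positivity
    linarith
  · have := V_le_of_br_le k i one_le_two (show br ξ ≤ 2 * br ζ by linarith)
    have : 0 < (2:ℝ) ^ k * V k i (ξ - ζ) := by positivity
    linarith

/-- The integrals with truncated weights grow no faster than the Besov norm allows; the converse is
`bn_le_of_lintegral_V_le`. -/
lemma exists_lintegral_V_le {σ : ℝ} {k : ℕ} (hσ : 0 < σ) (hk : σ < k) :
    ∃ C : ℝ≥0, ∀ (i : ℕ) (F : ℝ → ℝ≥0∞), ∫⁻ ξ, ENNReal.ofReal (V k i ξ) ^ 2 * F ξ ^ 2 ≤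
      C * (ENNReal.ofReal ((2:ℝ) ^ (2 * (k - σ) * i)) * bn σ F) := by
  have hS := tsum_two_rpow_ne_top (mul_pos two_pos hσ)
  set S := ∑' j : ℕ, ENNReal.ofReal ((2:ℝ) ^ (-(2 * σ * j)))
  set q : ℝ := (2:ℝ) ^ (2 * (k - σ)) with hq
  have hq1 : 1 < q := Real.one_lt_rpow one_lt_two (by linarith)
  have hqi : ∀ i : ℕ, q ^ i = (2:ℝ) ^ (2 * (k - σ) * i) := fun i => by
    rw [hq, ← Real.rpow_natCast, ← Real.rpow_mul (by norm_num)]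
  refine ⟨(ENNReal.ofReal (4 ^ k * (q - 1)⁻¹) + S).toNNReal, fun i F => ?_⟩
  rw [ENNReal.coe_toNNReal (by finiteness)]
  set c : ℕ → ℝ≥0∞ := fun j => ENNReal.ofReal ((min (2 ^ (j + 1)) (2 ^ i) : ℝ) ^ (2 * k)) with hc
  have h := lintegral_weight_le σ (w := fun ξ => ENNReal.ofReal (V k i ξ) ^ 2) (c := c)
    (by simp [hc]) ?_ F
  swap
  · intro j ξ hξ
    rw [hc, ← ENNReal.ofReal_pow (V_pos k i ξ).le]
    apply ENNReal.ofReal_le_ofReal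
    rw [V, ← pow_mul, mul_comm k 2]
    exact pow_le_pow_left₀ (min_br_pos i ξ).le (min_le_min hξ.2.le le_rfl) _
  refine h.trans ?_
  rw [← mul_assoc]
  gcongr
  rw [← Summable.sum_add_tsum_nat_add' (k := i) ENNReal.summable, add_mul]
  gcongr
  · calc ∑ j ∈ Finset.range i, c j * ENNReal.ofReal ((2:ℝ) ^ (-(2 * σ * j)))
        ≤ ∑ j ∈ Finset.range i, ENNReal.ofReal (4 ^ k * q ^ j) := by
          refine Finset.sum_le_sum fun j _ => ?_
          rw [hc, ← ENNReal.ofReal_mul (by positivity)]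
          apply ENNReal.ofReal_le_ofReal
          calc (min (2 ^ (j + 1)) (2 ^ i) : ℝ) ^ (2 * k) * (2:ℝ) ^ (-(2 * σ * j))
              ≤ ((2:ℝ) ^ (j + 1)) ^ (2 * k) * (2:ℝ) ^ (-(2 * σ * j)) := by
                gcongr; exact min_le_left _ _
            _ = 4 ^ k * q ^ j := by
                rw [hqi, pow_succ, mul_pow, ← pow_mul, pow_mul 2 2 k,
                  show (2 * (k - σ) * j : ℝ) = ((j * (2 * k) : ℕ) : ℝ) + -(2 * σ * j) by
                    push_cast; ring, Real.rpow_add (by norm_num), Real.rpow_natCast]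
                norm_num; ring
      _ = ENNReal.ofReal (∑ j ∈ Finset.range i, 4 ^ k * q ^ j) :=
          (ENNReal.ofReal_sum_of_nonneg fun j _ => by positivity).symm
      _ ≤ ENNReal.ofReal (4 ^ k * (q - 1)⁻¹) * ENNReal.ofReal ((2:ℝ) ^ (2 * (k - σ) * i)) := by
          rw [← ENNReal.ofReal_mul (by have := sub_pos.2 hq1; positivity)]
          apply ENNReal.ofReal_le_ofReal
          rw [← Finset.mul_sum, geom_sum_eq hq1.ne', ← hqi, div_eq_mul_inv]
          have := sub_pos.2 hq1
          have h4 : (0:ℝ) < 4 ^ k * (q - 1)⁻¹ := by positivity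
          nlinarith
  · rw [mul_comm S, ← ENNReal.tsum_mul_left]
    refine ENNReal.tsum_le_tsum fun j => ?_
    rw [hc, ← ENNReal.ofReal_mul (by positivity), ofReal_two_rpow_mul]
    apply ENNReal.ofReal_le_ofReal
    calc (min (2 ^ (j + i + 1)) (2 ^ i) : ℝ) ^ (2 * k) * (2:ℝ) ^ (-(2 * σ * ((j + i : ℕ) : ℝ)))
        ≤ ((2:ℝ) ^ i) ^ (2 * k) * (2:ℝ) ^ (-(2 * σ * ((j + i : ℕ) : ℝ))) := by
          gcongr; exact min_le_right _ _
      _ = _ := by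
          rw [← pow_mul, ← Real.rpow_natCast, ← Real.rpow_add (by norm_num)]
          congr 1; push_cast; ring

lemma V_eq_of_mem_shell {k j : ℕ} {ξ : ℝ} (h : ξ ∈ shell j) : V k j ξ = (2 ^ j) ^ k := by
  rw [V, min_eq_right h.1]

/-- Control of all the weighted `L²` norms controls the Besov norm. -/
lemma bn_le_of_lintegral_V_le {σ : ℝ} {k : ℕ} {F : ℝ → ℝ≥0∞} {B : ℝ≥0∞}
    (h : ∀ i : ℕ, ∫⁻ ξ, ENNReal.ofReal (V k i ξ) ^ 2 * F ξ ^ 2 ≤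
      ENNReal.ofReal ((2:ℝ) ^ (2 * (k - σ) * i)) * B) : bn σ F ≤ B := by
  refine bn_le fun j => ?_
  have h1 : ENNReal.ofReal ((2:ℝ) ^ (2 * (k:ℝ) * j)) * ∫⁻ ξ in shell j, F ξ ^ 2 ≤
      ENNReal.ofReal ((2:ℝ) ^ (2 * (k - σ) * j)) * B := by
    refine le_trans ?_ (h j)
    rw [← lintegral_const_mul' _ _ (by finiteness)]
    refine le_trans ?_ (setLIntegral_le_lintegral (shell j) _)
    refine setLIntegral_mono' (measurableSet_shell j) fun ξ hξ => ?_
    gcongr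
    rw [V_eq_of_mem_shell hξ, ← ENNReal.ofReal_pow (by positivity), ← pow_mul, ← pow_mul,
      ← Real.rpow_natCast]
    apply ENNReal.ofReal_le_ofReal
    apply le_of_eq; congr 1; push_cast; ring
  calc ∫⁻ ξ in shell j, F ξ ^ 2
      = ENNReal.ofReal ((2:ℝ) ^ (-(2 * (k:ℝ) * j))) *
        (ENNReal.ofReal ((2:ℝ) ^ (2 * (k:ℝ) * j)) * ∫⁻ ξ in shell j, F ξ ^ 2) := by
          rw [← mul_assoc, ofReal_two_rpow_mul_neg, one_mul]
    _ ≤ ENNReal.ofReal ((2:ℝ) ^ (-(2 * (k:ℝ) * j))) *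
        (ENNReal.ofReal ((2:ℝ) ^ (2 * (k - σ) * j)) * B) := by gcongr
    _ = _ := by
        rw [← mul_assoc, ofReal_two_rpow_mul]
        congr 3; ring

/-! ### Convolutions of nonnegative functions -/

/-- The convolution of two nonnegative functions on the line. -/
noncomputable def lconv (F G : ℝ → ℝ≥0∞) (ξ : ℝ) : ℝ≥0∞ := ∫⁻ ζ, F ζ * G (ξ - ζ)

lemma measurable_lconv {F G : ℝ → ℝ≥0∞} (hF : Measurable F) (hG : Measurable G) :
    Measurable (lconv F G) := by
  unfold lconv
  exact Measurable.lintegral_prod_right' (f := fun p : ℝ × ℝ => F p.2 * G (p.1 - p.2))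
    (by fun_prop)

lemma lconv_comm (F G : ℝ → ℝ≥0∞) : lconv F G = lconv G F := by
  ext ξ
  unfold lconv
  rw [← lintegral_sub_left_eq_self _ ξ]
  simp [mul_comm]

lemma lconv_mono {F F' G G' : ℝ → ℝ≥0∞} (hF : ∀ ξ, F ξ ≤ F' ξ) (hG : ∀ ξ, G ξ ≤ G' ξ) (ξ : ℝ) :
    lconv F G ξ ≤ lconv F' G' ξ :=
  lintegral_mono fun ζ => mul_le_mul' (hF ζ) (hG _)

lemma lintegral_comp_sub (F : ℝ → ℝ≥0∞) (ξ : ℝ) : ∫⁻ ζ, F (ξ - ζ) = ∫⁻ ζ, F ζ :=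
  lintegral_sub_left_eq_self F ξ

lemma lconv_sq_le {F G : ℝ → ℝ≥0∞} (hF : Measurable F) (hG : Measurable G) (ξ : ℝ) :
    lconv F G ξ ^ 2 ≤ (∫⁻ ζ, F ζ ^ 2) * ∫⁻ ζ, G ζ ^ 2 := by
  have h := sq_lintegral_mul_le (μ := volume) (f := F) (g := fun ζ => G (ξ - ζ)) (by fun_prop)
    (by fun_prop)
  rwa [lintegral_comp_sub (fun ζ => G ζ ^ 2) ξ] at h

/-- Young's inequality `‖F ⋆ G‖₂ ≤ ‖F‖₁ ‖G‖₂`, squared. -/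
lemma lintegral_lconv_sq_le {F G : ℝ → ℝ≥0∞} (hF : Measurable F) (hG : Measurable G) :
    ∫⁻ ξ, lconv F G ξ ^ 2 ≤ (∫⁻ ξ, F ξ) ^ 2 * ∫⁻ ξ, G ξ ^ 2 := by
  have hG' : ∀ ξ, Measurable fun ζ => G (ξ - ζ) :=
    fun ξ => hG.comp (measurable_const.sub measurable_id)
  have h1 : ∀ ξ, lconv F G ξ ^ 2 ≤ (∫⁻ ζ, F ζ) * ∫⁻ ζ, F ζ * G (ξ - ζ) ^ 2 := by
    intro ξ
    have hh : ∀ x : ℝ≥0∞, x ^ (1 / 2 : ℝ) * x ^ (1 / 2 : ℝ) = x := fun x => by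
      rw [← ENNReal.rpow_add_of_nonneg _ _ (by norm_num) (by norm_num)]; norm_num
    have hG'' := hG' ξ
    have h := sq_lintegral_mul_le (μ := volume) (f := fun ζ => F ζ ^ (1 / 2 : ℝ))
      (g := fun ζ => F ζ ^ (1 / 2 : ℝ) * G (ξ - ζ)) (by fun_prop) (by fun_prop)
    simp_rw [mul_pow, sq (_ ^ (1 / 2 : ℝ)), ← mul_assoc, hh] at h
    exact h
  calc ∫⁻ ξ, lconv F G ξ ^ 2 ≤ ∫⁻ ξ, (∫⁻ ζ, F ζ) * ∫⁻ ζ, F ζ * G (ξ - ζ) ^ 2 := lintegral_mono h1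
    _ = (∫⁻ ζ, F ζ) * ∫⁻ ξ, ∫⁻ ζ, F ζ * G (ξ - ζ) ^ 2 := by
        rw [lintegral_const_mul]
        exact Measurable.lintegral_prod_right'
          (f := fun p : ℝ × ℝ => F p.2 * G (p.1 - p.2) ^ 2) (by fun_prop)
    _ = (∫⁻ ζ, F ζ) * ∫⁻ ζ, ∫⁻ ξ, F ζ * G (ξ - ζ) ^ 2 := by
        rw [lintegral_lintegral_swap]
        exact (by fun_prop : Measurable fun p : ℝ × ℝ => F p.2 * G (p.1 - p.2) ^ 2).aemeasurable
    _ = (∫⁻ ζ, F ζ) * ∫⁻ ζ, F ζ * ∫⁻ ξ, G ξ ^ 2 := by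
        congr 2; ext ζ
        rw [lintegral_const_mul _ (by fun_prop), lintegral_sub_right_eq_self (fun ξ => G ξ ^ 2) ζ]
    _ = _ := by rw [lintegral_mul_const _ hF]; ring

lemma V_mul_lconv_le (k i : ℕ) {F G : ℝ → ℝ≥0∞} (hF : Measurable F) (hG : Measurable G) (ξ : ℝ) :
    ENNReal.ofReal (V k i ξ) * lconv F G ξ ≤
      2 ^ k * (lconv (fun ζ => ENNReal.ofReal (V k i ζ) * F ζ) G ξ +
        lconv F (fun ζ => ENNReal.ofReal (V k i ζ) * G ζ) ξ) := by
  have hV := measurable_V k i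
  unfold lconv
  rw [← lintegral_add_left (by fun_prop), ← lintegral_const_mul' _ _ (by finiteness),
    ← lintegral_const_mul' _ _ (by finiteness)]
  refine lintegral_mono fun ζ => ?_
  have h := ENNReal.ofReal_le_ofReal (V_le_add k i ξ ζ)
  rw [ENNReal.ofReal_mul (by positivity), ENNReal.ofReal_add (V_pos k i ζ).le (V_pos k i _).le,
    ENNReal.ofReal_pow (by norm_num), ENNReal.ofReal_ofNat] at h
  calc ENNReal.ofReal (V k i ξ) * (F ζ * G (ξ - ζ)) ≤
      2 ^ k * (ENNReal.ofReal (V k i ζ) + ENNReal.ofReal (V k i (ξ - ζ))) * (F ζ * G (ξ - ζ)) := by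
        gcongr
    _ = _ := by ring

lemma ENNReal.add_sq_le (x y : ℝ≥0∞) : (x + y) ^ 2 ≤ 2 * (x ^ 2 + y ^ 2) := by
  have := ENNReal.rpow_add_le_mul_rpow_add_rpow x y (p := 2) (by norm_num)
  norm_num at this
  exact this

/-- `B^σ_{2,∞}` is an algebra for `σ > 1/2`. -/
lemma exists_bn_lconv_le {σ : ℝ} (hσ : 1 / 2 < σ) :
    ∃ C : ℝ≥0, ∀ F G : ℝ → ℝ≥0∞, Measurable F → Measurable G →
      bn σ (lconv F G) ≤ C * (bn σ F * bn σ G) := by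
  obtain ⟨k, hk⟩ := exists_nat_gt σ
  obtain ⟨C₁, hC₁⟩ := exists_sq_lintegral_le hσ
  obtain ⟨C₂, hC₂⟩ := exists_lintegral_V_le (by linarith : 0 < σ) hk
  refine ⟨(2 ^ k) ^ 2 * 2 * (2 * (C₁ * C₂)), fun F G hF hG => ?_⟩
  have hV := fun i => measurable_V k i
  refine bn_le_of_lintegral_V_le (k := k) fun i => ?_
  have hVi := hV i
  have key : ∀ F G : ℝ → ℝ≥0∞, Measurable F → Measurable G →
      ∫⁻ ξ, lconv (fun ζ => ENNReal.ofReal (V k i ζ) * F ζ) G ξ ^ 2 ≤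
        C₁ * C₂ * (ENNReal.ofReal ((2:ℝ) ^ (2 * (k - σ) * i)) * (bn σ F * bn σ G)) := by
    intro F G hF hG
    rw [lconv_comm]
    refine (lintegral_lconv_sq_le hG (by fun_prop)).trans ?_
    simp_rw [mul_pow]
    calc _ ≤ (C₁ * bn σ G) * (C₂ * (ENNReal.ofReal ((2:ℝ) ^ (2 * (k - σ) * i)) * bn σ F)) := by
          gcongr
          · exact hC₁ G hG
          · exact hC₂ i F
      _ = _ := by ring
  calc ∫⁻ ξ, ENNReal.ofReal (V k i ξ) ^ 2 * lconv F G ξ ^ 2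
      ≤ ∫⁻ ξ, (2 ^ k) ^ 2 * 2 * (lconv (fun ζ => ENNReal.ofReal (V k i ζ) * F ζ) G ξ ^ 2 +
        lconv F (fun ζ => ENNReal.ofReal (V k i ζ) * G ζ) ξ ^ 2) := by
        refine lintegral_mono fun ξ => ?_
        rw [← mul_pow]
        refine (pow_le_pow_left' (V_mul_lconv_le k i hF hG ξ) 2).trans ?_
        rw [mul_pow, mul_assoc]
        gcongr
        exact ENNReal.add_sq_le _ _
    _ = (2 ^ k) ^ 2 * 2 * ((∫⁻ ξ, lconv (fun ζ => ENNReal.ofReal (V k i ζ) * F ζ) G ξ ^ 2) +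
        ∫⁻ ξ, lconv F (fun ζ => ENNReal.ofReal (V k i ζ) * G ζ) ξ ^ 2) := by
        rw [lintegral_const_mul' _ _ (by finiteness), lintegral_add_left]
        exact (measurable_lconv (F := fun ζ => ENNReal.ofReal (V k i ζ) * F ζ) (by fun_prop)
          hG).pow_const 2
    _ ≤ (2 ^ k) ^ 2 * 2 *
        (C₁ * C₂ * (ENNReal.ofReal ((2:ℝ) ^ (2 * (k - σ) * i)) * (bn σ F * bn σ G)) +
        C₁ * C₂ * (ENNReal.ofReal ((2:ℝ) ^ (2 * (k - σ) * i)) * (bn σ G * bn σ F))) := by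
        gcongr
        · exact key F G hF hG
        · rw [lconv_comm]; exact key G F hG hF
    _ = _ := by push_cast; ring

/-- The product of two elements of `B^δ_{2,∞}`, `δ > 0`, lies in `B^{δ-1/2}_{2,∞}`: the Cauchy-Schwarz
inequality gives a pointwise bound for its Fourier transform, and a shell of size `2^j` has measure
about `2^j`. -/
lemma exists_bn_lconv_le_of_pos {δ : ℝ} (hδ : 0 < δ) :
    ∃ C : ℝ≥0, ∀ F G : ℝ → ℝ≥0∞, Measurable F → Measurable G →
      bn (δ - 1 / 2) (lconv F G) ≤ C * (bn δ F * bn δ G) := by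
  obtain ⟨k, hk⟩ := exists_nat_gt δ
  obtain ⟨C₁, hC₁⟩ := exists_lintegral_sq_le hδ
  obtain ⟨C₂, hC₂⟩ := exists_lintegral_V_le hδ hk
  refine ⟨2 * ((2 ^ k) ^ 2 * 2 * (2 * (C₁ * C₂))), fun F G hF hG => ?_⟩
  refine bn_le fun i => ?_
  have hVi := measurable_V k i
  set D := ENNReal.ofReal ((2:ℝ) ^ (2 * (k - δ) * i)) with hD
  have key : ∀ F G : ℝ → ℝ≥0∞, Measurable F → Measurable G → ∀ ξ,
      lconv (fun ζ => ENNReal.ofReal (V k i ζ) * F ζ) G ξ ^ 2 ≤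
        C₁ * C₂ * (D * (bn δ F * bn δ G)) := by
    intro F G hF hG ξ
    refine (lconv_sq_le (by fun_prop) hG ξ).trans ?_
    simp_rw [mul_pow]
    calc _ ≤ (C₂ * (D * bn δ F)) * (C₁ * bn δ G) := by
          gcongr
          · exact hC₂ i F
          · exact hC₁ G
      _ = _ := by ring
  have hpt : ∀ ξ, ENNReal.ofReal (V k i ξ) ^ 2 * lconv F G ξ ^ 2 ≤
      (2 ^ k) ^ 2 * 2 * (2 * (C₁ * C₂)) * (D * (bn δ F * bn δ G)) := by
    intro ξ
    rw [← mul_pow]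
    refine (pow_le_pow_left' (V_mul_lconv_le k i hF hG ξ) 2).trans ?_
    rw [mul_pow]
    calc _ ≤ (2 ^ k) ^ 2 * (2 * (C₁ * C₂ * (D * (bn δ F * bn δ G)) +
          C₁ * C₂ * (D * (bn δ G * bn δ F)))) := by
          gcongr
          refine (ENNReal.add_sq_le _ _).trans ?_
          gcongr
          · exact key F G hF hG ξ
          · rw [lconv_comm]; exact key G F hG hF ξ
      _ = _ := by ring
  have hsh : ∀ ξ ∈ shell i, lconv F G ξ ^ 2 ≤ ENNReal.ofReal ((2:ℝ) ^ (-(2 * (k:ℝ) * i))) *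
      ((2 ^ k) ^ 2 * 2 * (2 * (C₁ * C₂)) * (D * (bn δ F * bn δ G))) := by
    intro ξ hξ
    calc lconv F G ξ ^ 2 = ENNReal.ofReal ((2:ℝ) ^ (-(2 * (k:ℝ) * i))) *
          (ENNReal.ofReal ((2:ℝ) ^ (2 * (k:ℝ) * i)) * lconv F G ξ ^ 2) := by
            rw [← mul_assoc, ofReal_two_rpow_mul_neg, one_mul]
      _ ≤ _ := by
          refine mul_le_mul_right (le_trans (le_of_eq ?_) (hpt ξ)) _
          congr 1
          rw [V_eq_of_mem_shell hξ, ← ENNReal.ofReal_pow (by positivity), ← pow_mul, ← pow_mul,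
            ← Real.rpow_natCast]
          congr 2; push_cast; ring
  calc ∫⁻ ξ in shell i, lconv F G ξ ^ 2
      ≤ ∫⁻ ξ in shell i, ENNReal.ofReal ((2:ℝ) ^ (-(2 * (k:ℝ) * i))) *
        ((2 ^ k) ^ 2 * 2 * (2 * (C₁ * C₂)) * (D * (bn δ F * bn δ G))) :=
        setLIntegral_mono' (measurableSet_shell i) hsh
    _ ≤ ENNReal.ofReal ((2:ℝ) ^ (-(2 * (k:ℝ) * i))) *
        ((2 ^ k) ^ 2 * 2 * (2 * (C₁ * C₂)) * (D * (bn δ F * bn δ G))) *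
        ENNReal.ofReal ((2:ℝ) ^ ((i:ℝ) + 1)) := by
        rw [setLIntegral_const]
        gcongr
        refine (volume_shell_le i).trans (le_of_eq ?_)
        rw [← Real.rpow_natCast]; push_cast; rfl
    _ = (ENNReal.ofReal ((2:ℝ) ^ (-(2 * (k:ℝ) * i))) * D * ENNReal.ofReal ((2:ℝ) ^ ((i:ℝ) + 1))) *
        ((2 ^ k) ^ 2 * 2 * (2 * (C₁ * C₂)) * (bn δ F * bn δ G)) := by ring
    _ = _ := by
        have h2 : ENNReal.ofReal ((2:ℝ) ^ ((i:ℝ) + 1 + (2 * (k - δ) * i + -(2 * (k:ℝ) * i)))) =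
            2 * ENNReal.ofReal ((2:ℝ) ^ (-(2 * (δ - 1 / 2) * i))) := by
          rw [show (2:ℝ≥0∞) = ENNReal.ofReal ((2:ℝ) ^ (1:ℝ)) by simp, ofReal_two_rpow_mul]
          congr 2; ring
        rw [hD, mul_comm (ENNReal.ofReal _) (ENNReal.ofReal _), mul_comm _ (ENNReal.ofReal _),
          ofReal_two_rpow_mul, ofReal_two_rpow_mul, h2]
        push_cast; ring

/-! ### The Camassa-Holm nonlinearity on the Fourier side -/

/-- The convolution of two functions, which is the Fourier transform of a product. -/
noncomputable def conv (f g : ℝ → ℂ) (ξ : ℝ) : ℂ := ∫ ζ, f ζ * g (ξ - ζ)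

/-- Multiplication by `2πiξ`, the symbol of `∂ₓ`. -/
noncomputable def dSym (f : ℝ → ℂ) (ξ : ℝ) : ℂ := Complex.I * ((2 * Real.pi * ξ : ℝ) : ℂ) * f ξ

/-- The symbol of `(1 - α² ∂ₓ²)⁻¹` in the variable of Mathlib's Fourier transform. -/
noncomputable def hSym (α ξ : ℝ) : ℝ := (1 + α ^ 2 * (2 * Real.pi * ξ) ^ 2)⁻¹

/-- The bilinear form on the Fourier side whose diagonal is the Camassa-Holm nonlinearity
`-u ∂ₓu - ∂ₓ (1 - α²∂ₓ²)⁻¹ (u² + (α²/2) (∂ₓu)²)`, with `u ∂ₓu` written as `∂ₓ(u²)/2`. -/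
noncomputable def chForm (α : ℝ) (f g : ℝ → ℂ) (ξ : ℝ) : ℂ :=
  -(Complex.I * ((2 * Real.pi * ξ : ℝ) : ℂ) * ((1 / 2 + hSym α ξ : ℝ) : ℂ) * conv f g ξ) -
    Complex.I * ((α ^ 2 * (2 * Real.pi * ξ) * hSym α ξ / 2 : ℝ) : ℂ) * conv (dSym f) (dSym g) ξ

lemma hSym_pos (α ξ : ℝ) : 0 < hSym α ξ := by unfold hSym; positivity

lemma hSym_le_one (α ξ : ℝ) : hSym α ξ ≤ 1 := by
  unfold hSym
  exact inv_le_one_of_one_le₀ (by nlinarith [mul_nonneg (sq_nonneg α) (sq_nonneg (2 * Real.pi * ξ))])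

lemma hSym_mul (α ξ : ℝ) : hSym α ξ * (1 + α ^ 2 * (2 * Real.pi * ξ) ^ 2) = 1 :=
  inv_mul_cancel₀ (by positivity)

lemma measurable_hSym (α : ℝ) : Measurable (hSym α) := by unfold hSym; fun_prop

/-- The symbol of `(α²/2) ∂ₓ (1 - α²∂ₓ²)⁻¹` gains one derivative, uniformly in `α ∈ [0, 1]`. -/
lemma symbol_mul_br_le {α : ℝ} (hα : α ∈ Icc (0:ℝ) 1) (ξ : ℝ) :
    |α ^ 2 * (2 * Real.pi * ξ) * hSym α ξ / 2| * br ξ ≤ 1 := by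
  have hb : br ξ = 1 + |2 * Real.pi * ξ| := by
    rw [abs_mul, abs_of_pos (by positivity : 0 < 2 * Real.pi)]; rfl
  have hm := hSym_mul α ξ
  have hp := hSym_pos α ξ
  rw [hb]
  set X := 2 * Real.pi * ξ
  set h := hSym α ξ
  have hX : X ^ 2 = |X| ^ 2 := (sq_abs X).symm
  rw [hX] at hm
  have hX0 := abs_nonneg X
  rw [abs_div, abs_mul, abs_mul, abs_of_pos hp, abs_of_nonneg (sq_nonneg α), abs_two]
  set x := |X|
  have h1 : α ^ 2 * x ≤ 1 + α ^ 2 * x ^ 2 := by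
    have ha : α ^ 2 ≤ 1 := pow_le_one₀ hα.1 hα.2
    nlinarith [mul_nonneg (sq_nonneg α) (sq_nonneg (x - 1)), mul_nonneg (sq_nonneg α) hX0]
  have h2 : α ^ 2 * x * h ≤ 1 := by nlinarith
  nlinarith

lemma symbol_le {α : ℝ} (hα : α ∈ Icc (0:ℝ) 1) (ξ : ℝ) :
    |α ^ 2 * (2 * Real.pi * ξ) * hSym α ξ / 2| ≤ 1 :=
  le_trans (le_mul_of_one_le_right (abs_nonneg _) (one_le_br ξ)) (symbol_mul_br_le hα ξ)

lemma measurable_conv {f g : ℝ → ℂ} (hf : Measurable f) (hg : Measurable g) :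
    Measurable (conv f g) := by
  unfold conv
  exact (StronglyMeasurable.integral_prod_right' (f := fun p : ℝ × ℝ => f p.2 * g (p.1 - p.2))
    (by fun_prop : Measurable _).stronglyMeasurable).measurable

lemma measurable_dSym {f : ℝ → ℂ} (hf : Measurable f) : Measurable (dSym f) := by
  unfold dSym; fun_prop

lemma measurable_chForm (α : ℝ) {f g : ℝ → ℂ} (hf : Measurable f) (hg : Measurable g) :
    Measurable (chForm α f g) := by
  have h1 := measurable_conv hf hg
  have h2 := measurable_conv (measurable_dSym hf) (measurable_dSym hg)
  have h3 := measurable_hSym α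
  unfold chForm; fun_prop

lemma conv_comm (f g : ℝ → ℂ) : conv f g = conv g f := by
  ext ξ
  unfold conv
  rw [← integral_sub_left_eq_self _ volume ξ]
  simp [mul_comm]

lemma enorm_conv_le (f g : ℝ → ℂ) (ξ : ℝ) :
    ‖conv f g ξ‖ₑ ≤ lconv (fun ζ => ‖f ζ‖ₑ) (fun ζ => ‖g ζ‖ₑ) ξ := by
  refine (enorm_integral_le_lintegral_enorm _).trans (le_of_eq ?_)
  simp [lconv, enorm_mul]

lemma enorm_ofReal_eq (x : ℝ) : ‖(x : ℂ)‖ₑ = ENNReal.ofReal |x| := by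
  rw [← ofReal_norm, Complex.norm_real, Real.norm_eq_abs]

lemma enorm_I : ‖Complex.I‖ₑ = 1 := by rw [← ofReal_norm]; simp

lemma enorm_dSym_le (f : ℝ → ℂ) (ξ : ℝ) : ‖dSym f ξ‖ₑ ≤ ENNReal.ofReal (br ξ) * ‖f ξ‖ₑ := by
  unfold dSym
  rw [enorm_mul, enorm_mul, enorm_I, one_mul, enorm_ofReal_eq]
  gcongr
  exact abs_angular_le_br ξ

lemma memLp_two_iff {f : ℝ → ℂ} (hf : Measurable f) :
    MemLp f 2 ↔ ∫⁻ ξ, ‖f ξ‖ₑ ^ 2 < ⊤ := by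
  have h := eLpNorm_lt_top_iff_lintegral_rpow_enorm_lt_top (μ := volume) (f := f) (p := 2)
    (by norm_num) (by norm_num)
  simp only [ENNReal.toReal_ofNat, ENNReal.rpow_ofNat] at h
  rw [← h]
  exact ⟨fun h => h.2, fun h => ⟨hf.aestronglyMeasurable, h⟩⟩

lemma memLp_two_of_bn {σ : ℝ} (hσ : 0 < σ) {f : ℝ → ℂ} (hf : Measurable f)
    (h : bn σ (fun ξ => ‖f ξ‖ₑ) < ⊤) : MemLp f 2 := by
  obtain ⟨C, hC⟩ := exists_lintegral_sq_le hσ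
  rw [memLp_two_iff hf]
  exact (hC _).trans_lt (ENNReal.mul_lt_top ENNReal.coe_lt_top h)

lemma integrable_of_bn {σ : ℝ} (hσ : 1 / 2 < σ) {f : ℝ → ℂ} (hf : Measurable f)
    (h : bn σ (fun ξ => ‖f ξ‖ₑ) < ⊤) : Integrable f := by
  obtain ⟨C, hC⟩ := exists_sq_lintegral_le hσ
  refine ⟨hf.aestronglyMeasurable, ?_⟩
  have h1 := (hC _ hf.enorm).trans_lt (ENNReal.mul_lt_top ENNReal.coe_lt_top h)
  have h2 : (∫⁻ ξ, ‖f ξ‖ₑ) ≠ ⊤ := fun h => by simp [h] at h1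
  exact h2.lt_top

lemma bn_br_mul_le (σ : ℝ) (F : ℝ → ℝ≥0∞) :
    bn σ (fun ξ => ENNReal.ofReal (br ξ) * F ξ) ≤ 4 * bn (σ + 1) F := by
  have h := bn_rpow_mul_le σ zero_le_one F
  simp only [Real.rpow_one, mul_one] at h
  refine h.trans (le_of_eq ?_)
  congr 1
  rw [show (2:ℝ) ^ (2:ℝ) = 4 by norm_num]
  simp

lemma bn_dSym_le (σ : ℝ) (f : ℝ → ℂ) :
    bn σ (fun ξ => ‖dSym f ξ‖ₑ) ≤ 4 * bn (σ + 1) (fun ξ => ‖f ξ‖ₑ) :=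
  (bn_mono (Filter.Eventually.of_forall (enorm_dSym_le f))).trans (bn_br_mul_le σ _)

lemma integrable_conv_kernel {f g : ℝ → ℂ} (hf : MemLp f 2) (hg : MemLp g 2) (ξ : ℝ) :
    Integrable (fun ζ => f ζ * g (ξ - ζ)) :=
  hf.integrable_mul (hg.comp_measurePreserving (volume.measurePreserving_sub_left ξ))

lemma conv_sub_add {f g : ℝ → ℂ} (hf : MemLp f 2) (hg : MemLp g 2) (ξ : ℝ) :
    conv (f - g) (f + g) ξ = conv f f ξ - conv g g ξ := by
  have h1 := integrable_conv_kernel hf hf ξ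
  have h2 := integrable_conv_kernel hf hg ξ
  have h3 := integrable_conv_kernel hg hf ξ
  have h4 := integrable_conv_kernel hg hg ξ
  have h5 : conv f g ξ = conv g f ξ := by rw [conv_comm]
  calc conv (f - g) (f + g) ξ = ∫ ζ, (f ζ * f (ξ - ζ) + f ζ * g (ξ - ζ)) -
        (g ζ * f (ξ - ζ) + g ζ * g (ξ - ζ)) := by
        unfold conv; congr 1; ext ζ; simp; ring
    _ = conv f f ξ + conv f g ξ - (conv g f ξ + conv g g ξ) := by
        unfold conv
        rw [integral_sub (by exact h1.add h2) (by exact h3.add h4), integral_add h1 h2,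
          integral_add h3 h4]
    _ = _ := by rw [h5]; ring

lemma dSym_sub (f g : ℝ → ℂ) : dSym (f - g) = dSym f - dSym g := by
  ext ξ; simp [dSym]; ring

lemma dSym_add (f g : ℝ → ℂ) : dSym (f + g) = dSym f + dSym g := by
  ext ξ; simp [dSym]; ring

lemma chForm_sub_chForm (α : ℝ) {f g : ℝ → ℂ} (hf : MemLp f 2) (hg : MemLp g 2)
    (hf' : MemLp (dSym f) 2) (hg' : MemLp (dSym g) 2) (ξ : ℝ) :
    chForm α f f ξ - chForm α g g ξ = chForm α (f - g) (f + g) ξ := by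
  unfold chForm
  rw [conv_sub_add hf hg, dSym_sub, dSym_add, conv_sub_add hf' hg']
  ring

lemma enorm_chForm_le {α : ℝ} (f g : ℝ → ℂ) (ξ : ℝ) :
    ‖chForm α f g ξ‖ₑ ≤
      2 * (ENNReal.ofReal (br ξ) * lconv (fun ζ => ‖f ζ‖ₑ) (fun ζ => ‖g ζ‖ₑ) ξ) +
      ENNReal.ofReal |α ^ 2 * (2 * Real.pi * ξ) * hSym α ξ / 2| *
        lconv (fun ζ => ENNReal.ofReal (br ζ) * ‖f ζ‖ₑ)
          (fun ζ => ENNReal.ofReal (br ζ) * ‖g ζ‖ₑ) ξ := by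
  unfold chForm
  refine (enorm_sub_le).trans ?_
  gcongr
  · rw [enorm_neg, enorm_mul, enorm_mul, enorm_mul, enorm_I, one_mul, enorm_ofReal_eq,
      enorm_ofReal_eq]
    have h1 := hSym_pos α ξ
    have h2 := hSym_le_one α ξ
    calc _ ≤ ENNReal.ofReal (br ξ) * ENNReal.ofReal 2 *
        lconv (fun ζ => ‖f ζ‖ₑ) (fun ζ => ‖g ζ‖ₑ) ξ := by
          gcongr
          · exact abs_angular_le_br ξ
          · rw [abs_of_pos (by positivity)]; linarith
          · exact enorm_conv_le f g ξ
      _ = _ := by rw [ENNReal.ofReal_ofNat]; ring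
  · rw [enorm_mul, enorm_mul, enorm_I, one_mul, enorm_ofReal_eq]
    gcongr
    exact (enorm_conv_le _ _ ξ).trans (lconv_mono (enorm_dSym_le f) (enorm_dSym_le g) ξ)

/-- The nonlinearity maps `B^s_{2,∞}` to `B^{s-1}_{2,∞}`. -/
lemma exists_bn_chForm_le {s : ℝ} (hs : 3 / 2 < s) :
    ∃ C : ℝ≥0, ∀ α ∈ Icc (0:ℝ) 1, ∀ f g : ℝ → ℂ, Measurable f → Measurable g →
      bn (s - 1) (fun ξ => ‖chForm α f g ξ‖ₑ) ≤
        C * (bn s (fun ξ => ‖f ξ‖ₑ) * bn s (fun ξ => ‖g ξ‖ₑ)) := by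
  obtain ⟨C₁, hC₁⟩ := exists_bn_lconv_le (by linarith : 1 / 2 < s)
  obtain ⟨C₂, hC₂⟩ := exists_bn_lconv_le (by linarith : 1 / 2 < s - 1)
  refine ⟨32 * C₁ + 32 * C₂, fun α hα f g hf hg => ?_⟩
  have hb := measurable_br
  set F := fun ξ => ‖f ξ‖ₑ
  set G := fun ξ => ‖g ξ‖ₑ
  have hF : Measurable F := hf.enorm
  have hG : Measurable G := hg.enorm
  have hm := measurable_lconv hF hG
  calc bn (s - 1) (fun ξ => ‖chForm α f g ξ‖ₑ)
      ≤ bn (s - 1) (fun ξ => 2 * (ENNReal.ofReal (br ξ) * lconv F G ξ) +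
        lconv (fun ζ => ENNReal.ofReal (br ζ) * F ζ) (fun ζ => ENNReal.ofReal (br ζ) * G ζ) ξ) := by
        refine bn_mono (Filter.Eventually.of_forall fun ξ => ?_)
        refine (enorm_chForm_le f g ξ).trans ?_
        gcongr
        refine mul_le_of_le_one_left' ?_
        exact ENNReal.ofReal_le_one.2 (symbol_le hα ξ)
    _ ≤ 2 * bn (s - 1) (fun ξ => 2 * (ENNReal.ofReal (br ξ) * lconv F G ξ)) +
        2 * bn (s - 1) (lconv (fun ζ => ENNReal.ofReal (br ζ) * F ζ)
          (fun ζ => ENNReal.ofReal (br ζ) * G ζ)) := bn_add_le (by fun_prop) _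
    _ ≤ 2 * (2 ^ 2 * (4 * (C₁ * (bn s F * bn s G)))) +
        2 * (C₂ * ((4 * bn s F) * (4 * bn s G))) := by
        rw [bn_const_mul (by norm_num)]
        have h1 : ∀ H : ℝ → ℝ≥0∞, bn (s - 1) (fun ξ => ENNReal.ofReal (br ξ) * H ξ) ≤ 4 * bn s H := by
          intro H
          simpa using bn_br_mul_le (s - 1) H
        gcongr
        · exact (h1 _).trans (by gcongr; exact hC₁ F G hF hG)
        · refine (hC₂ _ _ (by fun_prop) (by fun_prop)).trans ?_
          gcongr
          · exact h1 F
          · exact h1 G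
    _ = _ := by push_cast; ring

/-- In `∂ₓw ∂ₓz` the symbol moves half a derivative from the first factor to the second one. -/
lemma symbol_mul_br_mul_br_le {α : ℝ} (hα : α ∈ Icc (0:ℝ) 1) (ξ ζ : ℝ) :
    |α ^ 2 * (2 * Real.pi * ξ) * hSym α ξ / 2| * (br ζ * br (ξ - ζ)) ≤
      2 * (br ζ ^ (1 / 2 : ℝ) * br (ξ - ζ) ^ (3 / 2 : ℝ)) := by
  have h0 := symbol_mul_br_le hα ξ
  set p := |α ^ 2 * (2 * Real.pi * ξ) * hSym α ξ / 2|
  have hp : 0 ≤ p := abs_nonneg _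
  have hx := one_le_br ξ
  have hz := one_le_br ζ
  have hy := one_le_br (ξ - ζ)
  have htri : br ζ ≤ 2 * br ξ * br (ξ - ζ) := by
    have h := br_le_add ζ ξ
    rw [show ζ - ξ = -(ξ - ζ) by ring, br_neg] at h
    nlinarith
  set x := br ξ
  set y := br (ξ - ζ)
  set z := br ζ
  have hz0 : 0 < z := by linarith
  have hy0 : 0 < y := by linarith
  have h1 : z ^ (1 / 2 : ℝ) ≤ 2 * x * y ^ (1 / 2 : ℝ) := by
    calc z ^ (1 / 2 : ℝ) ≤ (2 * x * y) ^ (1 / 2 : ℝ) := Real.rpow_le_rpow hz0.le htri (by norm_num)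
      _ = (2 * x) ^ (1 / 2 : ℝ) * y ^ (1 / 2 : ℝ) := Real.mul_rpow (by linarith) hy0.le
      _ ≤ (2 * x) ^ (1 : ℝ) * y ^ (1 / 2 : ℝ) := by
          gcongr
          · linarith
          · norm_num
      _ = _ := by rw [Real.rpow_one]
  have h2 : z = z ^ (1 / 2 : ℝ) * z ^ (1 / 2 : ℝ) := by
    rw [← Real.rpow_add hz0]; norm_num
  have h3 : y ^ (3 / 2 : ℝ) = y ^ (1 / 2 : ℝ) * y := by
    rw [← Real.rpow_add_one hy0.ne']; norm_num
  calc p * (z * y) = p * (z ^ (1 / 2 : ℝ) * z ^ (1 / 2 : ℝ) * y) := by rw [← h2]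
    _ ≤ p * (z ^ (1 / 2 : ℝ) * (2 * x * y ^ (1 / 2 : ℝ)) * y) := by gcongr
    _ = (p * x) * (2 * (z ^ (1 / 2 : ℝ) * (y ^ (1 / 2 : ℝ) * y))) := by ring
    _ ≤ 1 * (2 * (z ^ (1 / 2 : ℝ) * (y ^ (1 / 2 : ℝ) * y))) := by gcongr
    _ = _ := by rw [one_mul, h3]

/-- The bilinear form maps `B^{s-1}_{2,∞} × B^s_{2,∞}` to `B^{s-2}_{2,∞}`. The index `s - 2` may be
negative; the smoothing of the symbol moves half a derivative from the first factor in
`∂ₓw ∂ₓz` to the second one, so that both lie in `B^{s-3/2}_{2,∞}` with `s - 3/2 > 0`. -/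
lemma exists_bn_chForm_le_of_lower {s : ℝ} (hs : 3 / 2 < s) :
    ∃ C : ℝ≥0, ∀ α ∈ Icc (0:ℝ) 1, ∀ f g : ℝ → ℂ, Measurable f → Measurable g →
      bn (s - 2) (fun ξ => ‖chForm α f g ξ‖ₑ) ≤
        C * (bn (s - 1) (fun ξ => ‖f ξ‖ₑ) * bn s (fun ξ => ‖g ξ‖ₑ)) := by
  obtain ⟨C₁, hC₁⟩ := exists_bn_lconv_le (by linarith : 1 / 2 < s - 1)
  obtain ⟨C₂, hC₂⟩ := exists_bn_lconv_le_of_pos (by linarith : 0 < s - 3 / 2)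
  refine ⟨32 * C₁ + 128 * C₂, fun α hα f g hf hg => ?_⟩
  have hb := measurable_br
  set F := fun ξ => ‖f ξ‖ₑ
  set G := fun ξ => ‖g ξ‖ₑ
  have hF : Measurable F := hf.enorm
  have hG : Measurable G := hg.enorm
  have hm := measurable_lconv hF hG
  calc bn (s - 2) (fun ξ => ‖chForm α f g ξ‖ₑ)
      ≤ bn (s - 2) (fun ξ => 2 * (ENNReal.ofReal (br ξ) * lconv F G ξ) +
        2 * lconv (fun ζ => ENNReal.ofReal (br ζ ^ (1 / 2 : ℝ)) * F ζ)
          (fun ζ => ENNReal.ofReal (br ζ ^ (3 / 2 : ℝ)) * G ζ) ξ) := by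
        refine bn_mono (Filter.Eventually.of_forall fun ξ => ?_)
        refine (enorm_chForm_le f g ξ).trans (add_le_add le_rfl ?_)
        unfold lconv
        rw [← lintegral_const_mul' _ _ (by finiteness), ← lintegral_const_mul' _ _ (by finiteness)]
        refine lintegral_mono fun ζ => ?_
        have h := ENNReal.ofReal_le_ofReal (symbol_mul_br_mul_br_le hα ξ ζ)
        have hz := br_pos ζ
        have hy := br_pos (ξ - ζ)
        rw [ENNReal.ofReal_mul (abs_nonneg _), ENNReal.ofReal_mul hz.le,
          ENNReal.ofReal_mul two_pos.le, ENNReal.ofReal_mul (by positivity),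
          ENNReal.ofReal_ofNat] at h
        calc _ = (ENNReal.ofReal |α ^ 2 * (2 * Real.pi * ξ) * hSym α ξ / 2| *
              (ENNReal.ofReal (br ζ) * ENNReal.ofReal (br (ξ - ζ)))) * (F ζ * G (ξ - ζ)) := by ring
          _ ≤ _ := mul_le_mul_left h _
          _ = _ := by ring
    _ ≤ 2 * bn (s - 2) (fun ξ => 2 * (ENNReal.ofReal (br ξ) * lconv F G ξ)) +
        2 * bn (s - 2) (fun ξ => 2 * lconv (fun ζ => ENNReal.ofReal (br ζ ^ (1 / 2 : ℝ)) * F ζ)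
          (fun ζ => ENNReal.ofReal (br ζ ^ (3 / 2 : ℝ)) * G ζ) ξ) := bn_add_le (by fun_prop) _
    _ ≤ 2 * (2 ^ 2 * (4 * (C₁ * (bn (s - 1) F * bn s G)))) +
        2 * (2 ^ 2 * (C₂ * ((2 * bn (s - 1) F) * (8 * bn s G)))) := by
        rw [bn_const_mul (by norm_num), bn_const_mul (by norm_num)]
        gcongr
        · refine (bn_br_mul_le (s - 2) _).trans ?_
          rw [show s - 2 + 1 = s - 1 by ring]
          gcongr
          refine (hC₁ F G hF hG).trans ?_
          gcongr
          exact bn_mono_left (by linarith) G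
        · have h := hC₂ (fun ζ => ENNReal.ofReal (br ζ ^ (1 / 2 : ℝ)) * F ζ)
            (fun ζ => ENNReal.ofReal (br ζ ^ (3 / 2 : ℝ)) * G ζ) (by fun_prop) (by fun_prop)
          rw [show s - 3 / 2 - 1 / 2 = s - 2 by ring] at h
          refine h.trans ?_
          gcongr
          · refine (bn_rpow_mul_le _ (by norm_num) F).trans (le_of_eq ?_)
            rw [show s - 3 / 2 + 1 / 2 = s - 1 by ring]; norm_num
          · refine (bn_rpow_mul_le _ (by norm_num) G).trans (le_of_eq ?_)
            rw [show s - 3 / 2 + 3 / 2 = s by ring]; norm_num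
    _ = _ := by push_cast; ring

/-! ### The weighted energy estimate -/

/-- The commutator of `(1 - α²∂ₓ²)⁻¹` with a multiplication gains one derivative, uniformly in `α`. -/
lemma hSym_lipschitz (α ξ ζ : ℝ) :
    |hSym α ξ - hSym α ζ| * |2 * Real.pi * ζ| ≤ 2 * |2 * Real.pi * ξ - 2 * Real.pi * ζ| := by
  have h1 := hSym_mul α ξ
  have h2 := hSym_mul α ζ
  have p1 := hSym_pos α ξ
  have p2 := hSym_pos α ζ
  have l1 := hSym_le_one α ξ
  have l2 := hSym_le_one α ζ
  set x := 2 * Real.pi * ξ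
  set z := 2 * Real.pi * ζ
  set g := hSym α ξ
  set h := hSym α ζ
  have e : (g - h) * z = (z - x) * (α ^ 2 * z ^ 2 * h * g + α ^ 2 * (x * z) * (g * h)) := by
    linear_combination z * h * h1 - z * g * h2
  rw [← abs_mul, e, abs_mul, abs_sub_comm z x, mul_comm 2]
  gcongr
  have b1 : α ^ 2 * z ^ 2 * h ≤ 1 := by nlinarith
  have b0 : 0 ≤ α ^ 2 * z ^ 2 * h := by positivity
  have b2 : α ^ 2 * x ^ 2 * g ≤ 1 := by nlinarith
  have b20 : 0 ≤ α ^ 2 * x ^ 2 * g := by positivity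
  have c1 : α ^ 2 * z ^ 2 * h * g ≤ 1 := by nlinarith
  have c10 : 0 ≤ α ^ 2 * z ^ 2 * h * g := by positivity
  have c2 : α ^ 2 * x ^ 2 * g * h ≤ 1 := by nlinarith
  have hgh : 0 ≤ α ^ 2 * (g * h) := by positivity
  have u1 : α ^ 2 * (x * z) * (g * h) ≤ 1 := by
    nlinarith [mul_nonneg hgh (sq_nonneg (x - z))]
  have u2 : -1 ≤ α ^ 2 * (x * z) * (g * h) := by
    nlinarith [mul_nonneg hgh (sq_nonneg (x + z))]
  rw [abs_le]
  constructor <;> linarith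

/-- The variation of the truncated weight `min a L`, which behaves like a function of degree one
also where only one of the two values is truncated. -/
lemma abs_min_sub_min_mul_le {a b c L : ℝ} (h : |a - b| ≤ c)
    (hba : b ≤ 2 * a) (hL : 0 < L) (hb : 0 < b) :
    |min a L - min b L| * b ≤ 2 * c * max (min a L) (min b L) := by
  have hc : 0 ≤ c := (abs_nonneg _).trans h
  rcases le_total b L with hbL | hbL
  · have h1 : |min a L - min b L| ≤ c := by
      refine le_trans ?_ h
      have := abs_min_sub_min_le_max a L b L
      simpa using this
    have h2 : b ≤ max (min a L) (min b L) := by rw [min_eq_left hbL]; exact le_max_right _ _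
    calc _ ≤ c * max (min a L) (min b L) := by gcongr
      _ ≤ _ := by nlinarith [le_trans hb.le h2]
  · rcases le_total L a with haL | haL
    · rw [min_eq_right haL, min_eq_right hbL]; simp; positivity
    · rw [min_eq_left haL, min_eq_right hbL]
      have h1 : |a - L| ≤ c := by
        refine le_trans ?_ h
        rw [abs_of_nonpos (by linarith), abs_of_nonpos (by linarith)]; linarith
      have h2 : b ≤ 2 * max a L := hba.trans (by gcongr; exact le_max_left _ _)
      calc _ ≤ c * (2 * max a L) := by gcongr
        _ = _ := by ring

/-- The symmetrized kernel of the transport term gains the derivative back: every term on the right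
carries the weight on two of the three frequencies and one derivative on the third. -/
lemma kernel_bound {k : ℕ} (hk : 1 ≤ k) (i : ℕ) (α ξ ζ : ℝ) :
    |V k i ξ ^ 2 * (1 / 2 + hSym α ξ) * (2 * Real.pi * ζ) -
        V k i ζ ^ 2 * (1 / 2 + hSym α ζ) * (2 * Real.pi * ξ)| ≤
      (8 * k + 4) * 3 ^ k * (br (ξ - ζ) * (V k i ξ * V k i ζ) + br ζ * (V k i ξ * V k i (ξ - ζ)) +
        br ξ * (V k i ζ * V k i (ξ - ζ))) := by
  have hx := abs_angular_le_br ξ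
  have hz := abs_angular_le_br ζ
  have hy : |2 * Real.pi * ξ - 2 * Real.pi * ζ| ≤ br (ξ - ζ) := by
    rw [← mul_sub]; exact abs_angular_le_br (ξ - ζ)
  have hlip : |(1 / 2 + hSym α ξ) - (1 / 2 + hSym α ζ)| * |2 * Real.pi * ζ| ≤ 2 * br (ξ - ζ) := by
    have := hSym_lipschitz α ξ ζ
    rw [add_sub_add_left_eq_sub]
    linarith
  have hm : |1 / 2 + hSym α ξ| ≤ 2 := by
    have h1 := hSym_pos α ξ
    have h2 := hSym_le_one α ξ
    rw [abs_of_pos (by linarith)]; linarith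
  have hn : |1 / 2 + hSym α ζ| ≤ 2 := by
    have h1 := hSym_pos α ζ
    have h2 := hSym_le_one α ζ
    rw [abs_of_pos (by linarith)]; linarith
  have t1 := br_le_add ξ ζ
  have t2 : br ζ ≤ br ξ + br (ξ - ζ) := by
    have h := br_le_add ζ ξ
    rwa [show ζ - ξ = -(ξ - ζ) by ring, br_neg] at h
  have a0 := br_pos ξ
  have b0 := br_pos ζ
  have c0 := br_pos (ξ - ζ)
  have p0 := V_pos k i ξ
  have q0 := V_pos k i ζ
  have r0 := V_pos k i (ξ - ζ)
  have hkR : (1:ℝ) ≤ k := by exact_mod_cast hk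
  have h3 : (1:ℝ) ≤ 3 ^ k := one_le_pow₀ (by norm_num)
  have h23 : (2:ℝ) ^ k ≤ 3 ^ k := pow_le_pow_left₀ (by norm_num) (by norm_num) k
  rcases le_total (br ζ) (2 * br (ξ - ζ)) with hc | hc
  -- If `ξ - ζ` dominates, one weight moves to `ξ - ζ` in each term and no cancellation is needed.
  · have hp := V_le_of_br_le k i (c := 3) (by norm_num) (show br ξ ≤ 3 * br (ξ - ζ) by linarith)
    have hq := V_le_of_br_le k i (c := 3) (by norm_num) (show br ζ ≤ 3 * br (ξ - ζ) by linarith)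
    have e1 : |V k i ξ ^ 2 * (1 / 2 + hSym α ξ) * (2 * Real.pi * ζ)| ≤
        2 * 3 ^ k * (br ζ * (V k i ξ * V k i (ξ - ζ))) := by
      rw [abs_mul, abs_mul, abs_of_nonneg (sq_nonneg _), sq]
      calc _ ≤ V k i ξ * (3 ^ k * V k i (ξ - ζ)) * 2 * br ζ := by gcongr
        _ = _ := by ring
    have e2 : |V k i ζ ^ 2 * (1 / 2 + hSym α ζ) * (2 * Real.pi * ξ)| ≤
        2 * 3 ^ k * (br ξ * (V k i ζ * V k i (ξ - ζ))) := by
      rw [abs_mul, abs_mul, abs_of_nonneg (sq_nonneg _), sq]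
      calc _ ≤ V k i ζ * (3 ^ k * V k i (ξ - ζ)) * 2 * br ξ := by gcongr
        _ = _ := by ring
    refine (abs_sub _ _).trans ((add_le_add e1 e2).trans ?_)
    rw [← mul_add]
    have : (0:ℝ) ≤ br (ξ - ζ) * (V k i ξ * V k i ζ) := by positivity
    gcongr <;> linarith
  -- If `ξ` and `ζ` are comparable, the difference vanishes at `ξ = ζ` and is Lipschitz there.
  · have hpq := V_le_of_br_le k i one_le_two (show br ξ ≤ 2 * br ζ by linarith)
    have hqp := V_le_of_br_le k i one_le_two (show br ζ ≤ 2 * br ξ by linarith)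
    have hd : |br ξ - br ζ| ≤ br (ξ - ζ) := abs_le.2 ⟨by linarith, by linarith⟩
    have hmin := abs_min_sub_min_mul_le (L := 2 ^ i) hd (by linarith) (by positivity) b0
    have hsq : |V k i ξ ^ 2 - V k i ζ ^ 2| * br ζ ≤
        4 * k * 2 ^ k * (br (ξ - ζ) * (V k i ξ * V k i ζ)) := by
      unfold V at hpq hqp ⊢
      have hP := min_br_pos i ξ
      have hQ := min_br_pos i ζ
      set P := min (br ξ) (2 ^ i)
      set Q := min (br ζ) (2 ^ i)
      have hpow := abs_pow_sub_pow_le P Q (2 * k)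
      rw [abs_of_pos hP, abs_of_pos hQ] at hpow
      rw [← pow_mul, ← pow_mul, mul_comm k 2]
      have hmax : max P Q ^ (2 * k) ≤ 2 ^ k * (P ^ k * Q ^ k) := by
        rw [mul_comm 2 k, pow_mul, sq]
        rcases le_total P Q with h | h
        · rw [max_eq_right h]; nlinarith [pow_pos hQ k]
        · rw [max_eq_left h]; nlinarith [pow_pos hP k]
      have hM : 0 < max P Q := lt_max_of_lt_left hP
      calc |P ^ (2 * k) - Q ^ (2 * k)| * br ζ
          ≤ |P - Q| * ((2 * k : ℕ) : ℝ) * max P Q ^ (2 * k - 1) * br ζ := by gcongr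
        _ = (|P - Q| * br ζ) * (((2 * k : ℕ) : ℝ) * max P Q ^ (2 * k - 1)) := by ring
        _ ≤ (2 * br (ξ - ζ) * max P Q) * (((2 * k : ℕ) : ℝ) * max P Q ^ (2 * k - 1)) := by gcongr
        _ = 4 * k * br (ξ - ζ) * max P Q ^ (2 * k) := by
            rw [show 2 * k = (2 * k - 1) + 1 by omega, pow_succ]
            rw [show 2 * k - 1 + 1 - 1 = 2 * k - 1 by omega,
              show 2 * k - 1 + 1 = 2 * k by omega]
            push_cast; ring
        _ ≤ 4 * k * br (ξ - ζ) * (2 ^ k * (P ^ k * Q ^ k)) := by gcongr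
        _ = _ := by ring
    set p := V k i ξ
    set q := V k i ζ
    set r := V k i (ξ - ζ)
    set x := 2 * Real.pi * ξ
    set z := 2 * Real.pi * ζ
    set m := 1 / 2 + hSym α ξ
    set n := 1 / 2 + hSym α ζ
    set c := br (ξ - ζ)
    have e1 : |p ^ 2 * ((m - n) * z)| ≤ 2 * 2 ^ k * (c * (p * q)) := by
      rw [abs_mul, abs_mul, abs_of_nonneg (sq_nonneg _), sq]
      calc _ ≤ p * (2 ^ k * q) * (2 * c) := by gcongr
        _ = _ := by ring
    have e2 : |n * ((p ^ 2 - q ^ 2) * z)| ≤ 8 * k * 2 ^ k * (c * (p * q)) := by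
      rw [abs_mul, abs_mul]
      calc _ ≤ 2 * (|p ^ 2 - q ^ 2| * br ζ) := by gcongr
        _ ≤ 2 * (4 * k * 2 ^ k * (c * (p * q))) := by gcongr
        _ = _ := by ring
    have e3 : |q ^ 2 * n * (x - z)| ≤ 2 * 2 ^ k * (c * (p * q)) := by
      rw [abs_mul, abs_mul, abs_of_nonneg (sq_nonneg _), sq]
      calc _ ≤ (2 ^ k * p) * q * 2 * c := by gcongr
        _ = _ := by ring
    have e : p ^ 2 * m * z - q ^ 2 * n * x =
        p ^ 2 * ((m - n) * z) + n * ((p ^ 2 - q ^ 2) * z) - q ^ 2 * n * (x - z) := by ring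
    rw [e]
    refine (abs_sub _ _).trans ?_
    have e4 := abs_add_le (p ^ 2 * ((m - n) * z)) (n * ((p ^ 2 - q ^ 2) * z))
    have pos1 : (0:ℝ) ≤ br ζ * (p * r) + br ξ * (q * r) := by positivity
    have pos2 : (0:ℝ) ≤ c * (p * q) := by positivity
    calc _ ≤ (8 * k + 4) * 2 ^ k * (c * (p * q)) := by linarith
      _ ≤ (8 * k + 4) * 3 ^ k * (c * (p * q)) := by gcongr
      _ ≤ (8 * k + 4) * 3 ^ k * (c * (p * q) + br ζ * (p * r) + br ξ * (q * r)) := by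
        rw [add_assoc]
        gcongr
        linarith

lemma sq_lintegral_mul_lconv_le {H F G : ℝ → ℝ≥0∞} (hH : Measurable H) (hF : Measurable F)
    (hG : Measurable G) :
    (∫⁻ ξ, H ξ * lconv F G ξ) ^ 2 ≤ (∫⁻ ξ, H ξ ^ 2) * ((∫⁻ ξ, F ξ) ^ 2 * ∫⁻ ξ, G ξ ^ 2) :=
  (sq_lintegral_mul_le hH.aemeasurable (measurable_lconv hF hG).aemeasurable).trans
    (mul_le_mul_right (lintegral_lconv_sq_le hF hG) _)

lemma lintegral_mul_lconv_self_le {F G : ℝ → ℝ≥0∞} (hF : Measurable F) (hG : Measurable G) :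
    ∫⁻ ξ, G ξ * lconv F G ξ ≤ (∫⁻ ξ, F ξ) * ∫⁻ ξ, G ξ ^ 2 := by
  have h := sq_lintegral_mul_lconv_le hG hF hG
  rw [show (∫⁻ ξ, G ξ ^ 2) * ((∫⁻ ξ, F ξ) ^ 2 * ∫⁻ ξ, G ξ ^ 2) =
    ((∫⁻ ξ, F ξ) * ∫⁻ ξ, G ξ ^ 2) ^ 2 by ring] at h
  exact (ENNReal.pow_le_pow_left_iff (by norm_num)).1 h

/-- The product rule `∂ₓ(u²) = 2 u ∂ₓu` on the Fourier side. -/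
lemma dSym_conv {f : ℝ → ℂ} (hf : MemLp f 2) (hf' : MemLp (dSym f) 2) (ξ : ℝ) :
    Complex.I * ((2 * Real.pi * ξ : ℝ) : ℂ) * conv f f ξ = 2 * conv (dSym f) f ξ := by
  have h1 := integrable_conv_kernel hf' hf ξ
  have h2 := integrable_conv_kernel hf hf' ξ
  have h3 : conv f (dSym f) ξ = conv (dSym f) f ξ := by rw [conv_comm]
  calc _ = ∫ ζ, dSym f ζ * f (ξ - ζ) + f ζ * dSym f (ξ - ζ) := by
        unfold conv
        rw [← integral_const_mul]
        congr 1; ext ζ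
        simp only [dSym]; push_cast; ring
    _ = conv (dSym f) f ξ + conv f (dSym f) ξ := by
        unfold conv; rw [integral_add h1 h2]
    _ = _ := by rw [h3]; ring

/-- The transport part of the nonlinearity, tested against the weighted solution. The symmetry
`f(-ξ) = conj f(ξ)` allows an exchange of the two frequencies, after which `kernel_bound` applies. -/
lemma transport_energy_le {k : ℕ} (hk : 1 ≤ k) (i : ℕ) (α : ℝ) {f : ℝ → ℂ} (hf : Measurable f)
    (hsymm : ∀ ξ, f (-ξ) = starRingEnd ℂ (f ξ)) (hf1 : Integrable f) (hf2 : MemLp f 2)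
    (hf' : MemLp (dSym f) 2) :
    Integrable (fun ξ => ((V k i ξ ^ 2 * (1 / 2 + hSym α ξ) : ℝ) : ℂ) * starRingEnd ℂ (f ξ) *
      (2 * conv (dSym f) f ξ)) ∧
    ENNReal.ofReal |(∫ ξ, ((V k i ξ ^ 2 * (1 / 2 + hSym α ξ) : ℝ) : ℂ) * starRingEnd ℂ (f ξ) *
      (2 * conv (dSym f) f ξ)).re| ≤
      3 * ENNReal.ofReal ((8 * k + 4) * 3 ^ k) * ((∫⁻ ξ, ENNReal.ofReal (br ξ) * ‖f ξ‖ₑ) *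
        ∫⁻ ξ, ENNReal.ofReal (V k i ξ) ^ 2 * ‖f ξ‖ₑ ^ 2) := by
  have hV := measurable_V k i
  have hh := measurable_hSym α
  have hbr := measurable_br
  have hdf := measurable_dSym hf
  have hconj : Measurable (fun ξ => starRingEnd ℂ (f ξ)) := Complex.continuous_conj.measurable.comp hf
  set M : ℝ → ℝ := fun ξ => V k i ξ ^ 2 * (1 / 2 + hSym α ξ) with hMdef
  have hM : Measurable M := by fun_prop
  set a : ℝ × ℝ → ℂ := fun p => (M p.1 : ℂ) * starRingEnd ℂ (f p.1) *
    (2 * (dSym f p.2 * f (p.1 - p.2))) with ha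
  have ham : Measurable a := by fun_prop
  have hMb : ∀ ξ, ENNReal.ofReal |M ξ| ≤ ENNReal.ofReal (((2 ^ i) ^ k) ^ 2 * 2) := by
    intro ξ
    apply ENNReal.ofReal_le_ofReal
    have h1 := hSym_pos α ξ
    have h2 := hSym_le_one α ξ
    have h3 := (V_pos k i ξ).le
    rw [abs_of_nonneg (by rw [hMdef]; positivity)]
    simp only [hMdef]
    gcongr
    · exact V_le k i ξ
    · linarith
  have hint : Integrable a (volume.prod volume) := by
    refine ⟨ham.aestronglyMeasurable, ?_⟩
    rw [hasFiniteIntegral_def, lintegral_prod _ ham.enorm.aemeasurable]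
    have hle : ∫⁻ ξ, ∫⁻ ζ, ‖a (ξ, ζ)‖ₑ ≤ ENNReal.ofReal (((2 ^ i) ^ k) ^ 2 * 2) * 2 *
        ∫⁻ ξ, ‖f ξ‖ₑ * lconv (fun ζ => ‖f ζ‖ₑ) (fun ζ => ‖dSym f ζ‖ₑ) ξ := by
      have hlm := measurable_lconv hf.enorm hdf.enorm
      rw [← lintegral_const_mul _ (by fun_prop)]
      refine lintegral_mono fun ξ => ?_
      rw [lconv_comm]
      unfold lconv
      rw [← lintegral_const_mul _ (by fun_prop), ← lintegral_const_mul _ (by fun_prop)]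
      refine lintegral_mono fun ζ => ?_
      simp only [ha, enorm_mul, RCLike.enorm_conj]
      rw [enorm_ofReal_eq]
      calc _ ≤ ENNReal.ofReal (((2 ^ i) ^ k) ^ 2 * 2) * ‖f ξ‖ₑ *
            (‖(2:ℂ)‖ₑ * (‖dSym f ζ‖ₑ * ‖f (ξ - ζ)‖ₑ)) :=
              mul_le_mul' (mul_le_mul' (hMb ξ) le_rfl) le_rfl
        _ = _ := by
            rw [show ‖(2:ℂ)‖ₑ = 2 by rw [← ofReal_norm]; simp]; ring
    refine hle.trans_lt ?_
    have hsq := sq_lintegral_mul_lconv_le hf.enorm hf.enorm hdf.enorm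
    have h1 := (memLp_two_iff hf).1 hf2
    have h2 := (memLp_two_iff hdf).1 hf'
    have h3 : (∫⁻ ξ, ‖f ξ‖ₑ) < ⊤ := hf1.2
    have h4 := hsq.trans_lt (ENNReal.mul_lt_top h1 (ENNReal.mul_lt_top (ENNReal.pow_lt_top h3) h2))
    have h5 : ∫⁻ ξ, ‖f ξ‖ₑ * lconv (fun ζ => ‖f ζ‖ₑ) (fun ζ => ‖dSym f ζ‖ₑ) ξ < ⊤ := by
      by_contra h
      rw [not_lt, top_le_iff] at h
      rw [h] at h4; simp at h4
    exact ENNReal.mul_lt_top (by finiteness) h5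
  have hinner : ∀ ξ, ∫ ζ, a (ξ, ζ) = (M ξ : ℂ) * starRingEnd ℂ (f ξ) * (2 * conv (dSym f) f ξ) := by
    intro ξ
    simp only [ha, conv]
    rw [integral_const_mul, integral_const_mul]
  have hint1 := hint.integral_prod_left
  simp_rw [hinner] at hint1
  refine ⟨hint1, ?_⟩
  have hz : ∫ ξ, (M ξ : ℂ) * starRingEnd ℂ (f ξ) * (2 * conv (dSym f) f ξ) =
      ∫ p, a p ∂(volume.prod volume) := by
    rw [integral_prod _ hint]; simp_rw [hinner]
  rw [hz]
  set z := ∫ p, a p ∂(volume.prod volume) with hzdef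
  have hswap : starRingEnd ℂ z = ∫ p, starRingEnd ℂ (a p.swap) ∂(volume.prod volume) := by
    rw [integral_conj, integral_prod_swap]
  have hint2 : Integrable (fun p => starRingEnd ℂ (a p.swap)) (volume.prod volume) := by
    have h : Integrable (fun p => a p.swap) (volume.prod volume) := hint.swap
    refine ⟨Complex.continuous_conj.comp_aestronglyMeasurable h.1, ?_⟩
    simpa [hasFiniteIntegral_def, RCLike.enorm_conj] using h.2
  have hsum : z + starRingEnd ℂ z = ∫ p, (a p + starRingEnd ℂ (a p.swap)) ∂(volume.prod volume) := by
    rw [hswap, hzdef, integral_add hint hint2]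
  set K : ℝ := (8 * k + 4) * 3 ^ k with hK
  have hK0 : 0 ≤ K := by positivity
  set F : ℝ → ℝ≥0∞ := fun ξ => ‖f ξ‖ₑ
  have hF : Measurable F := hf.enorm
  set G : ℝ → ℝ≥0∞ := fun ξ => ENNReal.ofReal (V k i ξ) * F ξ with hG
  set D : ℝ → ℝ≥0∞ := fun ξ => ENNReal.ofReal (br ξ) * F ξ with hD
  have hGm : Measurable G := by fun_prop
  have hDm : Measurable D := by fun_prop
  have hpt : ∀ ξ ζ, ‖a (ξ, ζ) + starRingEnd ℂ (a (ζ, ξ))‖ₑ ≤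
      2 * (ENNReal.ofReal K * (G ξ * (G ζ * D (ξ - ζ)) + G ξ * (D ζ * G (ξ - ζ)) +
        D ξ * (G ζ * G (ξ - ζ)))) := by
    intro ξ ζ
    have e : a (ξ, ζ) + starRingEnd ℂ (a (ζ, ξ)) = 2 * Complex.I *
        ((M ξ * (2 * Real.pi * ζ) - M ζ * (2 * Real.pi * ξ) : ℝ) : ℂ) *
        (starRingEnd ℂ (f ξ) * f ζ * f (ξ - ζ)) := by
      have h1 : starRingEnd ℂ (f (ζ - ξ)) = f (ξ - ζ) := by
        rw [← hsymm]; congr 1; ring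
      simp only [ha, dSym, map_mul, Complex.conj_ofReal, Complex.conj_conj, Complex.conj_I, h1,
        map_ofNat]
      push_cast
      ring
    rw [e, enorm_mul, enorm_mul, enorm_mul, enorm_mul, enorm_mul, enorm_I, enorm_ofReal_eq,
      RCLike.enorm_conj, show ‖(2:ℂ)‖ₑ = 2 by rw [← ofReal_norm]; simp, mul_one, mul_assoc]
    have hker := ENNReal.ofReal_le_ofReal (kernel_bound hk i α ξ ζ)
    have a0 := br_pos ξ
    have b0 := br_pos ζ
    have c0 := br_pos (ξ - ζ)
    have p0 := V_pos k i ξ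
    have q0 := V_pos k i ζ
    have r0 := V_pos k i (ξ - ζ)
    rw [← hK, ENNReal.ofReal_mul hK0, ENNReal.ofReal_add (by positivity) (by positivity),
      ENNReal.ofReal_add (by positivity) (by positivity), ENNReal.ofReal_mul c0.le,
      ENNReal.ofReal_mul p0.le, ENNReal.ofReal_mul b0.le, ENNReal.ofReal_mul p0.le,
      ENNReal.ofReal_mul a0.le, ENNReal.ofReal_mul q0.le] at hker
    refine mul_le_mul_right ((mul_le_mul_left hker _).trans (le_of_eq ?_)) 2
    simp only [hG, hD]
    ring
  have hnorm : ENNReal.ofReal (2 * |z.re|) = ‖z + starRingEnd ℂ z‖ₑ := by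
    rw [Complex.add_conj, enorm_ofReal_eq, abs_mul, abs_two]
  have hT : ∀ H F G : ℝ → ℝ≥0∞, Measurable F → Measurable G →
      ∫⁻ ξ, ∫⁻ ζ, H ξ * (F ζ * G (ξ - ζ)) = ∫⁻ ξ, H ξ * lconv F G ξ := by
    intro H F G hF hG
    congr 1; ext ξ
    rw [lintegral_const_mul _ (by fun_prop)]; rfl
  have hS : ∫⁻ ξ, ENNReal.ofReal (V k i ξ) ^ 2 * F ξ ^ 2 = ∫⁻ ξ, G ξ ^ 2 := by
    congr 1; ext ξ; rw [hG, mul_pow]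
  rw [hS]
  have hfinal : 2 * ENNReal.ofReal |z.re| ≤ 2 * (ENNReal.ofReal K *
      ((∫⁻ ξ, D ξ) * (∫⁻ ξ, G ξ ^ 2) + (∫⁻ ξ, D ξ) * (∫⁻ ξ, G ξ ^ 2) +
        (∫⁻ ξ, D ξ) * (∫⁻ ξ, G ξ ^ 2))) := by
    calc 2 * ENNReal.ofReal |z.re| = ‖z + starRingEnd ℂ z‖ₑ := by
          rw [← hnorm, ENNReal.ofReal_mul two_pos.le, ENNReal.ofReal_ofNat]
      _ ≤ ∫⁻ p, ‖a p + starRingEnd ℂ (a p.swap)‖ₑ ∂(volume.prod volume) := by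
          rw [hsum]; exact enorm_integral_le_lintegral_enorm _
      _ = ∫⁻ ξ, ∫⁻ ζ, ‖a (ξ, ζ) + starRingEnd ℂ (a (ζ, ξ))‖ₑ := by
          rw [lintegral_prod _ (by fun_prop)]; rfl
      _ ≤ ∫⁻ ξ, ∫⁻ ζ, 2 * (ENNReal.ofReal K * (G ξ * (G ζ * D (ξ - ζ)) + G ξ * (D ζ * G (ξ - ζ)) +
          D ξ * (G ζ * G (ξ - ζ)))) := lintegral_mono fun ξ => lintegral_mono fun ζ => hpt ξ ζ
      _ = 2 * (ENNReal.ofReal K * ((∫⁻ ξ, G ξ * lconv G D ξ) + (∫⁻ ξ, G ξ * lconv D G ξ) +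
          ∫⁻ ξ, D ξ * lconv G G ξ)) := by
          have m1 := measurable_lconv hGm hDm
          have m2 := measurable_lconv hDm hGm
          rw [← lintegral_add_left (by fun_prop), ← lintegral_add_left (by fun_prop),
            ← lintegral_const_mul' _ _ (by finiteness), ← lintegral_const_mul' _ _ (by finiteness)]
          congr 1; ext ξ
          unfold lconv
          rw [← lintegral_const_mul _ (by fun_prop), ← lintegral_const_mul _ (by fun_prop),
            ← lintegral_const_mul _ (by fun_prop), ← lintegral_add_left (by fun_prop),
            ← lintegral_add_left (by fun_prop),
            ← lintegral_const_mul' _ _ (by finiteness), ← lintegral_const_mul' _ _ (by finiteness)]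
      _ ≤ _ := by
          gcongr
          · rw [lconv_comm]; exact lintegral_mul_lconv_self_le hDm hGm
          · exact lintegral_mul_lconv_self_le hDm hGm
          · rw [← lintegral_mul_const _ hDm]
            refine lintegral_mono fun ξ => mul_le_mul_right ?_ _
            have h := lconv_sq_le hGm hGm ξ
            rw [← sq] at h
            exact (ENNReal.pow_le_pow_left_iff (by norm_num)).1 h
  have := (ENNReal.mul_le_mul_iff_right (by norm_num) (by norm_num)).1 hfinal
  refine this.trans (le_of_eq ?_)
  ring

/-- The part of the energy that comes from `(∂ₓu)²`: here the symbol gains one derivative. -/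
lemma exists_source_energy_le {s : ℝ} {k : ℕ} (hs : 3 / 2 < s) (hk : s < k) :
    ∃ C : ℝ≥0, ∀ α ∈ Icc (0:ℝ) 1, ∀ (i : ℕ) (f : ℝ → ℂ), Measurable f →
      (∫⁻ ξ, ENNReal.ofReal (V k i ξ) ^ 2 * (‖f ξ‖ₑ *
        (ENNReal.ofReal |α ^ 2 * (2 * Real.pi * ξ) * hSym α ξ / 2| * ‖conv (dSym f) (dSym f) ξ‖ₑ)))
        ^ 2 ≤ C * (ENNReal.ofReal ((2:ℝ) ^ (2 * (k - s) * i)) ^ 2 *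
          bn s (fun ξ => ‖f ξ‖ₑ) ^ 3) := by
  obtain ⟨n, rfl⟩ : ∃ n, k = n + 1 := by
    refine Nat.exists_eq_succ_of_ne_zero ?_
    rintro rfl
    norm_num at hk; linarith
  have hn : s - 1 < n := by push_cast at hk; linarith
  obtain ⟨C₁, hC₁⟩ := exists_lintegral_V_le (by linarith : 0 < s) hk
  obtain ⟨C₂, hC₂⟩ := exists_lintegral_V_le (by linarith : 0 < s - 1) hn
  obtain ⟨C₃, hC₃⟩ := exists_bn_lconv_le (by linarith : 1 / 2 < s - 1)
  refine ⟨C₁ * (C₂ * (C₃ * 16)), fun α hα i f hf => ?_⟩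
  have hV := measurable_V (n + 1) i
  have hV' := measurable_V n i
  have hdf := measurable_dSym hf
  have hm := measurable_lconv hdf.enorm hdf.enorm
  set L := lconv (fun ξ => ‖dSym f ξ‖ₑ) (fun ξ => ‖dSym f ξ‖ₑ) with hL
  set N := bn s (fun ξ => ‖f ξ‖ₑ)
  set E := ENNReal.ofReal ((2:ℝ) ^ (2 * (((n + 1 : ℕ) : ℝ) - s) * i))
  calc _ ≤ (∫⁻ ξ, (ENNReal.ofReal (V (n + 1) i ξ) * ‖f ξ‖ₑ) *
        (ENNReal.ofReal (V n i ξ) * L ξ)) ^ 2 := by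
        refine pow_le_pow_left' (lintegral_mono fun ξ => ?_) 2
        have hle : V (n + 1) i ξ * |α ^ 2 * (2 * Real.pi * ξ) * hSym α ξ / 2| ≤ V n i ξ := by
          have h0 := min_br_pos i ξ
          calc _ ≤ V n i ξ * (|α ^ 2 * (2 * Real.pi * ξ) * hSym α ξ / 2| * br ξ) := by
                unfold V
                rw [pow_succ, mul_assoc, mul_comm |_|]
                gcongr
                exact min_le_left _ _
            _ ≤ V n i ξ * 1 := by
                have := (V_pos n i ξ).le
                gcongr; exact symbol_mul_br_le hα ξ
            _ = _ := mul_one _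
        have hle' := ENNReal.ofReal_le_ofReal hle
        rw [ENNReal.ofReal_mul (V_pos _ _ _).le] at hle'
        calc _ = (ENNReal.ofReal (V (n + 1) i ξ) * ‖f ξ‖ₑ) * ((ENNReal.ofReal (V (n + 1) i ξ) *
              ENNReal.ofReal |α ^ 2 * (2 * Real.pi * ξ) * hSym α ξ / 2|) *
              ‖conv (dSym f) (dSym f) ξ‖ₑ) := by ring
          _ ≤ _ := mul_le_mul_right (mul_le_mul' hle' (enorm_conv_le _ _ ξ)) _
    _ ≤ (∫⁻ ξ, (ENNReal.ofReal (V (n + 1) i ξ) * ‖f ξ‖ₑ) ^ 2) *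
        ∫⁻ ξ, (ENNReal.ofReal (V n i ξ) * L ξ) ^ 2 :=
        sq_lintegral_mul_le (by fun_prop) (by fun_prop)
    _ ≤ (C₁ * (E * N)) * (C₂ * (E * (C₃ * ((4 * N) * (4 * N))))) := by
        simp_rw [mul_pow]
        gcongr
        · exact hC₁ i _
        · refine (hC₂ i L).trans ?_
          have hE : ENNReal.ofReal ((2:ℝ) ^ (2 * ((n : ℝ) - (s - 1)) * i)) = E := by
            congr 2; push_cast; ring
          rw [hE]
          gcongr
          refine (hC₃ _ _ hdf.enorm hdf.enorm).trans ?_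
          have h := bn_dSym_le (s - 1) f
          rw [sub_add_cancel] at h
          gcongr
    _ = _ := by push_cast; ring

/-- The energy estimate: the nonlinearity, tested against the solution with the weight `V²`, costs no
derivative, with a constant that is uniform in `α` and in the weight. -/
lemma exists_energy_le {s : ℝ} {k : ℕ} (hs : 3 / 2 < s) (hk : s < k) :
    ∃ C : ℝ≥0, ∀ α ∈ Icc (0:ℝ) 1, ∀ (i : ℕ) (f : ℝ → ℂ) (B : ℝ≥0), Measurable f →
      (∀ ξ, f (-ξ) = starRingEnd ℂ (f ξ)) → bn s (fun ξ => ‖f ξ‖ₑ) ≤ B ^ 2 →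
      |∫ ξ, (starRingEnd ℂ (((V k i ξ ^ 2 : ℝ) : ℂ) * f ξ) * chForm α f f ξ).re| ≤
        C * (2:ℝ) ^ (2 * (k - s) * i) * B ^ 3 := by
  have hk1 : 1 ≤ k := by
    by_contra h
    have : k = 0 := by omega
    subst this
    norm_num at hk; linarith
  obtain ⟨C₁, hC₁⟩ := exists_lintegral_V_le (by linarith : 0 < s) hk
  obtain ⟨C₂, hC₂⟩ := exists_source_energy_le hs hk
  obtain ⟨C₃, hC₃⟩ := exists_sq_lintegral_le (by linarith : 1 / 2 < s - 1)
  set K : ℝ≥0 := ((8 * k + 4) * 3 ^ k : ℝ).toNNReal with hK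
  refine ⟨3 * K * (NNReal.sqrt (C₃ * 4) * C₁) + NNReal.sqrt C₂, fun α hα i f B hf hsymm hB => ?_⟩
  have hlt : bn s (fun ξ => ‖f ξ‖ₑ) < ⊤ := hB.trans_lt (by finiteness)
  have hf2 := memLp_two_of_bn (by linarith : 0 < s) hf hlt
  have hf1 := integrable_of_bn (by linarith : 1 / 2 < s) hf hlt
  have hdf := measurable_dSym hf
  have hbd := bn_dSym_le (s - 1) f
  rw [sub_add_cancel] at hbd
  have hf' := memLp_two_of_bn (by linarith : 0 < s - 1) hdf
    (hbd.trans_lt (ENNReal.mul_lt_top (by norm_num) hlt))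
  have hV := measurable_V k i
  have hh := measurable_hSym α
  have hbr := measurable_br
  have hconj : Measurable (fun ξ => starRingEnd ℂ (f ξ)) := Complex.continuous_conj.measurable.comp hf
  obtain ⟨hAint, hA⟩ := transport_energy_le hk1 i α hf hsymm hf1 hf2 hf'
  set Ai := fun ξ => ((V k i ξ ^ 2 * (1 / 2 + hSym α ξ) : ℝ) : ℂ) * starRingEnd ℂ (f ξ) *
      (2 * conv (dSym f) f ξ) with hAi
  set Bi := fun ξ => ((V k i ξ ^ 2 : ℝ) : ℂ) * (starRingEnd ℂ (f ξ) *
    (Complex.I * ((α ^ 2 * (2 * Real.pi * ξ) * hSym α ξ / 2 : ℝ) : ℂ) *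
      conv (dSym f) (dSym f) ξ)) with hBi
  have hBm : Measurable Bi := by
    have := measurable_conv hdf hdf
    fun_prop
  set E := (2:ℝ) ^ (2 * (k - s) * i) with hE
  have hE0 : 0 < E := by positivity
  have hBsq := hC₂ α hα i f hf
  have hBen : ∀ ξ, ‖Bi ξ‖ₑ = ENNReal.ofReal (V k i ξ) ^ 2 * (‖f ξ‖ₑ *
        (ENNReal.ofReal |α ^ 2 * (2 * Real.pi * ξ) * hSym α ξ / 2| *
          ‖conv (dSym f) (dSym f) ξ‖ₑ)) := by
    intro ξ
    simp only [hBi, enorm_mul, RCLike.enorm_conj, enorm_I, one_mul]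
    rw [enorm_ofReal_eq, enorm_ofReal_eq, abs_of_nonneg (sq_nonneg _),
      ENNReal.ofReal_pow (V_pos k i ξ).le]
  simp_rw [← hBen] at hBsq
  rw [← hE] at hBsq
  have hsqrt : ∀ c : ℝ≥0, (NNReal.sqrt c : ℝ) ^ 2 = c := fun c => by exact_mod_cast NNReal.sq_sqrt c
  have hBle : ∫⁻ ξ, ‖Bi ξ‖ₑ ≤ ENNReal.ofReal (NNReal.sqrt C₂ * E * B ^ 3) := by
    refine (ENNReal.pow_le_pow_left_iff (n := 2) (by norm_num)).1 (hBsq.trans ?_)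
    calc (C₂ : ℝ≥0∞) * (ENNReal.ofReal E ^ 2 * bn s (fun ξ => ‖f ξ‖ₑ) ^ 3)
        ≤ C₂ * (ENNReal.ofReal E ^ 2 * ((B:ℝ≥0∞) ^ 2) ^ 3) := by gcongr
      _ = ENNReal.ofReal (C₂ * (E ^ 2 * ((B:ℝ) ^ 2) ^ 3)) := by
          rw [ENNReal.ofReal_mul (by positivity), ENNReal.ofReal_mul (by positivity),
            ENNReal.ofReal_pow (by positivity), ENNReal.ofReal_pow (by positivity),
            ENNReal.ofReal_pow (by positivity), ENNReal.ofReal_coe_nnreal,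
            ENNReal.ofReal_coe_nnreal]
      _ = _ := by
          rw [← ENNReal.ofReal_pow (by positivity), mul_pow, mul_pow, hsqrt]
          congr 1; ring
  have hBint : Integrable Bi := ⟨hBm.aestronglyMeasurable, hBle.trans_lt (by finiteness)⟩
  have hBnorm : ‖∫ ξ, Bi ξ‖ ≤ NNReal.sqrt C₂ * E * B ^ 3 := by
    have h := (enorm_integral_le_lintegral_enorm Bi).trans hBle
    rw [← ofReal_norm] at h
    exact (ENNReal.ofReal_le_ofReal_iff (by positivity)).1 h
  have hAre : |(∫ ξ, Ai ξ).re| ≤ 3 * K * (NNReal.sqrt (C₃ * 4) * C₁) * E * B ^ 3 := by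
    have h1 : ∫⁻ ξ, ENNReal.ofReal (br ξ) * ‖f ξ‖ₑ ≤ ENNReal.ofReal (NNReal.sqrt (C₃ * 4) * B) := by
      refine (ENNReal.pow_le_pow_left_iff (n := 2) (by norm_num)).1 ?_
      refine (hC₃ _ (by fun_prop)).trans ?_
      have h := bn_br_mul_le (s - 1) (fun ξ => ‖f ξ‖ₑ)
      rw [sub_add_cancel] at h
      rw [← ENNReal.ofReal_pow (by positivity)]
      calc _ ≤ (C₃:ℝ≥0∞) * (4 * (B:ℝ≥0∞) ^ 2) := by gcongr; exact h.trans (by gcongr)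
        _ = ENNReal.ofReal (C₃ * (4 * (B:ℝ) ^ 2)) := by
            rw [ENNReal.ofReal_mul (by positivity), ENNReal.ofReal_mul (by positivity),
              ENNReal.ofReal_pow (by positivity), ENNReal.ofReal_coe_nnreal,
              ENNReal.ofReal_coe_nnreal, ENNReal.ofReal_ofNat]
        _ = _ := by
            congr 1
            rw [mul_pow, hsqrt]; push_cast; ring
    have h2 : ∫⁻ ξ, ENNReal.ofReal (V k i ξ) ^ 2 * ‖f ξ‖ₑ ^ 2 ≤
        ENNReal.ofReal (C₁ * (E * B ^ 2)) := by
      refine (hC₁ i _).trans ?_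
      rw [ENNReal.ofReal_mul (by positivity), ENNReal.ofReal_mul (by positivity),
        ENNReal.ofReal_pow (by positivity), ENNReal.ofReal_coe_nnreal, ENNReal.ofReal_coe_nnreal]
      gcongr
    have h3 : ENNReal.ofReal |(∫ ξ, Ai ξ).re| ≤ ENNReal.ofReal
        (3 * K * (NNReal.sqrt (C₃ * 4) * C₁) * E * B ^ 3) := by
      refine hA.trans ?_
      calc _ ≤ 3 * ENNReal.ofReal ((8 * k + 4) * 3 ^ k) *
            (ENNReal.ofReal (NNReal.sqrt (C₃ * 4) * B) * ENNReal.ofReal (C₁ * (E * B ^ 2))) := by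
            gcongr
        _ = ENNReal.ofReal (3 * ((8 * k + 4) * 3 ^ k) *
            ((NNReal.sqrt (C₃ * 4) * B) * (C₁ * (E * B ^ 2)))) := by
            rw [← ENNReal.ofReal_mul (by positivity), ← ENNReal.ofReal_ofNat,
              ← ENNReal.ofReal_mul (by positivity), ← ENNReal.ofReal_mul (by positivity)]
        _ = _ := by
            rw [hK, Real.coe_toNNReal _ (by positivity)]
            congr 1; ring
    exact (ENNReal.ofReal_le_ofReal_iff (by positivity)).1 h3
  have hpt : ∀ ξ, (starRingEnd ℂ (((V k i ξ ^ 2 : ℝ) : ℂ) * f ξ) * chForm α f f ξ).re =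
      RCLike.re (-(Ai ξ) - Bi ξ) := by
    intro ξ
    have h := dSym_conv hf2 hf' ξ
    have e : starRingEnd ℂ (((V k i ξ ^ 2 : ℝ) : ℂ) * f ξ) * chForm α f f ξ = -(Ai ξ) - Bi ξ := by
      simp only [hAi, hBi, chForm, map_mul, Complex.conj_ofReal]
      rw [← h]; push_cast; ring
    rw [e]; rfl
  simp_rw [hpt]
  have e0 : ∫ ξ, RCLike.re (-(Ai ξ) - Bi ξ) = RCLike.re (∫ ξ, (-(Ai ξ) - Bi ξ)) :=
    integral_re (hAint.neg.sub hBint)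
  rw [e0, integral_sub (by exact hAint.neg) hBint, integral_neg]
  have e : RCLike.re (-(∫ ξ, Ai ξ) - ∫ ξ, Bi ξ) = -(∫ ξ, Ai ξ).re - (∫ ξ, Bi ξ).re := by simp
  rw [e]
  have h1 := abs_sub (-(∫ ξ, Ai ξ).re) ((∫ ξ, Bi ξ).re)
  rw [abs_neg] at h1
  have h2 := Complex.abs_re_le_norm (∫ ξ, Bi ξ)
  calc _ ≤ _ := h1
    _ ≤ _ := add_le_add hAre (h2.trans hBnorm)
    _ = _ := by push_cast; ring

/-! ### Weakly differentiable curves in a Hilbert space -/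

section Hilbert

variable {H : Type*} [NormedAddCommGroup H] [InnerProductSpace ℂ H]

/-- `u(t) = u(0) + ∫₀ᵗ e(τ) dτ` on `[0, T]`, tested against the elements of `D`. -/
def HasWeakIntegral (D : Set H) (u e : ℝ → H) (T : ℝ) : Prop :=
  ∀ d ∈ D, ∀ t ∈ Icc (0:ℝ) T, IntervalIntegrable (fun τ => inner ℂ d (e τ)) volume 0 t ∧
    inner ℂ d (u t) = inner ℂ d (u 0) + ∫ τ in (0:ℝ)..t, inner ℂ d (e τ)

/-- A one-sided bound on the speed in a direction `g` bounds the increment. The curve `e` need not be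
measurable: only its pairings with a dense set are used. -/
lemma HasWeakIntegral.re_inner_sub_le {D : Set H} {u e : ℝ → H} {T K : ℝ}
    (h : HasWeakIntegral D u e T) (hD : Dense D) (hK : ∀ τ ∈ Icc (0:ℝ) T, ‖e τ‖ ≤ K)
    {a b : ℝ} (ha : 0 ≤ a) (hab : a ≤ b) (hb : b ≤ T) {g : H} {c : ℝ}
    (hc : ∀ τ ∈ Icc a b, (inner ℂ g (e τ)).re ≤ c) :
    (inner ℂ g (u b - u a)).re ≤ c * (b - a) := by
  refine le_of_forall_pos_le_add fun ε hε => ?_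
  have hK0 : 0 ≤ K := (norm_nonneg _).trans (hK a ⟨ha, hab.trans hb⟩)
  set W := K * (b - a) + ‖u b - u a‖ with hW
  have hba : 0 ≤ b - a := sub_nonneg.2 hab
  have hW0 : 0 ≤ W := by positivity
  obtain ⟨d, hd, hdist⟩ := Metric.dense_iff.1 hD g (ε / (W + 1)) (by positivity)
  rw [Metric.mem_ball, dist_eq_norm] at hd
  have hnear : ‖g - d‖ * W ≤ ε := by
    rw [norm_sub_rev]
    calc ‖d - g‖ * W ≤ ε / (W + 1) * W := by gcongr
      _ ≤ ε := by
        rw [div_mul_eq_mul_div, div_le_iff₀ (by positivity)]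
        nlinarith
  obtain ⟨ia, ea⟩ := h d hdist a ⟨ha, hab.trans hb⟩
  obtain ⟨ib, eb⟩ := h d hdist b ⟨ha.trans hab, hb⟩
  have iab : IntervalIntegrable (fun τ => inner ℂ d (e τ)) volume a b := ia.symm.trans ib
  have hd1 : inner ℂ d (u b - u a) = ∫ τ in a..b, inner ℂ d (e τ) := by
    rw [inner_sub_right, ea, eb, ← intervalIntegral.integral_interval_sub_left ib ia]; ring
  have hre : (∫ τ in a..b, inner ℂ d (e τ)).re = ∫ τ in a..b, (inner ℂ d (e τ)).re := by
    have := Complex.reCLM.intervalIntegral_comp_comm iab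
    simpa using this.symm
  have hd2 : (inner ℂ d (u b - u a)).re ≤ (c + ‖g - d‖ * K) * (b - a) := by
    rw [hd1, hre]
    have hmono : ∫ τ in a..b, (inner ℂ d (e τ)).re ≤ ∫ _ in a..b, (c + ‖g - d‖ * K) := by
      refine intervalIntegral.integral_mono_on hab ?_ (by simp) fun τ hτ => ?_
      · exact ⟨iab.1.re, iab.2.re⟩
      · have e1 : inner ℂ d (e τ) = inner ℂ g (e τ) - inner ℂ (g - d) (e τ) := by
          rw [inner_sub_left]; ring
        have e2 : ‖inner ℂ (g - d) (e τ)‖ ≤ ‖g - d‖ * K :=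
          (norm_inner_le_norm _ _).trans (by
            gcongr; exact hK τ ⟨ha.trans hτ.1, hτ.2.trans hb⟩)
        have e3 := (abs_le.1 (Complex.abs_re_le_norm (inner ℂ (g - d) (e τ)))).1
        rw [e1, Complex.sub_re]
        linarith [hc τ hτ]
    refine hmono.trans (le_of_eq ?_)
    rw [intervalIntegral.integral_const, smul_eq_mul]; ring
  have e1 : inner ℂ g (u b - u a) = inner ℂ d (u b - u a) + inner ℂ (g - d) (u b - u a) := by
    rw [inner_sub_left]; ring
  have e2 := (Complex.re_le_norm _).trans (norm_inner_le_norm (𝕜 := ℂ) (g - d) (u b - u a))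
  rw [e1, Complex.add_re]
  have : (c + ‖g - d‖ * K) * (b - a) + ‖g - d‖ * ‖u b - u a‖ = c * (b - a) + ‖g - d‖ * W := by
    rw [hW]; ring
  linarith

/-- A bound for the speed, seen through a bounded operator and relative to a constant velocity. -/
lemma HasWeakIntegral.norm_sub_le [CompleteSpace H] {D : Set H} {u e : ℝ → H} {T K : ℝ}
    (h : HasWeakIntegral D u e T) (hD : Dense D) (hK : ∀ τ ∈ Icc (0:ℝ) T, ‖e τ‖ ≤ K)
    {a b : ℝ} (ha : 0 ≤ a) (hab : a ≤ b) (hb : b ≤ T) (P : H →L[ℂ] H) (G : H) {c : ℝ}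
    (hc : ∀ τ ∈ Icc a b, ‖P (e τ - G)‖ ≤ c) :
    ‖P (u b - u a - ((b - a : ℝ) : ℂ) • G)‖ ≤ c * (b - a) := by
  set z := u b - u a - ((b - a : ℝ) : ℂ) • G with hz
  have hc0 : 0 ≤ c := (norm_nonneg _).trans (hc a ⟨le_rfl, hab⟩)
  have hba : 0 ≤ b - a := sub_nonneg.2 hab
  set g := ContinuousLinearMap.adjoint P (P z) with hg
  have hgi : ∀ x, inner ℂ g x = inner ℂ (P z) (P x) := fun x => by
    rw [hg, ContinuousLinearMap.adjoint_inner_left]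
  have h1 := h.re_inner_sub_le hD hK ha hab hb (g := g)
    (c := (inner ℂ g G).re + ‖P z‖ * c) fun τ hτ => by
      have e1 : inner ℂ g (e τ) = inner ℂ g G + inner ℂ (P z) (P (e τ - G)) := by
        rw [← hgi, inner_sub_right]; ring
      rw [e1, Complex.add_re]
      have := (Complex.re_le_norm _).trans (norm_inner_le_norm (𝕜 := ℂ) (P z) (P (e τ - G)))
      have h2 := mul_le_mul_of_nonneg_left (hc τ hτ) (norm_nonneg (P z))
      linarith
  have h2 : (inner ℂ g (u b - u a)).re = ‖P z‖ ^ 2 + (b - a) * (inner ℂ g G).re := by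
    have e1 : u b - u a = z + ((b - a : ℝ) : ℂ) • G := by rw [hz]; abel
    rw [e1, inner_add_right, inner_smul_right, Complex.add_re, Complex.re_ofReal_mul, hgi,
      inner_self_eq_norm_sq_to_K]
    congr 1
    norm_cast
  rcases eq_or_lt_of_le (norm_nonneg (P z)) with h0 | h0
  · rw [← h0]; positivity
  · refine le_of_mul_le_mul_left ?_ h0
    nlinarith

/-- A bound for increments with a quadratic error improves to one without error, by subdividing
the interval. -/
lemma sub_le_mul_of_quadratic_error {y : ℝ → ℝ} {a b S K : ℝ} (hab : a ≤ b)
    (h : ∀ x x', a ≤ x → x ≤ x' → x' ≤ b → y x' - y x ≤ S * (x' - x) + K * (x' - x) ^ 2) :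
    y b - y a ≤ S * (b - a) := by
  have key : ∀ n : ℕ, y b - y a ≤ S * (b - a) + K * (b - a) ^ 2 * (1 / ((n:ℝ) + 1)) := by
    intro n
    set d := (b - a) / ((n:ℝ) + 1) with hd
    have hn : (0:ℝ) < (n:ℝ) + 1 := by positivity
    have hd0 : 0 ≤ d := div_nonneg (sub_nonneg.2 hab) hn.le
    have hnd : ((n:ℝ) + 1) * d = b - a := by rw [hd]; field_simp
    have step : ∀ m : ℕ, m ≤ n + 1 → y (a + m * d) - y a ≤ m * (S * d + K * d ^ 2) := by
      intro m
      induction m with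
      | zero => intro _; simp
      | succ m ih =>
        intro hm
        have h1 := ih (by omega)
        have hm' : ((m:ℝ) + 1) ≤ (n:ℝ) + 1 := by exact_mod_cast hm
        have h2 := h (a + m * d) (a + (m + 1 : ℕ) * d) (by nlinarith [mul_nonneg m.cast_nonneg hd0])
          (by push_cast; nlinarith) (by push_cast; nlinarith)
        have e : a + ((m + 1 : ℕ) : ℝ) * d - (a + m * d) = d := by push_cast; ring
        rw [e] at h2
        push_cast at h2 ⊢
        linarith
    have h1 := step (n + 1) le_rfl
    push_cast at h1
    rw [hnd, show a + (b - a) = b by ring] at h1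
    refine h1.trans (le_of_eq ?_)
    rw [mul_add, ← mul_assoc, mul_comm _ S, mul_assoc, hnd]
    congr 1
    rw [hd]; field_simp
  have hlim : Filter.Tendsto (fun n : ℕ => S * (b - a) + K * (b - a) ^ 2 * (1 / ((n:ℝ) + 1)))
      Filter.atTop (nhds (S * (b - a) + K * (b - a) ^ 2 * 0)) :=
    (tendsto_one_div_add_atTop_nhds_zero_nat.const_mul _).const_add _
  have := ge_of_tendsto' hlim key
  simpa using this

/-- The energy inequality for a quadratic form: a bound for `2 Re⟨A u, e⟩` bounds the growth of
`⟨A u, u⟩`. The curve is Lipschitz, so on short intervals `A (u b + u a)` may be replaced by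
`2 A (u τ)` up to a quadratic error. -/
lemma HasWeakIntegral.re_inner_le [CompleteSpace H] {D : Set H} {u e : ℝ → H} {T K : ℝ}
    (h : HasWeakIntegral D u e T) (hD : Dense D) (hK : ∀ τ ∈ Icc (0:ℝ) T, ‖e τ‖ ≤ K)
    {a b : ℝ} (ha : 0 ≤ a) (hab : a ≤ b) (hb : b ≤ T) (A : H →L[ℂ] H)
    (hA : ∀ x y, inner ℂ (A x) y = inner ℂ x (A y)) {S : ℝ}
    (hS : ∀ τ ∈ Icc a b, 2 * (inner ℂ (A (u τ)) (e τ)).re ≤ S) :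
    (inner ℂ (A (u b)) (u b)).re ≤ (inner ℂ (A (u a)) (u a)).re + S * (b - a) := by
  have hK0 : 0 ≤ K := (norm_nonneg _).trans (hK a ⟨ha, hab.trans hb⟩)
  have hlip : ∀ x x', a ≤ x → x ≤ x' → x' ≤ b → ‖u x' - u x‖ ≤ K * (x' - x) := by
    intro x x' h1 h2 h3
    have := h.norm_sub_le hD hK (ha.trans h1) h2 (h3.trans hb) (ContinuousLinearMap.id ℂ H) 0
      (c := K) fun τ hτ => by
        simpa using hK τ ⟨(ha.trans h1).trans hτ.1, hτ.2.trans (h3.trans hb)⟩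
    simpa using this
  have key := sub_le_mul_of_quadratic_error (y := fun t => (inner ℂ (A (u t)) (u t)).re) (S := S)
    (K := 2 * (‖A‖ * K * K)) hab ?_
  · linarith
  intro x x' h1 h2 h3
  have e1 : (inner ℂ (A (u x')) (u x')).re - (inner ℂ (A (u x)) (u x)).re =
      (inner ℂ (A (u x' + u x)) (u x' - u x)).re := by
    have hsym : (inner ℂ (A (u x')) (u x)).re = (inner ℂ (A (u x)) (u x')).re := by
      rw [hA, ← inner_conj_symm, Complex.conj_re]
    rw [map_add, inner_add_left, inner_sub_right, inner_sub_right]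
    simp only [Complex.add_re, Complex.sub_re]
    linarith
  show (inner ℂ (A (u x')) (u x')).re - (inner ℂ (A (u x)) (u x)).re ≤ _
  rw [e1]
  have h4 := h.re_inner_sub_le hD hK (ha.trans h1) h2 (h3.trans hb) (g := A (u x' + u x))
    (c := S + 2 * (‖A‖ * K * K) * (x' - x)) ?_
  · refine h4.trans (le_of_eq ?_); ring
  intro τ hτ
  have hτ' : τ ∈ Icc (0:ℝ) T := ⟨(ha.trans h1).trans hτ.1, hτ.2.trans (h3.trans hb)⟩
  have bound : ∀ w : H, ‖w‖ ≤ K * (x' - x) → (inner ℂ (A w) (e τ)).re ≤ ‖A‖ * K * K * (x' - x) := by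
    intro w hw
    calc _ ≤ ‖inner ℂ (A w) (e τ)‖ := Complex.re_le_norm _
      _ ≤ ‖A w‖ * ‖e τ‖ := norm_inner_le_norm _ _
      _ ≤ (‖A‖ * (K * (x' - x))) * K := by
          gcongr
          · exact (A.le_opNorm w).trans (by gcongr)
          · exact hK τ hτ'
      _ = _ := by ring
  have b1 := bound (u x' - u τ) ((hlip τ x' (h1.trans hτ.1) hτ.2 h3).trans (by
    gcongr; exact hτ.1))
  have b2 := bound (u x - u τ) (by
    rw [norm_sub_rev]
    exact (hlip x τ h1 hτ.1 (hτ.2.trans h3)).trans (by gcongr; exact hτ.2))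
  have e2 : inner ℂ (A (u x' + u x)) (e τ) = 2 * inner ℂ (A (u τ)) (e τ) +
      inner ℂ (A (u x' - u τ)) (e τ) + inner ℂ (A (u x - u τ)) (e τ) := by
    rw [map_add, map_sub, map_sub, inner_add_left, inner_sub_left, inner_sub_left]; ring
  have h5 := hS τ ⟨h1.trans hτ.1, hτ.2.trans h3⟩
  rw [e2, Complex.add_re, Complex.add_re]
  have e3 : (2 * inner ℂ (A (u τ)) (e τ)).re = 2 * (inner ℂ (A (u τ)) (e τ)).re := by simp
  rw [e3]
  linarith

end Hilbert

/-! ### Solutions on the Fourier side -/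

lemma inner_toLp {u v : ℝ → ℂ} (hu : MemLp u 2) (hv : MemLp v 2) :
    inner ℂ (hu.toLp u) (hv.toLp v) = ∫ ξ, starRingEnd ℂ (u ξ) * v ξ := by
  rw [L2.inner_def]
  refine integral_congr_ae ?_
  filter_upwards [hu.coeFn_toLp, hv.coeFn_toLp] with ξ h1 h2
  rw [h1, h2, RCLike.inner_apply, mul_comm]

lemma enorm_toLp_sq {u : ℝ → ℂ} (hu : MemLp u 2) : ‖hu.toLp u‖ₑ ^ 2 = ∫⁻ ξ, ‖u ξ‖ₑ ^ 2 := by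
  rw [Lp.enorm_toLp, eLpNorm_eq_lintegral_rpow_enorm_toReal (by norm_num) (by norm_num),
    ← ENNReal.rpow_natCast, ← ENNReal.rpow_mul]
  norm_num

lemma norm_toLp_le_iff {u : ℝ → ℂ} (hu : MemLp u 2) {c : ℝ} (hc : 0 ≤ c) :
    ‖hu.toLp u‖ ≤ c ↔ ∫⁻ ξ, ‖u ξ‖ₑ ^ 2 ≤ ENNReal.ofReal (c ^ 2) := by
  rw [← enorm_toLp_sq hu, ENNReal.ofReal_pow hc, ENNReal.pow_le_pow_left_iff (by norm_num),
    ← ofReal_norm, ENNReal.ofReal_le_ofReal_iff hc]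

/-- Multiplication by a bounded function as an operator on `L²`. -/
noncomputable def mulOp {m : ℝ → ℂ} (hm : MemLp m ⊤) :
    Lp ℂ 2 (volume : Measure ℝ) →L[ℂ] Lp ℂ 2 (volume : Measure ℝ) :=
  (ContinuousLinearMap.mul ℂ ℂ).holderL volume ⊤ 2 2 (hm.toLp m)

lemma coeFn_mulOp {m : ℝ → ℂ} (hm : MemLp m ⊤) (x : Lp ℂ 2 (volume : Measure ℝ)) :
    mulOp hm x =ᵐ[volume] fun ξ => m ξ * x ξ := by
  have h : mulOp hm x = (ContinuousLinearMap.mul ℂ ℂ).holder 2 (hm.toLp m) x := rfl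
  rw [h]
  filter_upwards [ContinuousLinearMap.coeFn_holder (r := 2) (ContinuousLinearMap.mul ℂ ℂ)
    (hm.toLp m) x, hm.coeFn_toLp] with ξ h1 h2
  rw [h1, h2]; rfl

lemma mulOp_toLp {m : ℝ → ℂ} (hm : MemLp m ⊤) {u : ℝ → ℂ} (hu : MemLp u 2) :
    ∃ hmu : MemLp (fun ξ => m ξ * u ξ) 2, mulOp hm (hu.toLp u) = hmu.toLp _ := by
  have h : mulOp hm (hu.toLp u) =ᵐ[volume] fun ξ => m ξ * u ξ := by
    filter_upwards [coeFn_mulOp hm (hu.toLp u), hu.coeFn_toLp] with ξ h1 h2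
    rw [h1, h2]
  have hmu : MemLp (fun ξ => m ξ * u ξ) 2 := (memLp_congr_ae h).1 (Lp.memLp _)
  refine ⟨hmu, Lp.ext ?_⟩
  exact h.trans hmu.coeFn_toLp.symm

lemma mulOp_symm {m : ℝ → ℂ} (hm : MemLp m ⊤) (hreal : ∀ ξ, starRingEnd ℂ (m ξ) = m ξ)
    (x y : Lp ℂ 2 (volume : Measure ℝ)) :
    inner ℂ (mulOp hm x) y = inner ℂ x (mulOp hm y) := by
  rw [L2.inner_def, L2.inner_def]
  refine integral_congr_ae ?_
  filter_upwards [coeFn_mulOp hm x, coeFn_mulOp hm y] with ξ h1 h2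
  rw [h1, h2, RCLike.inner_apply, RCLike.inner_apply, map_mul, hreal]; ring

/-- The pointwise complex conjugate of a Schwartz function. -/
noncomputable def conjSchwartz : 𝓢(ℝ, ℂ) →L[ℝ] 𝓢(ℝ, ℂ) :=
  SchwartzMap.postcompCLM (𝕜 := ℝ) (Complex.conjCLE : ℂ →L[ℝ] ℂ)

@[simp] lemma conjSchwartz_apply (ψ : 𝓢(ℝ, ℂ)) (x : ℝ) :
    conjSchwartz ψ x = starRingEnd ℂ (ψ x) := rfl

/-- The Fourier transform of a real-valued solution of the Camassa-Holm equation on `[0, T]` that is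
bounded in `B^s_{2,∞}`: the equation is integrated in time and tested against Schwartz functions. -/
structure IsFourierSolution (s α T : ℝ) (f : ℝ → ℝ → ℂ) : Prop where
  measurable : ∀ t ∈ Icc (0:ℝ) T, Measurable (f t)
  symm : ∀ t ∈ Icc (0:ℝ) T, ∀ ξ, f t (-ξ) = starRingEnd ℂ (f t ξ)
  bounded : ∃ M : ℝ≥0, ∀ t ∈ Icc (0:ℝ) T, bn s (fun ξ => ‖f t ξ‖ₑ) ≤ M
  weak : ∀ ψ : 𝓢(ℝ, ℂ), ∀ t ∈ Icc (0:ℝ) T,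
    IntervalIntegrable (fun τ => ∫ ξ, ψ ξ * chForm α (f τ) (f τ) ξ) volume 0 t ∧
    ∫ ξ, ψ ξ * f t ξ = (∫ ξ, ψ ξ * f 0 ξ) +
      ∫ τ in (0:ℝ)..t, ∫ ξ, ψ ξ * chForm α (f τ) (f τ) ξ

open Classical in
/-- A function as an element of `L²` (zero if it is not square integrable). -/
noncomputable def toL2 (u : ℝ → ℂ) : Lp ℂ 2 (volume : Measure ℝ) :=
  if h : MemLp u 2 then h.toLp u else 0

lemma toL2_eq {u : ℝ → ℂ} (hu : MemLp u 2) : toL2 u = hu.toLp u := dif_pos hu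

namespace IsFourierSolution

variable {s α T : ℝ} {f : ℝ → ℝ → ℂ}

lemma memLp (h : IsFourierSolution s α T f) (hs : 3 / 2 < s) {t : ℝ} (ht : t ∈ Icc (0:ℝ) T) :
    MemLp (f t) 2 := by
  obtain ⟨M, hM⟩ := h.bounded
  exact memLp_two_of_bn (by linarith : 0 < s) (h.measurable t ht)
    ((hM t ht).trans_lt ENNReal.coe_lt_top)

lemma memLp_dSym (h : IsFourierSolution s α T f) (hs : 3 / 2 < s) {t : ℝ} (ht : t ∈ Icc (0:ℝ) T) :
    MemLp (dSym (f t)) 2 := by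
  obtain ⟨M, hM⟩ := h.bounded
  have hbd := bn_dSym_le (s - 1) (f t)
  rw [sub_add_cancel] at hbd
  exact memLp_two_of_bn (by linarith : 0 < s - 1) (measurable_dSym (h.measurable t ht))
    (hbd.trans_lt (ENNReal.mul_lt_top (by norm_num) ((hM t ht).trans_lt ENNReal.coe_lt_top)))

/-- The velocity is bounded in `L²`. The bound depends on the solution; it is only used
qualitatively. -/
lemma exists_speed_bound (h : IsFourierSolution s α T f) (hs : 3 / 2 < s)
    (hα : α ∈ Icc (0:ℝ) 1) :
    ∃ K : ℝ≥0, ∀ t ∈ Icc (0:ℝ) T, MemLp (chForm α (f t) (f t)) 2 ∧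
      ‖toL2 (chForm α (f t) (f t))‖ ≤ K := by
  obtain ⟨M, hM⟩ := h.bounded
  obtain ⟨C₁, hC₁⟩ := exists_bn_chForm_le hs
  obtain ⟨C₂, hC₂⟩ := exists_lintegral_sq_le (by linarith : 0 < s - 1)
  refine ⟨NNReal.sqrt (C₂ * (C₁ * (M * M))), fun t ht => ?_⟩
  have hm := measurable_chForm α (h.measurable t ht) (h.measurable t ht)
  have hle : ∫⁻ ξ, ‖chForm α (f t) (f t) ξ‖ₑ ^ 2 ≤ ((C₂ * (C₁ * (M * M)) : ℝ≥0) : ℝ≥0∞) := by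
    push_cast
    refine (hC₂ _).trans ?_
    gcongr
    refine (hC₁ α hα _ _ (h.measurable t ht) (h.measurable t ht)).trans ?_
    gcongr <;> exact hM t ht
  have hmem := (memLp_two_iff hm).2 (hle.trans_lt ENNReal.coe_lt_top)
  refine ⟨hmem, ?_⟩
  rw [toL2_eq hmem, norm_toLp_le_iff hmem (by positivity)]
  refine hle.trans (le_of_eq ?_)
  rw [← NNReal.coe_pow, NNReal.sq_sqrt, ENNReal.ofReal_coe_nnreal]

lemma hasWeakIntegral (h : IsFourierSolution s α T f) (hs : 3 / 2 < s) (hα : α ∈ Icc (0:ℝ) 1) :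
    HasWeakIntegral (range (SchwartzMap.toLpCLM ℂ ℂ 2 (volume : Measure ℝ)))
      (fun t => toL2 (f t)) (fun t => toL2 (chForm α (f t) (f t))) T := by
  obtain ⟨K, hK⟩ := h.exists_speed_bound hs hα
  rintro _ ⟨ψ, rfl⟩ t ht
  have hψ : SchwartzMap.toLpCLM ℂ ℂ 2 (volume : Measure ℝ) ψ = (ψ.memLp 2 volume).toLp ψ := rfl
  have h0 : (0:ℝ) ∈ Icc (0:ℝ) T := ⟨le_rfl, ht.1.trans ht.2⟩
  obtain ⟨hi, he⟩ := h.weak (conjSchwartz ψ) t ht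
  simp only [conjSchwartz_apply] at hi he
  have hu : ∀ t ∈ Icc (0:ℝ) T, inner ℂ (SchwartzMap.toLpCLM ℂ ℂ 2 (volume : Measure ℝ) ψ)
      (toL2 (f t)) = ∫ ξ, starRingEnd ℂ (ψ ξ) * f t ξ := fun t ht => by
    rw [toL2_eq (h.memLp hs ht), hψ, inner_toLp]
  have hsub : ∀ τ ∈ uIcc 0 t, τ ∈ Icc (0:ℝ) T := fun τ hτ => by
    rw [uIcc_of_le ht.1] at hτ
    exact ⟨hτ.1, hτ.2.trans ht.2⟩
  have hv : ∀ τ ∈ uIcc 0 t, inner ℂ (SchwartzMap.toLpCLM ℂ ℂ 2 (volume : Measure ℝ) ψ)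
      (toL2 (chForm α (f τ) (f τ))) = ∫ ξ, starRingEnd ℂ (ψ ξ) * chForm α (f τ) (f τ) ξ :=
    fun τ hτ => by
      rw [toL2_eq (hK τ (hsub τ hτ)).1, hψ, inner_toLp]
  refine ⟨hi.congr fun τ hτ => (hv τ (uIoc_subset_uIcc hτ)).symm, ?_⟩
  rw [hu t ht, hu 0 h0, he, intervalIntegral.integral_congr hv]

lemma dense_schwartz : Dense (range (SchwartzMap.toLpCLM ℂ ℂ 2 (volume : Measure ℝ))) :=
  SchwartzMap.denseRange_toLpCLM ENNReal.ofNat_ne_top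

/-- A bound for the speed in `B^σ_{2,∞}`, relative to a constant velocity `G`, bounds the deviation
from uniform motion. -/
lemma bn_sub_le (h : IsFourierSolution s α T f) (hs : 3 / 2 < s) (hα : α ∈ Icc (0:ℝ) 1)
    {t : ℝ} (ht : t ∈ Icc (0:ℝ) T) {G : ℝ → ℂ} (hG : MemLp G 2) (σ : ℝ) {c : ℝ≥0}
    (hc : ∀ τ ∈ Icc (0:ℝ) t, bn σ (fun ξ => ‖chForm α (f τ) (f τ) ξ - G ξ‖ₑ) ≤ c) :
    bn σ (fun ξ => ‖f t ξ - f 0 ξ - (t : ℂ) * G ξ‖ₑ) ≤ c * ENNReal.ofReal (t ^ 2) := by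
  obtain ⟨K, hK⟩ := h.exists_speed_bound hs hα
  have h0 : (0:ℝ) ∈ Icc (0:ℝ) T := ⟨le_rfl, ht.1.trans ht.2⟩
  refine bn_le fun j => ?_
  set m : ℝ → ℂ := (shell j).indicator 1 with hm
  have hmm : Measurable m := measurable_one.indicator (measurableSet_shell j)
  have hmt : MemLp m ⊤ (volume : Measure ℝ) := memLp_top_of_bound hmm.aestronglyMeasurable 1 <|
    Filter.Eventually.of_forall fun ξ => by
    by_cases hξ : ξ ∈ shell j <;> simp [hm, hξ]
  have hshell : ∀ u : ℝ → ℂ, ∫⁻ ξ, ‖m ξ * u ξ‖ₑ ^ 2 = ∫⁻ ξ in shell j, ‖u ξ‖ₑ ^ 2 := fun u => by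
    rw [← lintegral_indicator (measurableSet_shell j)]
    congr 1; ext ξ
    by_cases hξ : ξ ∈ shell j <;> simp [hm, hξ]
  set c' : ℝ := Real.sqrt ((2:ℝ) ^ (-(2 * σ * j)) * c) with hc'
  have hsq : c' ^ 2 = (2:ℝ) ^ (-(2 * σ * j)) * c := Real.sq_sqrt (by positivity)
  have key := (h.hasWeakIntegral hs hα).norm_sub_le dense_schwartz (fun τ hτ => (hK τ hτ).2)
    le_rfl ht.1 ht.2 (mulOp hmt) (hG.toLp G) (c := c') ?_
  · have e1 : toL2 (f t) - toL2 (f 0) - ((t - 0 : ℝ) : ℂ) • hG.toLp G =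
        (((h.memLp hs ht).sub (h.memLp hs h0)).sub (hG.const_mul (t:ℂ))).toLp _ := by
      rw [toL2_eq (h.memLp hs ht), toL2_eq (h.memLp hs h0), sub_zero]; rfl
    obtain ⟨hmu, e2⟩ := mulOp_toLp hmt (((h.memLp hs ht).sub (h.memLp hs h0)).sub
      (hG.const_mul (t:ℂ)))
    rw [e1, e2, norm_toLp_le_iff hmu (by have := ht.1; positivity), sub_zero, hshell, mul_pow, hsq,
      ENNReal.ofReal_mul (by positivity), ENNReal.ofReal_mul (by positivity),
      ENNReal.ofReal_coe_nnreal, mul_assoc] at key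
    exact key
  · intro τ hτ
    have hτ' : τ ∈ Icc (0:ℝ) T := ⟨hτ.1, hτ.2.trans ht.2⟩
    have hmem := (hK τ hτ').1
    obtain ⟨hmu, e2⟩ := mulOp_toLp hmt (hmem.sub hG)
    have e1 : toL2 (chForm α (f τ) (f τ)) - hG.toLp G = (hmem.sub hG).toLp _ := by
      rw [toL2_eq hmem]; rfl
    rw [e1, e2, norm_toLp_le_iff hmu (by positivity), hshell, hsq,
      ENNReal.ofReal_mul (by positivity), ENNReal.ofReal_coe_nnreal]
    refine (setLIntegral_shell_le σ _ j).trans ?_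
    gcongr
    exact hc τ hτ

/-- The square of the weighted `L²` norm with weight `V k i`. -/
noncomputable def energy (k i : ℕ) (u : ℝ → ℂ) : ℝ≥0∞ :=
  ∫⁻ ξ, ENNReal.ofReal (V k i ξ) ^ 2 * ‖u ξ‖ₑ ^ 2

/-- Growth of the weighted energies over a time interval on which the solution is bounded. -/
lemma exists_energy_growth (hs : 3 / 2 < s) {k : ℕ} (hk : s < k) :
    ∃ C : ℝ≥0, ∀ α ∈ Icc (0:ℝ) 1, ∀ (T : ℝ) (f : ℝ → ℝ → ℂ), IsFourierSolution s α T f →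
      ∀ a b : ℝ, 0 ≤ a → a ≤ b → b ≤ T → ∀ B : ℝ≥0,
      (∀ τ ∈ Icc a b, bn s (fun ξ => ‖f τ ξ‖ₑ) ≤ B ^ 2) → ∀ i : ℕ,
      energy k i (f b) ≤ energy k i (f a) +
        ENNReal.ofReal ((2:ℝ) ^ (2 * (k - s) * i)) * ENNReal.ofReal (C * B ^ 3 * (b - a)) := by
  obtain ⟨C, hC⟩ := exists_energy_le hs hk
  refine ⟨2 * C, fun α hα T f h a b ha hab hb B hB i => ?_⟩
  obtain ⟨K, hK⟩ := h.exists_speed_bound hs hα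
  set m : ℝ → ℂ := fun ξ => ((V k i ξ ^ 2 : ℝ) : ℂ) with hm
  have hV := measurable_V k i
  have hmt : MemLp m ⊤ (volume : Measure ℝ) :=
    memLp_top_of_bound (by fun_prop) (((2 ^ i) ^ k) ^ 2) <| Filter.Eventually.of_forall fun ξ => by
      rw [hm, Complex.norm_real, Real.norm_eq_abs, abs_of_nonneg (by positivity)]
      have := (V_pos k i ξ).le
      gcongr; exact V_le k i ξ
  have key := (h.hasWeakIntegral hs hα).re_inner_le dense_schwartz (fun τ hτ => (hK τ hτ).2)
    ha hab hb (mulOp hmt) (mulOp_symm hmt fun ξ => by rw [hm, Complex.conj_ofReal])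
    (S := 2 * (C * (2:ℝ) ^ (2 * (k - s) * i) * B ^ 3)) ?_
  · have hen : ∀ t ∈ Icc (0:ℝ) T, energy k i (f t) =
        ENNReal.ofReal (inner ℂ (mulOp hmt (toL2 (f t))) (toL2 (f t))).re := by
      intro t ht
      have hmem := h.memLp hs ht
      obtain ⟨hmu, e⟩ := mulOp_toLp hmt hmem
      rw [toL2_eq hmem, e, inner_toLp]
      have hpt : ∀ ξ, starRingEnd ℂ (m ξ * f t ξ) * f t ξ =
          ((V k i ξ ^ 2 * ‖f t ξ‖ ^ 2 : ℝ) : ℂ) := fun ξ => by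
        rw [hm, map_mul, Complex.conj_ofReal, mul_assoc, mul_comm (starRingEnd ℂ _),
          Complex.mul_conj, Complex.normSq_eq_norm_sq]
        push_cast; ring
      simp_rw [hpt]
      rw [integral_complex_ofReal, Complex.ofReal_re, ofReal_integral_eq_lintegral_ofReal]
      · unfold energy
        congr 1; ext ξ
        rw [ENNReal.ofReal_mul (by positivity), ENNReal.ofReal_pow (V_pos k i ξ).le,
          ENNReal.ofReal_pow (norm_nonneg _), ofReal_norm]
      · have hi : Integrable (fun ξ => starRingEnd ℂ (m ξ * f t ξ) * f t ξ) :=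
          MemLp.integrable_mul hmu.star hmem
        simp_rw [hpt] at hi
        exact hi.re
      · exact Filter.Eventually.of_forall fun ξ => by positivity
    rw [hen b ⟨ha.trans hab, hb⟩, hen a ⟨ha, hab.trans hb⟩]
    refine (ENNReal.ofReal_le_ofReal key).trans (ENNReal.ofReal_add_le.trans (le_of_eq ?_))
    rw [← ENNReal.ofReal_mul (by positivity)]
    congr 2; push_cast; ring
  · intro τ hτ
    have hτ' : τ ∈ Icc (0:ℝ) T := ⟨ha.trans hτ.1, hτ.2.trans hb⟩
    have hmem := h.memLp hs hτ'
    obtain ⟨hmu, e⟩ := mulOp_toLp hmt hmem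
    have hi : Integrable (fun ξ => starRingEnd ℂ (m ξ * f τ ξ) * chForm α (f τ) (f τ) ξ) :=
      MemLp.integrable_mul hmu.star (hK τ hτ').1
    have hre := integral_re hi
    have hle := hC α hα i (f τ) B (h.measurable τ hτ') (h.symm τ hτ') (hB τ hτ)
    have e2 : (inner ℂ (mulOp hmt (toL2 (f τ))) (toL2 (chForm α (f τ) (f τ)))).re =
        ∫ ξ, (starRingEnd ℂ (m ξ * f τ ξ) * chForm α (f τ) (f τ) ξ).re := by
      rw [toL2_eq hmem, toL2_eq (hK τ hτ').1, e, inner_toLp]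
      exact hre.symm
    rw [e2]
    linarith [(abs_le.1 hle).2]

/-- The a priori bound: for a short time that depends only on the size of the initial value,
the solution stays bounded. A finite bound `M` of unknown size turns the local growth estimate into
an induction over time steps of a length that depends on `M`. -/
lemma exists_apriori (hs : 3 / 2 < s) (R : ℝ≥0) :
    ∃ T₀ : ℝ, 0 < T₀ ∧ ∃ N : ℝ≥0, ∀ α ∈ Icc (0:ℝ) 1, ∀ T ≤ T₀, ∀ f : ℝ → ℝ → ℂ,
      IsFourierSolution s α T f → bn s (fun ξ => ‖f 0 ξ‖ₑ) ≤ R →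
      ∀ t ∈ Icc (0:ℝ) T, bn s (fun ξ => ‖f t ξ‖ₑ) ≤ N := by
  obtain ⟨k, hk⟩ := exists_nat_gt s
  obtain ⟨C₁, hC₁⟩ := exists_lintegral_V_le (by linarith : 0 < s) hk
  obtain ⟨C, hC⟩ := exists_energy_growth hs hk
  set Y : ℝ≥0 := C₁ * R with hY
  set B₀ : ℝ≥0 := NNReal.sqrt (Y + 1) with hB₀
  have hB₀sq : B₀ ^ 2 = Y + 1 := NNReal.sq_sqrt _
  -- A time step that keeps the growth `C * B ^ 3 * δ` below one half.
  have hstep : ∀ B : ℝ≥0, (C:ℝ) * B ^ 3 * (1 / (2 * (C * B ^ 3) + 1)) ≤ 1 / 2 := by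
    intro B
    have : (0:ℝ) ≤ C * B ^ 3 := by positivity
    rw [mul_one_div, div_le_div_iff₀ (by positivity) (by norm_num)]
    linarith
  refine ⟨1 / (2 * (C * B₀ ^ 3) + 1), by positivity, Y + 1, fun α hα T hT f h hR => ?_⟩
  obtain ⟨M, hM⟩ := h.bounded
  set Bm : ℝ≥0 := NNReal.sqrt M with hBm
  have hBmsq : Bm ^ 2 = M := NNReal.sq_sqrt _
  set δ : ℝ := 1 / (2 * (C * Bm ^ 3) + 1) with hδ
  have hδ0 : 0 < δ := by positivity
  set E : ℕ → ℝ≥0∞ := fun i => ENNReal.ofReal ((2:ℝ) ^ (2 * (k - s) * i)) with hE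
  have hbn : ∀ t, (∀ i, energy k i (f t) ≤ E i * ((Y + 1 : ℝ≥0) : ℝ≥0∞)) →
      bn s (fun ξ => ‖f t ξ‖ₑ) ≤ ((Y + 1 : ℝ≥0) : ℝ≥0∞) := fun t ht => bn_le_of_lintegral_V_le ht
  have hhalf : ∀ y : ℝ, y ≤ 1 / 2 → ENNReal.ofReal y ≤ ENNReal.ofReal (1 / 2) :=
    fun y hy => ENNReal.ofReal_le_ofReal hy
  have hsum : ENNReal.ofReal (1 / 2) + ENNReal.ofReal (1 / 2) = 1 := by
    rw [← ENNReal.ofReal_add (by norm_num) (by norm_num)]; norm_num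
  have main : ∀ n : ℕ, ∀ t ∈ Icc (0:ℝ) T, t ≤ n * δ →
      ∀ i, energy k i (f t) ≤ E i * (Y + ENNReal.ofReal (1 / 2)) := by
    have hzero : ∀ i, energy k i (f 0) ≤ E i * Y := by
      intro i
      refine (hC₁ i _).trans ?_
      rw [hY]
      push_cast
      calc _ ≤ (C₁:ℝ≥0∞) * (E i * R) := by gcongr
        _ = _ := by ring
    intro n
    induction n with
    | zero =>
      intro t ht htn i
      have : t = 0 := le_antisymm (by simpa using htn) ht.1
      subst this
      exact (hzero i).trans (by gcongr; exact le_self_add)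
    | succ n ih =>
      intro t ht htn
      -- The step with the weak bound `M` gives the bound `B₀ ^ 2` up to time `t`; the growth
      -- estimate on all of `[0, t]` with `B₀` then restores the sharper inductive bound.
      have hweak : ∀ r ∈ Icc (0:ℝ) t, bn s (fun ξ => ‖f r ξ‖ₑ) ≤ (B₀:ℝ≥0∞) ^ 2 := by
        intro r hr
        have hrT : r ∈ Icc (0:ℝ) T := ⟨hr.1, hr.2.trans ht.2⟩
        rw [← ENNReal.coe_pow, hB₀sq]
        refine hbn r fun i => ?_
        push_cast
        rcases le_total r (n * δ) with hrn | hrn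
        · refine (ih r hrT hrn i).trans ?_
          gcongr
          exact ENNReal.ofReal_le_one.2 (by norm_num)
        · have hn0 : (0:ℝ) ≤ n * δ := by positivity
          have g := hC α hα T f h (n * δ) r hn0 hrn hrT.2 Bm
            (fun τ hτ => by
              rw [← ENNReal.coe_pow, hBmsq]
              exact hM τ ⟨hn0.trans hτ.1, hτ.2.trans hrT.2⟩) i
          have hi := ih (n * δ) ⟨hn0, hrn.trans hrT.2⟩ le_rfl i
          have hlen : (C:ℝ) * Bm ^ 3 * (r - n * δ) ≤ 1 / 2 := by
            refine le_trans ?_ (hstep Bm)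
            gcongr
            rw [← hδ]
            push_cast at htn
            linarith [hr.2]
          calc _ ≤ _ := g
            _ ≤ E i * (Y + ENNReal.ofReal (1 / 2)) + E i * ENNReal.ofReal (1 / 2) := by
              gcongr
            _ = E i * (Y + (ENNReal.ofReal (1 / 2) + ENNReal.ofReal (1 / 2))) := by ring
            _ = _ := by rw [hsum]
      intro i
      have g := hC α hα T f h 0 t le_rfl ht.1 ht.2 B₀ hweak i
      have hlen : (C:ℝ) * B₀ ^ 3 * (t - 0) ≤ 1 / 2 := by
        refine le_trans ?_ (hstep B₀)
        gcongr
        rw [sub_zero]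
        exact ht.2.trans hT
      calc _ ≤ _ := g
        _ ≤ E i * Y + E i * ENNReal.ofReal (1 / 2) := by
          gcongr
          exact hzero i
        _ = _ := by ring
  intro t ht
  obtain ⟨n, hn⟩ := exists_nat_ge (t / δ)
  refine hbn t fun i => (main n t ht ((div_le_iff₀ hδ0).1 hn) i).trans ?_
  push_cast
  gcongr
  exact ENNReal.ofReal_le_one.2 (by norm_num)

/-- The second order expansion in time, on the Fourier side. -/
lemma exists_expansion (hs : 3 / 2 < s) (R : ℝ≥0) :
    ∃ T₀ : ℝ, 0 < T₀ ∧ ∃ C : ℝ≥0, ∀ α ∈ Icc (0:ℝ) 1, ∀ T ≤ T₀, ∀ f : ℝ → ℝ → ℂ,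
      IsFourierSolution s α T f → bn s (fun ξ => ‖f 0 ξ‖ₑ) ≤ R →
      ∀ t ∈ Icc (0:ℝ) T,
        bn (s - 2) (fun ξ => ‖f t ξ - f 0 ξ - (t : ℂ) * chForm α (f 0) (f 0) ξ‖ₑ) ≤
          C * ENNReal.ofReal (t ^ 4) := by
  obtain ⟨T₀, hT₀, N, hN⟩ := exists_apriori hs R
  obtain ⟨C₁, hC₁⟩ := exists_bn_chForm_le hs
  obtain ⟨C₂, hC₂⟩ := exists_bn_chForm_le_of_lower hs
  refine ⟨T₀, hT₀, C₂ * (C₁ * (N * N) * (4 * N)), fun α hα T hT f h hR t ht => ?_⟩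
  have hN' := hN α hα T hT f h hR
  have h0 : (0:ℝ) ∈ Icc (0:ℝ) T := ⟨le_rfl, ht.1.trans ht.2⟩
  obtain ⟨K, hK⟩ := h.exists_speed_bound hs hα
  have hfirst : ∀ τ ∈ Icc (0:ℝ) T, bn (s - 1) (fun ξ => ‖f τ ξ - f 0 ξ‖ₑ) ≤
      ((C₁ * (N * N) : ℝ≥0) : ℝ≥0∞) * ENNReal.ofReal (τ ^ 2) := by
    intro τ hτ
    have := h.bn_sub_le hs hα hτ (G := 0) (MemLp.zero) (s - 1) (c := C₁ * (N * N)) fun r hr => by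
      have hr' : r ∈ Icc (0:ℝ) T := ⟨hr.1, hr.2.trans hτ.2⟩
      simp only [Pi.zero_apply, sub_zero]
      push_cast
      refine (hC₁ α hα _ _ (h.measurable r hr') (h.measurable r hr')).trans ?_
      gcongr <;> exact hN' r hr'
    simpa using this
  have hsecond : ∀ τ ∈ Icc (0:ℝ) t,
      bn (s - 2) (fun ξ => ‖chForm α (f τ) (f τ) ξ - chForm α (f 0) (f 0) ξ‖ₑ) ≤
        ((C₂ * (C₁ * (N * N) * (4 * N)) * (t ^ 2).toNNReal : ℝ≥0) : ℝ≥0∞) := by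
    intro τ hτ
    have hτ' : τ ∈ Icc (0:ℝ) T := ⟨hτ.1, hτ.2.trans ht.2⟩
    have mτ := h.measurable τ hτ'
    have m0 := h.measurable 0 h0
    simp_rw [chForm_sub_chForm α (h.memLp hs hτ') (h.memLp hs h0) (h.memLp_dSym hs hτ')
      (h.memLp_dSym hs h0)]
    refine (hC₂ α hα _ _ (mτ.sub m0) (mτ.add m0)).trans ?_
    have hadd : bn s (fun ξ => ‖(f τ + f 0) ξ‖ₑ) ≤ 4 * N := by
      calc _ ≤ bn s (fun ξ => ‖f τ ξ‖ₑ + ‖f 0 ξ‖ₑ) :=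
            bn_mono (Filter.Eventually.of_forall fun ξ => enorm_add_le _ _)
        _ ≤ 2 * bn s (fun ξ => ‖f τ ξ‖ₑ) + 2 * bn s (fun ξ => ‖f 0 ξ‖ₑ) :=
            bn_add_le mτ.enorm _
        _ ≤ 2 * N + 2 * N := by
            gcongr
            · exact hN' τ hτ'
            · exact hN' 0 h0
        _ = _ := by ring
    calc _ ≤ (C₂:ℝ≥0∞) * (((C₁ * (N * N) : ℝ≥0) : ℝ≥0∞) * ENNReal.ofReal (t ^ 2) * (4 * N)) := by
          gcongr
          refine (hfirst τ hτ').trans ?_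
          gcongr
          · exact hτ.1
          · exact hτ.2
      _ = _ := by
          rw [ENNReal.ofReal]; push_cast; ring
  have := h.bn_sub_le hs hα ht (hK 0 h0).1 (s - 2) hsecond
  refine this.trans (le_of_eq ?_)
  rw [show t ^ 4 = t ^ 2 * t ^ 2 by ring, ENNReal.ofReal_mul (by positivity)]
  rw [ENNReal.ofReal]; push_cast; ring

end IsFourierSolution

/-! ### Distributions whose Fourier transform is a function -/

open FourierTransform

/-- The Fourier transform of the tempered distribution `u` is the function `f`. -/
def HasFT (u : 𝓢'(ℝ, ℂ)) (f : ℝ → ℂ) : Prop :=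
  ∀ ψ : 𝓢(ℝ, ℂ), Integrable (fun ξ => ψ ξ * f ξ) ∧ u (𝓕 ψ) = ∫ ξ, ψ ξ * f ξ

namespace HasFT

variable {u w : 𝓢'(ℝ, ℂ)} {f g : ℝ → ℂ}

lemma congr (h : HasFT u f) (hfg : ∀ ξ, f ξ = g ξ) : HasFT u g := by
  rwa [← show f = g from funext hfg]

lemma congr_ae (h : HasFT u f) (hfg : f =ᵐ[volume] g) : HasFT u g := fun ψ => by
  have he : (fun ξ => ψ ξ * f ξ) =ᵐ[volume] fun ξ => ψ ξ * g ξ := by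
    filter_upwards [hfg] with ξ hξ
    rw [hξ]
  exact ⟨(h ψ).1.congr he, (h ψ).2.trans (integral_congr_ae he)⟩

lemma add (hf : HasFT u f) (hg : HasFT w g) : HasFT (u + w) (fun ξ => f ξ + g ξ) := fun ψ => by
  simp only [mul_add]
  refine ⟨(hf ψ).1.add (hg ψ).1, ?_⟩
  rw [integral_add (hf ψ).1 (hg ψ).1, ← (hf ψ).2, ← (hg ψ).2]; rfl

lemma neg (hf : HasFT u f) : HasFT (-u) (fun ξ => -f ξ) := fun ψ => by
  simp only [mul_neg]
  refine ⟨(hf ψ).1.neg, ?_⟩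
  rw [integral_neg, ← (hf ψ).2]; rfl

lemma sub (hf : HasFT u f) (hg : HasFT w g) : HasFT (u - w) (fun ξ => f ξ - g ξ) := by
  simpa only [sub_eq_add_neg] using hf.add hg.neg

lemma smul (c : ℂ) (hf : HasFT u f) : HasFT (c • u) (fun ξ => c * f ξ) := fun ψ => by
  simp only [mul_left_comm _ c]
  refine ⟨(hf ψ).1.const_mul c, ?_⟩
  rw [integral_const_mul, ← (hf ψ).2]; rfl

/-- Multiplying a test function by a symbol of temperate growth. -/
lemma smulLeft (hf : HasFT u f) {m : ℝ → ℂ} (hm : m.HasTemperateGrowth) (ψ : 𝓢(ℝ, ℂ)) :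
    Integrable (fun ξ => ψ ξ * (m ξ * f ξ)) ∧
      u (𝓕 (SchwartzMap.smulLeftCLM ℂ m ψ)) = ∫ ξ, ψ ξ * (m ξ * f ξ) := by
  have h := hf (SchwartzMap.smulLeftCLM ℂ m ψ)
  simp only [SchwartzMap.smulLeftCLM_apply_apply hm, smul_eq_mul] at h
  have e : ∀ ξ, m ξ * ψ ξ * f ξ = ψ ξ * (m ξ * f ξ) := fun ξ => by ring
  simpa only [e] using h

lemma multiplierD (hf : HasFT u f) {m : ℝ → ℝ}
    (hm : (fun η : ℝ => ((m (2 * Real.pi * η) : ℝ) : ℂ)).HasTemperateGrowth) :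
    HasFT (multiplierD m u) (fun ξ => (m (2 * Real.pi * ξ) : ℂ) * f ξ) := fun ψ => by
  have h := hf.smulLeft hm ψ
  refine ⟨h.1, ?_⟩
  rw [← h.2, _root_.multiplierD, TemperedDistribution.fourierMultiplierCLM_apply_apply,
    fourierInv_fourier_eq]

lemma dx (hf : HasFT u f) : HasFT (dx u) (dSym f) := fun ψ => by
  have hm : (fun ξ : ℝ => Complex.I * ((2 * Real.pi * ξ : ℝ) : ℂ)).HasTemperateGrowth := by
    push_cast
    fun_prop
  have h := hf.smulLeft hm ψ
  refine ⟨h.1, ?_⟩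
  unfold dSym
  rw [← h.2, _root_.dx, TemperedDistribution.derivCLM_apply_apply]
  congr 1
  have e1 : SchwartzMap.derivCLM ℂ ℂ (𝓕 ψ) = LineDeriv.lineDerivOp (1:ℝ) (𝓕 ψ) := by
    ext x
    simp [SchwartzMap.lineDerivOp_apply_eq_fderiv]
  rw [e1, SchwartzMap.lineDerivOp_fourier_eq, ← FourierTransform.fourier_neg]
  congr 1
  ext ξ
  have hi : (fun x : ℝ => x).HasTemperateGrowth := by fun_prop
  rw [SchwartzMap.smulLeftCLM_apply_apply hm]
  simp [SchwartzMap.smulLeftCLM_apply_apply hi]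
  ring

end HasFT

/-- Every square-integrable function is a Fourier transform. -/
lemma hasFT_fourierInv {f : ℝ → ℂ} (hf : MemLp f 2) :
    HasFT ((𝓕⁻ (hf.toLp f) : Lp ℂ 2 (volume : Measure ℝ)) : 𝓢'(ℝ, ℂ)) f := fun ψ => by
  refine ⟨(ψ.memLp 2 volume).integrable_mul hf, ?_⟩
  rw [← Lp.fourierInv_toTemperedDistribution_eq, TemperedDistribution.fourierInv_apply,
    fourierInv_fourier_eq, Lp.toTemperedDistribution_apply]
  refine integral_congr_ae ?_
  filter_upwards [hf.coeFn_toLp] with ξ hξ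
  rw [hξ, smul_eq_mul]

lemma hasFT_coe (g : Lp ℂ 2 (volume : Measure ℝ)) :
    HasFT (g : 𝓢'(ℝ, ℂ)) (𝓕 g : Lp ℂ 2 (volume : Measure ℝ)) := by
  have h := hasFT_fourierInv (Lp.memLp (𝓕 g : Lp ℂ 2 (volume : Measure ℝ)))
  rwa [Lp.toLp_coeFn, fourierInv_fourier_eq] at h

/-- A tempered distribution is determined by its Fourier transform. -/
lemma HasFT.dist_unique {u w : 𝓢'(ℝ, ℂ)} {f : ℝ → ℂ} (hu : HasFT u f) (hw : HasFT w f) : u = w := by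
  ext ψ
  have h1 := (hu (𝓕⁻ ψ)).2
  have h2 := (hw (𝓕⁻ ψ)).2
  rw [fourier_fourierInv_eq] at h1 h2
  rw [h1, h2]

lemma HasFT.eq_coe {u : 𝓢'(ℝ, ℂ)} {f : ℝ → ℂ} (hu : HasFT u f) (hf : MemLp f 2) :
    ((𝓕⁻ (hf.toLp f) : Lp ℂ 2 (volume : Measure ℝ)) : 𝓢'(ℝ, ℂ)) = u :=
  (hasFT_fourierInv hf).dist_unique hu

/-- Functions with the same integrals against Schwartz functions agree almost everywhere. -/
lemma ae_eq_of_integral_schwartz {f g : ℝ → ℂ} (hf : LocallyIntegrable f) (hg : LocallyIntegrable g)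
    (h : ∀ ψ : 𝓢(ℝ, ℂ), ∫ ξ, ψ ξ * f ξ = ∫ ξ, ψ ξ * g ξ) : f =ᵐ[volume] g := by
  refine ae_eq_of_integral_contDiff_smul_eq hf hg fun φ hφ hc => ?_
  have hg₁ : HasCompactSupport (Complex.ofRealCLM ∘ φ) := hc.comp_left rfl
  have hg₂ : ContDiff ℝ ∞ (Complex.ofRealCLM ∘ φ) := by fun_prop
  simpa using h (hg₁.toSchwartzMap hg₂)

lemma HasFT.ae_eq {u : 𝓢'(ℝ, ℂ)} {f g : ℝ → ℂ} (hf : HasFT u f) (hg : HasFT u g)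
    (hfl : LocallyIntegrable f) (hgl : LocallyIntegrable g) : f =ᵐ[volume] g :=
  ae_eq_of_integral_schwartz hfl hgl fun ψ => by rw [← (hf ψ).2, ← (hg ψ).2]

lemma HasFT.l2Norm_le {u : 𝓢'(ℝ, ℂ)} {f : ℝ → ℂ} (hu : HasFT u f) (hf : MemLp f 2) :
    l2Norm u ^ 2 ≤ ∫⁻ ξ, ‖f ξ‖ₑ ^ 2 := by
  rw [← enorm_toLp_sq hf]
  have h : l2Norm u ≤ ‖(𝓕⁻ (hf.toLp f) : Lp ℂ 2 (volume : Measure ℝ))‖ₑ :=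
    iInf₂_le (f := fun (g : Lp ℂ 2 (volume : Measure ℝ)) (_ : (g : 𝓢'(ℝ, ℂ)) = u) => ‖g‖ₑ)
      _ (hu.eq_coe hf)
  refine pow_le_pow_left' (h.trans (le_of_eq ?_)) 2
  rw [← ofReal_norm, ← ofReal_norm, ← Lp.norm_fourier_eq, fourier_fourierInv_eq]

/-- Plancherel: a distribution of small `L²` norm has a Fourier transform of small `L²` norm. -/
lemma exists_hasFT_of_l2Norm_lt {u : 𝓢'(ℝ, ℂ)} {c : ℝ≥0∞} (h : l2Norm u < c) :
    ∃ F : Lp ℂ 2 (volume : Measure ℝ), HasFT u F ∧ ‖F‖ₑ < c := by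
  unfold l2Norm at h
  simp only [iInf_lt_iff] at h
  obtain ⟨g, hg, hlt⟩ := h
  refine ⟨𝓕 g, hg ▸ hasFT_coe g, ?_⟩
  rwa [← ofReal_norm, Lp.norm_fourier_eq, ofReal_norm]

/-- The inverse Fourier transform is symmetric with respect to the bilinear pairing. -/
lemma integral_fourierInv_mul {a b : ℝ → ℂ} (ha : Integrable a) (hb : Integrable b) :
    ∫ x, 𝓕⁻ a x * b x = ∫ x, a x * 𝓕⁻ b x := by
  have key := VectorFourier.integral_bilin_fourierIntegral_eq_flip (ContinuousLinearMap.mul ℂ ℂ)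
    (L := innerₗ ℝ) (μ := volume) (ν := volume) (f := a) (g := fun x => b (-x))
    Real.continuous_fourierChar (by exact continuous_inner) ha hb.comp_neg
  rw [flip_innerₗ] at key
  calc _ = ∫ x, 𝓕 a (-x) * b x := by simp_rw [Real.fourierInv_eq_fourier_neg]
    _ = ∫ x, 𝓕 a x * b (-x) := by
      rw [← integral_neg_eq_self]
      simp only [neg_neg]
    _ = ∫ x, a x * 𝓕 (fun y => b (-y)) x := key
    _ = _ := by simp_rw [Real.fourierInv_eq_fourier_comp_neg]

lemma continuous_fourierInv {f : ℝ → ℂ} (hf : Integrable f) : Continuous (𝓕⁻ f) := by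
  rw [show (𝓕⁻ f) = fun x => 𝓕 f (-x) from funext fun x => Real.fourierInv_eq_fourier_neg f x]
  exact (VectorFourier.fourierIntegral_continuous Real.continuous_fourierChar
    (by exact continuous_inner) hf).comp continuous_neg

/-- The square-integrable representative of a distribution is the inverse Fourier transform of its
Fourier transform. -/
lemma HasFT.l2Rep_ae_eq {u : 𝓢'(ℝ, ℂ)} {f : ℝ → ℂ} (hu : HasFT u f) (hf : MemLp f 2)
    (hfi : Integrable f) : l2Rep u =ᵐ[volume] 𝓕⁻ f := by
  have hex : ∃ g : Lp ℂ 2 (volume : Measure ℝ), (g : 𝓢'(ℝ, ℂ)) = u := ⟨_, hu.eq_coe hf⟩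
  have hrep : (l2Rep u : 𝓢'(ℝ, ℂ)) = u := by
    unfold l2Rep
    rw [dif_pos hex]
    exact hex.choose_spec
  refine ae_eq_of_integral_schwartz ((Lp.memLp _).locallyIntegrable (by norm_num))
    (continuous_fourierInv hfi).locallyIntegrable fun ψ => ?_
  have h1 := (hu (𝓕⁻ ψ)).2
  rw [fourier_fourierInv_eq, ← hrep, Lp.toTemperedDistribution_apply] at h1
  simp only [smul_eq_mul] at h1
  rw [h1]
  rw [SchwartzMap.fourierInv_coe]
  exact integral_fourierInv_mul ψ.integrable hfi

/-- The Fourier transform turns products into convolutions. -/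
lemma HasFT.l2Mul {u w : 𝓢'(ℝ, ℂ)} {f g : ℝ → ℂ} (hu : HasFT u f) (hw : HasFT w g)
    (hf : MemLp f 2) (hg : MemLp g 2) (hfi : Integrable f) (hgi : Integrable g) :
    HasFT (l2Mul u w) (conv f g) := fun ψ => by
  have hci : Integrable (conv f g) := hfi.integrable_convolution (ContinuousLinearMap.mul ℂ ℂ) hgi
  have hmul : ∀ x, 𝓕⁻ (conv f g) x = 𝓕⁻ f x * 𝓕⁻ g x := fun x => by
    simp_rw [Real.fourierInv_eq_fourier_neg]
    exact Real.fourier_mul_convolution_eq hfi hgi (-x)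
  refine ⟨hci.bdd_mul (c := SchwartzMap.seminorm ℝ 0 0 ψ) ψ.continuous.aestronglyMeasurable
    (Filter.Eventually.of_forall fun ξ => SchwartzMap.norm_le_seminorm ℝ ψ ξ), ?_⟩
  rw [_root_.l2Mul, Lp.toTemperedDistribution_apply]
  calc _ = ∫ x, 𝓕 ψ x * 𝓕⁻ (conv f g) x := by
        refine integral_congr_ae ?_
        filter_upwards [Lp.coeFn_lpSMul (r := 1) (l2Rep u) (l2Rep w), hu.l2Rep_ae_eq hf hfi,
          hw.l2Rep_ae_eq hg hgi] with x h1 h2 h3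
        rw [h1, Pi.smul_apply', h2, h3, hmul, smul_eq_mul, smul_eq_mul]
    _ = ∫ x, (𝓕⁻ (𝓕 ψ)) x * conv f g x := by
        rw [SchwartzMap.fourierInv_coe]
        exact (integral_fourierInv_mul (𝓕 ψ).integrable hci).symm
    _ = _ := by rw [fourierInv_fourier_eq]

/-! ### The Camassa-Holm equation for distributions -/

lemma hasTemperateGrowth_helmholtz (α : ℝ) : (fun η : ℝ =>
    (((fun ξ : ℝ => (1 + α ^ 2 * ξ ^ 2)⁻¹) (2 * Real.pi * η) : ℝ) : ℂ)).HasTemperateGrowth := by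
  have h1 : (fun η : ℝ => α * (2 * Real.pi) * η).HasTemperateGrowth := by fun_prop
  have h2 := Complex.ofRealCLM.hasTemperateGrowth.comp
    ((Function.hasTemperateGrowth_one_add_norm_sq_rpow ℝ (-1)).comp h1)
  convert h2 using 1
  ext η
  simp only [Function.comp_apply, Real.rpow_neg_one, Real.norm_eq_abs, sq_abs]
  congr 3
  ring

lemma HasFT.helmholtzInv {u : 𝓢'(ℝ, ℂ)} {f : ℝ → ℂ} (hu : HasFT u f) (α : ℝ) :
    HasFT (helmholtzInv α u) (fun ξ => (hSym α ξ : ℂ) * f ξ) :=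
  hu.multiplierD (hasTemperateGrowth_helmholtz α)

lemma HasFT.camassaHolmRHS {u : 𝓢'(ℝ, ℂ)} {f : ℝ → ℂ} (hu : HasFT u f) (hf : MemLp f 2)
    (hf' : MemLp (dSym f) 2) (hfi : Integrable f) (hfi' : Integrable (dSym f)) (α : ℝ) :
    HasFT (camassaHolmRHS α u) (chForm α f f) := by
  have h := (hu.l2Mul hu.dx hf hf' hfi hfi').neg.sub
    (((hu.l2Mul hu hf hf hfi hfi).add
      ((hu.dx.l2Mul hu.dx hf' hf' hfi' hfi').smul ((α : ℂ) ^ 2 / 2))).helmholtzInv α).dx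
  refine h.congr fun ξ => ?_
  have hd := dSym_conv hf hf' ξ
  rw [conv_comm (dSym f) f] at hd
  simp only [chForm]
  rw [show conv f (dSym f) ξ = Complex.I * ((2 * Real.pi * ξ : ℝ) : ℂ) * conv f f ξ / 2 by
    rw [hd]; ring]
  simp only [dSym]
  push_cast
  ring

/-- `E₀` has the same Fourier transform as the right-hand side of the equation. -/
lemma HasFT.camassaHolmE {u : 𝓢'(ℝ, ℂ)} {f : ℝ → ℂ} (hu : HasFT u f) (hf : MemLp f 2)
    (hf' : MemLp (dSym f) 2) (hfi : Integrable f) (hfi' : Integrable (dSym f)) (α : ℝ) :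
    HasFT (camassaHolmE α u) (chForm α f f) := by
  have h := (((hu.l2Mul hu.dx hf hf' hfi hfi').smul 3).neg.sub
    (((hu.l2Mul hu hf hf hfi hfi).helmholtzInv α).dx.dx.dx.smul ((α : ℂ) ^ 2))).sub
      (((hu.dx.l2Mul hu.dx hf' hf' hfi' hfi').helmholtzInv α).dx.smul ((α : ℂ) ^ 2 / 2))
  refine h.congr fun ξ => ?_
  have hd := dSym_conv hf hf' ξ
  rw [conv_comm (dSym f) f] at hd
  have hh : (hSym α ξ : ℂ) * (1 + (α : ℂ) ^ 2 * (2 * Real.pi * ξ) ^ 2) = 1 := by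
    exact_mod_cast congrArg (fun x : ℝ => (x : ℂ)) (hSym_mul α ξ)
  simp only [chForm]
  rw [show conv f (dSym f) ξ = Complex.I * ((2 * Real.pi * ξ : ℝ) : ℂ) * conv f f ξ / 2 by
    rw [hd]; ring]
  simp only [dSym]
  push_cast
  have hI : Complex.I ^ 2 = -1 := Complex.I_sq
  -- `∂ₓ³` contributes `-iξ³`, and `α²ξ²/(1 + α²ξ²) = 1 - 1/(1 + α²ξ²)`.
  linear_combination (-(α:ℂ) ^ 2 * (2 * Real.pi * ξ) ^ 3 * Complex.I * hSym α ξ * conv f f ξ) * hI +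
    (Complex.I * (2 * Real.pi * ξ) * conv f f ξ) * hh

/-! ### Real-valued distributions -/

lemma IsRealDistribution.apply_conj {u : 𝓢'(ℝ, ℂ)} (hu : IsRealDistribution u) (ψ : 𝓢(ℝ, ℂ)) :
    u (conjSchwartz ψ) = starRingEnd ℂ (u ψ) := by
  have ha : (u (ψ + conjSchwartz ψ)).im = 0 := hu _ fun x => by simp
  have hb : (u (Complex.I • (ψ - conjSchwartz ψ))).im = 0 := hu _ fun x => by simp
  rw [map_add, Complex.add_im] at ha
  rw [map_smul, map_sub, smul_eq_mul] at hb
  simp at hb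
  apply Complex.ext
  · rw [Complex.conj_re]; linarith
  · rw [Complex.conj_im]; linarith

lemma conjSchwartz_fourier (ψ : 𝓢(ℝ, ℂ)) : conjSchwartz (𝓕 ψ) = 𝓕⁻ (conjSchwartz ψ) := by
  ext x
  rw [conjSchwartz_apply, SchwartzMap.fourierInv_coe, SchwartzMap.fourier_coe, Real.fourier_eq',
    Real.fourierInv_eq', ← integral_conj]
  congr 1; ext v
  simp only [smul_eq_mul, map_mul, conjSchwartz_apply, ← Complex.exp_conj]
  simp [map_ofNat]

/-- The Fourier transform of a real-valued distribution is Hermitian. -/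
lemma HasFT.ae_symm {u : 𝓢'(ℝ, ℂ)} {f : ℝ → ℂ} (hu : IsRealDistribution u) (h : HasFT u f)
    (hf : MemLp f 2) :
    (fun ξ => f (-ξ)) =ᵐ[volume] fun ξ => starRingEnd ℂ (f ξ) := by
  have hneg : MemLp (fun ξ => f (-ξ)) 2 :=
    hf.comp_measurePreserving (Measure.measurePreserving_neg volume)
  have hstar : MemLp (fun ξ => starRingEnd ℂ (f ξ)) 2 := hf.star
  refine ae_eq_of_integral_schwartz (hneg.locallyIntegrable (by norm_num))
    (hstar.locallyIntegrable (by norm_num)) fun ψ => ?_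
  have h1 := hu.apply_conj (𝓕 (conjSchwartz ψ))
  have hcc : conjSchwartz (conjSchwartz ψ) = ψ := by ext x; simp
  have hFF : 𝓕 (𝓕⁻ (𝓕⁻ ψ)) = 𝓕⁻ ψ := fourier_fourierInv_eq _
  have hinv : ∀ ξ, (𝓕⁻ (𝓕⁻ ψ)) ξ = ψ (-ξ) := fun ξ => by
    have h3 : 𝓕 (𝓕⁻ ψ) = ψ := fourier_fourierInv_eq _
    rw [SchwartzMap.fourierInv_coe, Real.fourierInv_eq_fourier_neg, ← SchwartzMap.fourier_coe, h3]
  rw [conjSchwartz_fourier, hcc, ← hFF, (h _).2, (h _).2, ← integral_conj] at h1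
  simp only [hinv, map_mul, conjSchwartz_apply, Complex.conj_conj] at h1
  rw [← h1, ← integral_neg_eq_self]
  simp only [neg_neg]

/-- A real-valued distribution has a Hermitian Fourier transform at every point, for a suitable
choice of the representative. -/
lemma HasFT.exists_symm {u : 𝓢'(ℝ, ℂ)} {f : ℝ → ℂ} (hu : IsRealDistribution u) (h : HasFT u f)
    (hm : Measurable f) (hf : MemLp f 2) :
    ∃ g : ℝ → ℂ, Measurable g ∧ f =ᵐ[volume] g ∧ ∀ ξ, g (-ξ) = starRingEnd ℂ (g ξ) := by
  have hs := h.ae_symm hu hf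
  refine ⟨fun ξ => (f ξ + starRingEnd ℂ (f (-ξ))) / 2, ?_, ?_, fun ξ => ?_⟩
  · have : Measurable (starRingEnd ℂ) := Complex.continuous_conj.measurable
    exact (hm.add (this.comp (hm.comp measurable_neg))).div_const 2
  · filter_upwards [hs] with ξ hξ
    rw [hξ, Complex.conj_conj]; ring
  · simp [add_comm, map_ofNat]

/-! ### The Littlewood-Paley symbols -/

/-- The symbols of the dyadic blocks in the angular frequency: `χ`, and `φ(2^{-m} ·)` with
index `m + 1`. -/
noncomputable def lpSymbol (χ φ : ℝ → ℝ) : ℕ → ℝ → ℝ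
  | 0 => χ
  | m + 1 => fun ξ => φ ((2 : ℝ) ^ (-(m : ℤ)) * ξ)

lemma dyadicBlock_natCast_sub_one (χ φ : ℝ → ℝ) (m : ℕ) (u : 𝓢'(ℝ, ℂ)) :
    dyadicBlock χ φ ((m : ℤ) - 1) u = multiplierD (lpSymbol χ φ m) u := by
  unfold dyadicBlock
  rw [if_neg (by omega)]
  cases m with
  | zero => simp [lpSymbol]
  | succ m =>
    rw [if_neg (by push_cast; omega)]
    simp [lpSymbol]

namespace IsLittlewoodPaleyPair

variable {χ φ : ℝ → ℝ}

lemma contDiff_lpSymbol (h : IsLittlewoodPaleyPair χ φ) (m : ℕ) : ContDiff ℝ ∞ (lpSymbol χ φ m) := by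
  cases m with
  | zero => exact h.contDiff_low
  | succ m => exact h.contDiff_high.comp (contDiff_const.mul contDiff_id)

lemma lpSymbol_mem (h : IsLittlewoodPaleyPair χ φ) (m : ℕ) (ξ : ℝ) : lpSymbol χ φ m ξ ∈ Icc (0:ℝ) 1 := by
  cases m with
  | zero => exact h.range_low ξ
  | succ m => exact h.range_high _

lemma lpSymbol_support (h : IsLittlewoodPaleyPair χ φ) (m : ℕ) {η : ℝ}
    (hη : lpSymbol χ φ m (2 * Real.pi * η) ≠ 0) : 2 ^ m ≤ 4 * br η ∧ br η < 2 ^ (m + 2) := by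
  have hb : br η = 1 + |2 * Real.pi * η| := by
    rw [abs_mul, abs_of_pos (by positivity : 0 < 2 * Real.pi)]; rfl
  rw [hb]
  cases m with
  | zero =>
    have := h.support_low _ hη
    have h0 := abs_nonneg (2 * Real.pi * η)
    constructor
    · rw [pow_zero]; linarith
    · rw [zero_add]; linarith
  | succ m =>
    have := h.support_high _ hη
    have h2 : (1:ℝ) ≤ 2 ^ m := one_le_pow₀ (by norm_num)
    rw [abs_mul, zpow_neg, zpow_natCast, abs_of_pos (by positivity : (0:ℝ) < (2 ^ m)⁻¹),
      inv_mul_eq_div, le_div_iff₀ (by positivity), div_le_iff₀ (by positivity)] at this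
    rw [pow_succ, show m + 1 + 2 = m + 3 by ring, pow_add]
    constructor <;> linarith

/-- The dyadic block with index `m` meets the shell with index `l` only for neighbouring indices. -/
lemma lpSymbol_shell (h : IsLittlewoodPaleyPair χ φ) {m l : ℕ} {η : ℝ} (hl : η ∈ shell l)
    (hη : lpSymbol χ φ m (2 * Real.pi * η) ≠ 0) : m ≤ l + 2 ∧ l ≤ m + 1 := by
  obtain ⟨h1, h2⟩ := h.lpSymbol_support m hη
  constructor
  · have : (2:ℝ) ^ m < 2 ^ (l + 3) := by
      have := hl.2
      calc (2:ℝ) ^ m ≤ 4 * br η := h1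
        _ < 4 * 2 ^ (l + 1) := by linarith
        _ = _ := by ring
    have := (pow_lt_pow_iff_right₀ (by norm_num : (1:ℝ) < 2)).1 this
    omega
  · have := (pow_lt_pow_iff_right₀ (by norm_num : (1:ℝ) < 2)).1 (hl.1.trans_lt h2)
    omega

/-- On a shell the lower bound for the sum of squares involves only four symbols. -/
lemma half_le_sum (h : IsLittlewoodPaleyPair χ φ) {l : ℕ} {η : ℝ} (hl : η ∈ shell l) :
    1 / 2 ≤ ∑ m ∈ Finset.Icc (l - 1) (l + 2), lpSymbol χ φ m (2 * Real.pi * η) ^ 2 := by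
  have hzero : ∀ m : ℕ, ¬(m ≤ l + 2 ∧ l ≤ m + 1) → lpSymbol χ φ m (2 * Real.pi * η) ^ 2 = 0 :=
    fun m hm => by
      by_contra hne
      exact hm (h.lpSymbol_shell hl fun h0 => hne (by rw [h0]; norm_num))
  have h1 := h.half_le_sum_sq (2 * Real.pi * η)
  have htail : ∀ j ∉ Finset.range (l + 2), φ ((2 : ℝ) ^ (-(j : ℤ)) * (2 * Real.pi * η)) ^ 2 = 0 :=
    fun j hj => hzero (j + 1) (by simp only [Finset.mem_range] at hj; omega)
  rw [tsum_eq_sum htail] at h1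
  rw [Finset.sum_subset (s₂ := Finset.range (l + 3)) (fun m hm => by
    simp only [Finset.mem_Icc, Finset.mem_range] at hm ⊢; omega) fun m _ hm => hzero m (by
    simp only [Finset.mem_Icc] at hm; omega), Finset.sum_range_succ']
  simp only [lpSymbol]
  linarith

/-- The first symbols add up to a dilation of the low frequency cut-off. -/
lemma sum_lpSymbol (h : IsLittlewoodPaleyPair χ φ) (J : ℕ) (ξ : ℝ) :
    ∑ m ∈ Finset.range (J + 1), lpSymbol χ φ m ξ = χ ((2:ℝ) ^ (-(J : ℤ)) * ξ) := by
  have h1 := (hasSum_nat_add_iff' J).2 (h.sum_eq_one ξ)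
  have h2 := h.sum_eq_one ((2:ℝ) ^ (-(J : ℤ)) * ξ)
  have e : ∀ j : ℕ, (2:ℝ) ^ (-((j + J : ℕ) : ℤ)) * ξ =
      (2:ℝ) ^ (-(j : ℤ)) * ((2:ℝ) ^ (-(J : ℤ)) * ξ) := fun j => by
    rw [← mul_assoc, ← zpow_add₀ (by norm_num)]
    congr 2; push_cast; ring
  simp only [e] at h1
  have := h1.unique h2
  rw [Finset.sum_range_succ']
  simp only [lpSymbol]
  linarith

lemma low_eq_one (h : IsLittlewoodPaleyPair χ φ) {ξ : ℝ} (hξ : |ξ| < 3 / 4) : χ ξ = 1 := by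
  have h0 : ∀ j : ℕ, φ ((2:ℝ) ^ (-(j : ℤ)) * ξ) = 0 := fun j => by
    by_contra hne
    have := (h.support_high _ hne).1
    rw [abs_mul, abs_of_pos (by positivity), zpow_neg, zpow_natCast] at this
    have h2 : ((2:ℝ) ^ j)⁻¹ ≤ 1 := inv_le_one_of_one_le₀ (one_le_pow₀ (by norm_num))
    nlinarith [abs_nonneg ξ]
  have := h.sum_eq_one ξ
  simp only [h0] at this
  linarith [this.unique hasSum_zero]

lemma hasCompactSupport_lpSymbol (h : IsLittlewoodPaleyPair χ φ) (m : ℕ) :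
    HasCompactSupport fun η => ((lpSymbol χ φ m (2 * Real.pi * η) : ℝ) : ℂ) := by
  refine HasCompactSupport.of_support_subset_isCompact (isCompact_Icc (a := -(2:ℝ) ^ (m + 2))
    (b := 2 ^ (m + 2))) fun η hη => ?_
  have hne : lpSymbol χ φ m (2 * Real.pi * η) ≠ 0 := by
    simpa using hη
  have := (h.lpSymbol_support m hne).2
  have h2 := one_add_norm_le_br η
  rw [Real.norm_eq_abs] at h2
  exact abs_le.1 (by linarith)

lemma contDiff_ofReal_lpSymbol (h : IsLittlewoodPaleyPair χ φ) (m : ℕ) :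
    ContDiff ℝ ∞ fun η => ((lpSymbol χ φ m (2 * Real.pi * η) : ℝ) : ℂ) :=
  Complex.ofRealCLM.contDiff.comp ((h.contDiff_lpSymbol m).comp (contDiff_const.mul contDiff_id))

lemma hasTemperateGrowth_lpSymbol (h : IsLittlewoodPaleyPair χ φ) (m : ℕ) :
    (fun η => ((lpSymbol χ φ m (2 * Real.pi * η) : ℝ) : ℂ)).HasTemperateGrowth :=
  (h.hasCompactSupport_lpSymbol m).hasTemperateGrowth (h.contDiff_ofReal_lpSymbol m)

end IsLittlewoodPaleyPair

/-! ### Besov norms on both sides of the Fourier transform -/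

/-- A dilated cut-off, minus one, times a Schwartz function is small in every Schwartz seminorm:
off a large ball one power of `|x|` pays for the smallness. -/
lemma exists_cutoff_bound {θ : ℝ → ℂ} (hθ : ContDiff ℝ ∞ θ) {r : ℝ} (hr : 0 < r)
    (h0 : ∀ x, |x| < r → θ x = 0) (hb : ∀ i, ∃ M : ℝ, ∀ x, ‖iteratedDeriv i θ x‖ ≤ M)
    (ψ : 𝓢(ℝ, ℂ)) (k n : ℕ) :
    ∃ C : ℝ, 0 ≤ C ∧ ∀ c ∈ Icc (0:ℝ) 1, ∀ x,
      ‖x‖ ^ k * ‖iteratedFDeriv ℝ n (fun x => θ (c * x) * ψ x) x‖ ≤ C * c := by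
  choose M hM using hb
  have hM0 : ∀ i, 0 ≤ M i := fun i => (norm_nonneg _).trans (hM i 0)
  have hθi : ∀ i x, ‖iteratedDeriv i θ x‖ ≤ M i * (|x| / r) := fun i x => by
    rcases lt_or_ge |x| r with hx | hx
    · have hev : θ =ᶠ[nhds x] fun _ => 0 := by
        filter_upwards [(isOpen_lt continuous_abs continuous_const).mem_nhds hx] with y hy
        exact h0 y hy
      rw [(hev.iteratedDeriv_eq i), iteratedDeriv_const]
      have := hM0 i
      split_ifs <;> rw [norm_zero] <;> positivity
    · refine (hM i x).trans (le_mul_of_one_le_right (hM0 i) ?_)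
      rwa [one_le_div hr]
  refine ⟨∑ i ∈ Finset.range (n + 1), (n.choose i : ℝ) * (M i / r) *
    SchwartzMap.seminorm ℝ (k + 1) (n - i) ψ, ?_, fun c hc x => ?_⟩
  · exact Finset.sum_nonneg fun i _ => by
      have := hM0 i
      have := apply_nonneg (SchwartzMap.seminorm ℝ (k + 1) (n - i)) ψ
      positivity
  · have hθc : ContDiff ℝ ∞ fun x => θ (c * x) := hθ.comp (contDiff_const.mul contDiff_id)
    have hle := norm_iteratedFDeriv_mul_le (n := n) hθc (ψ.smooth ⊤) x (by exact_mod_cast le_top)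
    calc _ ≤ ‖x‖ ^ k * _ := mul_le_mul_of_nonneg_left hle (by positivity)
      _ ≤ _ := by
        rw [Finset.mul_sum, Finset.sum_mul]
        refine Finset.sum_le_sum fun i _ => ?_
        have h1 : ‖iteratedFDeriv ℝ i (fun x => θ (c * x)) x‖ ≤ M i * (c * |x| / r) := by
          have hi : ContDiff ℝ i θ := hθ.of_le (by exact_mod_cast le_top)
          have hd : iteratedDeriv i (fun x => θ (c * x)) x = c ^ i • iteratedDeriv i θ (c * x) :=
            congrFun (iteratedDeriv_comp_const_smul hi c) x
          rw [norm_iteratedFDeriv_eq_norm_iteratedDeriv, hd, norm_smul, norm_pow, Real.norm_of_nonneg hc.1]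
          refine (mul_le_of_le_one_left (norm_nonneg _) (pow_le_one₀ hc.1 hc.2)).trans
            ((hθi i _).trans ?_)
          rw [abs_mul, abs_of_nonneg hc.1]
        have h2 := SchwartzMap.le_seminorm ℝ (k + 1) (n - i) ψ x
        rw [Real.norm_eq_abs] at h2 ⊢
        have h3 := hM0 i
        have h4 := hc.1
        calc _ ≤ |x| ^ k * ((n.choose i : ℝ) * (M i * (c * |x| / r)) *
              ‖iteratedFDeriv ℝ (n - i) ψ x‖) := by gcongr
          _ = (n.choose i : ℝ) * (M i / r) * (|x| ^ (k + 1) * ‖iteratedFDeriv ℝ (n - i) ψ x‖) * c := by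
            ring
          _ ≤ _ := by gcongr

namespace IsLittlewoodPaleyPair

variable {χ φ : ℝ → ℝ}

/-- The Littlewood-Paley decomposition of a test function converges in the Schwartz space. -/
lemma tendsto_sum_smulLeft (h : IsLittlewoodPaleyPair χ φ) (ψ : 𝓢(ℝ, ℂ)) :
    Filter.Tendsto (fun J : ℕ => ∑ m ∈ Finset.range (J + 1), SchwartzMap.smulLeftCLM ℂ
      (fun η => ((lpSymbol χ φ m (2 * Real.pi * η) : ℝ) : ℂ)) ψ) Filter.atTop (nhds ψ) := by
  set θ : ℝ → ℂ := fun η => ((lpSymbol χ φ 0 (2 * Real.pi * η) : ℝ) : ℂ) - 1 with hθdef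
  have hχ := h.contDiff_ofReal_lpSymbol 0
  have hθ : ContDiff ℝ ∞ θ := hχ.sub contDiff_const
  have hb : ∀ i, ∃ M : ℝ, ∀ x, ‖iteratedDeriv i θ x‖ ≤ M := fun i => by
    set X : 𝓢(ℝ, ℂ) := (h.hasCompactSupport_lpSymbol 0).toSchwartzMap hχ
    refine ⟨SchwartzMap.seminorm ℝ 0 i X + 1, fun x => ?_⟩
    have e : iteratedDeriv i θ x = iteratedDeriv i X x - iteratedDeriv i (fun _ => (1:ℂ)) x :=
      iteratedDeriv_fun_sub (hχ.of_le (by exact_mod_cast le_top)).contDiffAt contDiffAt_const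
    rw [e]
    refine (norm_sub_le _ _).trans (add_le_add ?_ ?_)
    · rw [← norm_iteratedFDeriv_eq_norm_iteratedDeriv]
      exact SchwartzMap.norm_iteratedFDeriv_le_seminorm ℝ X i x
    · rw [iteratedDeriv_const]
      split_ifs <;> simp
  have h0 : ∀ x, |x| < 3 / (8 * Real.pi) → θ x = 0 := fun x hx => by
    have : |2 * Real.pi * x| < 3 / 4 := by
      rw [abs_mul, abs_of_pos (by positivity : 0 < 2 * Real.pi)]
      rw [lt_div_iff₀ (by positivity)] at hx
      linarith
    simp [hθdef, lpSymbol, h.low_eq_one this]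
  rw [(schwartz_withSeminorms ℝ ℝ ℂ).tendsto_nhds]
  rintro ⟨k, n⟩ ε hε
  obtain ⟨C, hC0, hC⟩ := exists_cutoff_bound hθ (by positivity) h0 hb ψ k n
  have hlim : Filter.Tendsto (fun J : ℕ => C * (1 / 2 : ℝ) ^ J) Filter.atTop (nhds 0) := by
    simpa using (tendsto_pow_atTop_nhds_zero_of_lt_one (r := (1 / 2 : ℝ)) (by norm_num)
      (by norm_num)).const_mul C
  filter_upwards [hlim.eventually_lt_const hε] with J hJ
  refine lt_of_le_of_lt ?_ hJ
  refine SchwartzMap.seminorm_le_bound ℝ k n _ (by positivity) fun x => ?_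
  have e : ⇑(∑ m ∈ Finset.range (J + 1), SchwartzMap.smulLeftCLM ℂ
      (fun η => ((lpSymbol χ φ m (2 * Real.pi * η) : ℝ) : ℂ)) ψ - ψ) =
      fun x => θ ((1 / 2 : ℝ) ^ J * x) * ψ x := by
    ext y
    rw [sub_apply, sum_apply]
    simp only [SchwartzMap.smulLeftCLM_apply_apply (h.hasTemperateGrowth_lpSymbol _), smul_eq_mul]
    rw [← Finset.sum_mul, ← Complex.ofReal_sum, h.sum_lpSymbol, hθdef]
    simp only [lpSymbol]
    rw [show (2:ℝ) ^ (-(J:ℤ)) * (2 * Real.pi * y) = 2 * Real.pi * ((1 / 2 : ℝ) ^ J * y) by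
      rw [zpow_neg, zpow_natCast, one_div, inv_pow]; ring]
    ring
  rw [e]
  exact hC _ ⟨by positivity, pow_le_one₀ (by norm_num) (by norm_num)⟩ x

/-- The Fourier transform of a dyadic block. -/
lemma hasFT_dyadicBlock (h : IsLittlewoodPaleyPair χ φ) {u : 𝓢'(ℝ, ℂ)} {f : ℝ → ℂ} (hu : HasFT u f)
    (m : ℕ) : HasFT (dyadicBlock χ φ ((m : ℤ) - 1) u)
      (fun ξ => (lpSymbol χ φ m (2 * Real.pi * ξ) : ℂ) * f ξ) := by
  rw [dyadicBlock_natCast_sub_one]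
  exact hu.multiplierD (h.hasTemperateGrowth_lpSymbol m)

lemma memLp_lpSymbol_mul (h : IsLittlewoodPaleyPair χ φ) {f : ℝ → ℂ} (hf : MemLp f 2) (m : ℕ) :
    MemLp (fun ξ => (lpSymbol χ φ m (2 * Real.pi * ξ) : ℂ) * f ξ) 2 := by
  refine hf.of_le ((h.contDiff_ofReal_lpSymbol m).continuous.aestronglyMeasurable.mul
    hf.aestronglyMeasurable) (Filter.Eventually.of_forall fun ξ => ?_)
  have := h.lpSymbol_mem m (2 * Real.pi * ξ)
  rw [norm_mul, Complex.norm_real, Real.norm_of_nonneg this.1]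
  exact mul_le_of_le_one_left (norm_nonneg _) this.2

/-- A distribution whose dyadic blocks have Fourier transforms `F m` with a convergent sum in `L²` has
that sum as its Fourier transform. -/
lemma hasFT_tsum (h : IsLittlewoodPaleyPair χ φ) {u : 𝓢'(ℝ, ℂ)}
    {F : ℕ → Lp ℂ 2 (volume : Measure ℝ)}
    (hF : ∀ m : ℕ, HasFT (dyadicBlock χ φ ((m : ℤ) - 1) u) (F m)) (hs : Summable F) :
    HasFT u (∑' m, F m : Lp ℂ 2 (volume : Measure ℝ)) := fun ψ => by
  refine ⟨(ψ.memLp 2 volume).integrable_mul (Lp.memLp _), ?_⟩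
  set L := innerSL ℂ (((conjSchwartz ψ).memLp 2 volume).toLp (conjSchwartz ψ)) with hL
  have hLg : ∀ g : Lp ℂ 2 (volume : Measure ℝ), L g = ∫ ξ, ψ ξ * g ξ := fun g => by
    have := inner_toLp ((conjSchwartz ψ).memLp 2 volume) (Lp.memLp g)
    rw [Lp.toLp_coeFn] at this
    simpa [hL] using this
  have hsum := (hs.hasSum.mapL L).tendsto_sum_nat
  rw [hLg] at hsum
  have hsum' := hsum.comp (Filter.tendsto_add_atTop_nat 1)
  have hψ := ((u.comp (fourierCLM ℂ 𝓢(ℝ, ℂ))).continuous.tendsto ψ).comp (h.tendsto_sum_smulLeft ψ)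
  refine tendsto_nhds_unique hψ (hsum'.congr fun J => ?_)
  simp only [Function.comp_apply, map_sum]
  refine Finset.sum_congr rfl fun m _ => ?_
  rw [hLg, ← (hF m ψ).2, dyadicBlock_natCast_sub_one, multiplierD,
    TemperedDistribution.fourierMultiplierCLM_apply_apply, fourierInv_fourier_eq]
  rfl

/-- A distribution in `B^s_{2,∞}` with `s > 0` has a square-integrable Fourier transform. -/
lemma exists_hasFT (h : IsLittlewoodPaleyPair χ φ) {s : ℝ} (hs : 0 < s) :
    ∃ C : ℝ≥0, ∀ (u : 𝓢'(ℝ, ℂ)) (R : ℝ≥0), besovNorm χ φ s u ≤ R →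
      ∃ f : ℝ → ℂ, Measurable f ∧ MemLp f 2 ∧ HasFT u f ∧
        bn s (fun ξ => ‖f ξ‖ₑ) ≤ C * (R + 1) ^ 2 := by
  refine ⟨8 * ((2:ℝ) ^ (4 * s)).toNNReal, fun u R hR => ?_⟩
  have hblock : ∀ m : ℕ, l2Norm (dyadicBlock χ φ ((m : ℤ) - 1) u) <
      ENNReal.ofReal ((2:ℝ) ^ (-(s * ((m:ℝ) - 1))) * (R + 1)) := fun m => by
    have h1 : ENNReal.ofReal ((2:ℝ) ^ (s * ((m:ℝ) - 1))) *
        l2Norm (dyadicBlock χ φ ((m : ℤ) - 1) u) ≤ R := by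
      refine le_trans ?_ hR
      have : _ ≤ besovNorm χ φ s u := le_iSup₂ (f := fun (j : ℤ) (_ : -1 ≤ j) =>
        ENNReal.ofReal ((2 : ℝ) ^ (s * (j : ℝ))) * l2Norm (dyadicBlock χ φ j u)) ((m:ℤ) - 1)
        (by omega)
      simpa using this
    calc _ = ENNReal.ofReal ((2:ℝ) ^ (-(s * ((m:ℝ) - 1)))) * (ENNReal.ofReal
          ((2:ℝ) ^ (s * ((m:ℝ) - 1))) * l2Norm (dyadicBlock χ φ ((m : ℤ) - 1) u)) := by
          rw [← mul_assoc, ofReal_two_rpow_mul]; simp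
      _ ≤ ENNReal.ofReal ((2:ℝ) ^ (-(s * ((m:ℝ) - 1)))) * ENNReal.ofReal R := by
          rw [ENNReal.ofReal_coe_nnreal]
          exact mul_le_mul_right h1 _
      _ = ENNReal.ofReal ((2:ℝ) ^ (-(s * ((m:ℝ) - 1))) * R) :=
          (ENNReal.ofReal_mul (by positivity)).symm
      _ < _ := by
          have : (0:ℝ) < (2:ℝ) ^ (-(s * ((m:ℝ) - 1))) := by positivity
          exact (ENNReal.ofReal_lt_ofReal_iff (by positivity)).2 (by linarith)
  choose F hF hFn using fun m => exists_hasFT_of_l2Norm_lt (hblock m)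
  have hsum : Summable F := by
    refine Summable.of_norm_bounded (g := fun m : ℕ => ((2:ℝ) ^ s * (R + 1)) * ((2:ℝ) ^ (-s)) ^ m)
      ((summable_geometric_of_lt_one (by positivity)
        (Real.rpow_lt_one_of_one_lt_of_neg (by norm_num) (by linarith))).mul_left _) fun m => ?_
    have h1 := (hFn m).le
    rw [← ofReal_norm, ENNReal.ofReal_le_ofReal_iff (by positivity)] at h1
    refine h1.trans (le_of_eq ?_)
    rw [← Real.rpow_natCast ((2:ℝ) ^ (-s)), ← Real.rpow_mul (by norm_num),
      show -(s * ((m:ℝ) - 1)) = s + -s * m by ring, Real.rpow_add (by norm_num)]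
    ring
  set f : Lp ℂ 2 (volume : Measure ℝ) := ∑' m, F m with hf
  have hmem : MemLp f 2 := Lp.memLp f
  have hFT : HasFT u f := h.hasFT_tsum hF hsum
  refine ⟨f, (Lp.stronglyMeasurable f).measurable, hmem, hFT, bn_le fun l => ?_⟩
  have hFf : ∀ m, ∫⁻ ξ, ‖(lpSymbol χ φ m (2 * Real.pi * ξ) : ℂ) * f ξ‖ₑ ^ 2 ≤
      ENNReal.ofReal ((2:ℝ) ^ (-(2 * s * ((m:ℝ) - 1)))) * (R + 1) ^ 2 := fun m => by
    have hml := h.memLp_lpSymbol_mul hmem m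
    have hae := (hF m).ae_eq (h.hasFT_dyadicBlock hFT m)
      ((Lp.memLp (F m)).locallyIntegrable (by norm_num)) (hml.locallyIntegrable (by norm_num))
    have e : hml.toLp _ = F m := by
      rw [← Lp.toLp_coeFn (F m) (Lp.memLp _), MemLp.toLp_eq_toLp_iff]
      exact hae.symm
    rw [← enorm_toLp_sq hml, e]
    refine (pow_le_pow_left' (hFn m).le 2).trans (le_of_eq ?_)
    rw [ENNReal.ofReal_mul (by positivity), mul_pow, ← ENNReal.ofReal_pow (by positivity),
      ← Real.rpow_natCast, ← Real.rpow_mul (by norm_num)]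
    congr 2
    · congr 2; push_cast; ring
    · rw [ENNReal.ofReal_add (by positivity) (by norm_num)]; simp
  have hpt : ∀ ξ ∈ shell l, ‖f ξ‖ₑ ^ 2 ≤ 2 * ∑ m ∈ Finset.Icc (l - 1) (l + 2),
      ‖(lpSymbol χ φ m (2 * Real.pi * ξ) : ℂ) * f ξ‖ₑ ^ 2 := fun ξ hξ => by
    have h1 := h.half_le_sum hξ
    have h2 : (1:ℝ≥0∞) ≤ 2 * ∑ m ∈ Finset.Icc (l - 1) (l + 2),
        ‖(lpSymbol χ φ m (2 * Real.pi * ξ) : ℂ)‖ₑ ^ 2 := by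
      have e : ∀ m, ‖(lpSymbol χ φ m (2 * Real.pi * ξ) : ℂ)‖ₑ ^ 2 =
          ENNReal.ofReal (lpSymbol χ φ m (2 * Real.pi * ξ) ^ 2) := fun m => by
        rw [enorm_ofReal_eq, ← ENNReal.ofReal_pow (abs_nonneg _), sq_abs]
      simp_rw [e]
      rw [← ENNReal.ofReal_sum_of_nonneg fun m _ => sq_nonneg _, ← ENNReal.ofReal_one,
        show (2:ℝ≥0∞) = ENNReal.ofReal 2 by simp, ← ENNReal.ofReal_mul (by norm_num)]
      exact ENNReal.ofReal_le_ofReal (by linarith)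
    simp_rw [enorm_mul, mul_pow]
    rw [← Finset.sum_mul, ← mul_assoc]
    exact le_mul_of_one_le_left' h2
  have hmeas : ∀ m, Measurable fun ξ => ‖(lpSymbol χ φ m (2 * Real.pi * ξ) : ℂ) * f ξ‖ₑ ^ 2 :=
    fun m => (((h.contDiff_ofReal_lpSymbol m).continuous.measurable.mul
      (Lp.stronglyMeasurable f).measurable).enorm.pow_const 2)
  calc ∫⁻ ξ in shell l, ‖f ξ‖ₑ ^ 2
      ≤ ∫⁻ ξ in shell l, 2 * ∑ m ∈ Finset.Icc (l - 1) (l + 2),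
        ‖(lpSymbol χ φ m (2 * Real.pi * ξ) : ℂ) * f ξ‖ₑ ^ 2 :=
        setLIntegral_mono' (measurableSet_shell l) hpt
    _ = 2 * ∑ m ∈ Finset.Icc (l - 1) (l + 2), ∫⁻ ξ in shell l,
        ‖(lpSymbol χ φ m (2 * Real.pi * ξ) : ℂ) * f ξ‖ₑ ^ 2 := by
        rw [lintegral_const_mul _ (Finset.measurable_fun_sum _ fun m _ => hmeas m),
          lintegral_finsetSum _ fun m _ => hmeas m]
    _ ≤ 2 * ∑ _m ∈ Finset.Icc (l - 1) (l + 2), ENNReal.ofReal ((2:ℝ) ^ (4 * s)) *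
        (ENNReal.ofReal ((2:ℝ) ^ (-(2 * s * l))) * (R + 1) ^ 2) := by
        refine mul_le_mul_right (Finset.sum_le_sum fun m hm => ?_) _
        refine (setLIntegral_le_lintegral _ _).trans ((hFf m).trans ?_)
        rw [← mul_assoc, ofReal_two_rpow_mul]
        refine mul_le_mul_left (ENNReal.ofReal_le_ofReal
          (Real.rpow_le_rpow_of_exponent_le (by norm_num) ?_)) _
        have hm1 : (l:ℝ) ≤ m + 1 := by
          have := (Finset.mem_Icc.1 hm).1
          exact_mod_cast (by omega : l ≤ m + 1)
        nlinarith
    _ ≤ 2 * (4 * (ENNReal.ofReal ((2:ℝ) ^ (4 * s)) *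
        (ENNReal.ofReal ((2:ℝ) ^ (-(2 * s * l))) * (R + 1) ^ 2))) := by
        rw [Finset.sum_const, nsmul_eq_mul]
        refine mul_le_mul_right (mul_le_mul_left ?_ _) _
        rw [Nat.card_Icc]
        exact_mod_cast (by omega : l + 2 + 1 - (l - 1) ≤ 4)
    _ = _ := by
        rw [show ENNReal.ofReal ((2:ℝ) ^ (4 * s)) = (((2:ℝ) ^ (4 * s)).toNNReal : ℝ≥0∞) from rfl]
        push_cast; ring

/-- The Besov norm is controlled by the Fourier transform. -/
lemma exists_besovNorm_le (h : IsLittlewoodPaleyPair χ φ) (σ : ℝ) :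
    ∃ C : ℝ≥0, ∀ (u : 𝓢'(ℝ, ℂ)) (f : ℝ → ℂ), MemLp f 2 → HasFT u f →
      besovNorm χ φ σ u ^ 2 ≤ C * bn σ (fun ξ => ‖f ξ‖ₑ) := by
  refine ⟨4 * ((2:ℝ) ^ (4 * |σ|)).toNNReal, fun u f hf hu => ?_⟩
  rw [← ENNReal.rpow_two, ← ENNReal.le_rpow_inv_iff (by norm_num)]
  refine iSup₂_le fun j hj => ?_
  rw [ENNReal.le_rpow_inv_iff (by norm_num), ENNReal.rpow_two]
  obtain ⟨m, rfl⟩ : ∃ m : ℕ, j = m - 1 := ⟨(j + 1).toNat, by omega⟩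
  have hle := (h.hasFT_dyadicBlock hu m).l2Norm_le (h.memLp_lpSymbol_mul hf m)
  set Λ := bn σ (fun ξ => ‖f ξ‖ₑ) with hΛ
  have hshell : ∀ l, ∫⁻ ξ in shell l, ‖(lpSymbol χ φ m (2 * Real.pi * ξ) : ℂ) * f ξ‖ₑ ^ 2 ≤
      ENNReal.ofReal ((2:ℝ) ^ (-(2 * σ * l))) * Λ := fun l => by
    refine (lintegral_mono fun ξ => ?_).trans (setLIntegral_shell_le σ _ l)
    have hm := h.lpSymbol_mem m (2 * Real.pi * ξ)
    refine pow_le_pow_left' ?_ 2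
    rw [enorm_mul, enorm_ofReal_eq, abs_of_nonneg hm.1]
    exact mul_le_of_le_one_left' (ENNReal.ofReal_le_one.2 hm.2)
  have hsupp : ∀ l ∉ Finset.Icc (m - 2) (m + 1),
      ∫⁻ ξ in shell l, ‖(lpSymbol χ φ m (2 * Real.pi * ξ) : ℂ) * f ξ‖ₑ ^ 2 = 0 := fun l hl => by
    rw [setLIntegral_congr_fun (g := fun _ => 0) (measurableSet_shell l), lintegral_zero]
    intro ξ hξ
    have : lpSymbol χ φ m (2 * Real.pi * ξ) = 0 := by
      by_contra hne
      have := h.lpSymbol_shell hξ hne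
      exact hl (Finset.mem_Icc.2 (by omega))
    simp [this]
  have hsq : ENNReal.ofReal ((2:ℝ) ^ (σ * (((m:ℤ) - 1 : ℤ) : ℝ))) ^ 2 =
      ENNReal.ofReal ((2:ℝ) ^ (2 * σ * ((m:ℝ) - 1))) := by
    rw [← ENNReal.ofReal_pow (by positivity), ← Real.rpow_natCast, ← Real.rpow_mul (by norm_num)]
    congr 2; push_cast; ring
  calc _ = ENNReal.ofReal ((2:ℝ) ^ (2 * σ * ((m:ℝ) - 1))) *
        l2Norm (dyadicBlock χ φ ((m:ℤ) - 1) u) ^ 2 := by rw [mul_pow, hsq]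
    _ ≤ ENNReal.ofReal ((2:ℝ) ^ (2 * σ * ((m:ℝ) - 1))) *
        ∑ l ∈ Finset.Icc (m - 2) (m + 1), ENNReal.ofReal ((2:ℝ) ^ (-(2 * σ * l))) * Λ := by
        refine mul_le_mul_right (hle.trans ?_) _
        rw [lintegral_eq_tsum_shell, tsum_eq_sum hsupp]
        exact Finset.sum_le_sum fun l _ => hshell l
    _ = ∑ l ∈ Finset.Icc (m - 2) (m + 1),
        ENNReal.ofReal ((2:ℝ) ^ (2 * σ * ((m:ℝ) - 1) + -(2 * σ * l))) * Λ := by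
        rw [Finset.mul_sum]
        refine Finset.sum_congr rfl fun l _ => ?_
        rw [← mul_assoc, ofReal_two_rpow_mul]
    _ ≤ ∑ _l ∈ Finset.Icc (m - 2) (m + 1), ENNReal.ofReal ((2:ℝ) ^ (4 * |σ|)) * Λ := by
        refine Finset.sum_le_sum fun l hl => mul_le_mul_left (ENNReal.ofReal_le_ofReal
          (Real.rpow_le_rpow_of_exponent_le (by norm_num) ?_)) _
        obtain ⟨h1, h2⟩ := Finset.mem_Icc.1 hl
        have h1' : (m:ℝ) ≤ l + 2 := by exact_mod_cast (by omega : m ≤ l + 2)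
        have h2' : (l:ℝ) ≤ m + 1 := by exact_mod_cast h2
        have h3 : |(m:ℝ) - 1 - l| ≤ 2 := abs_le.2 ⟨by linarith, by linarith⟩
        calc 2 * σ * ((m:ℝ) - 1) + -(2 * σ * l) = 2 * (σ * ((m:ℝ) - 1 - l)) := by ring
          _ ≤ 2 * (|σ| * |(m:ℝ) - 1 - l|) := by
              rw [← abs_mul]
              linarith [le_abs_self (σ * ((m:ℝ) - 1 - l))]
          _ ≤ _ := by nlinarith [abs_nonneg σ]
    _ ≤ 4 * (ENNReal.ofReal ((2:ℝ) ^ (4 * |σ|)) * Λ) := by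
        rw [Finset.sum_const, nsmul_eq_mul]
        refine mul_le_mul_left ?_ _
        rw [Nat.card_Icc]
        exact_mod_cast (by omega : m + 1 + 1 - (m - 2) ≤ 4)
    _ = _ := by
        rw [show ENNReal.ofReal ((2:ℝ) ^ (4 * |σ|)) = (((2:ℝ) ^ (4 * |σ|)).toNNReal : ℝ≥0∞) from rfl]
        push_cast; ring

end IsLittlewoodPaleyPair

/-! ### The second order expansion -/

/-- A solution has a Fourier transform, which solves the equation on the Fourier side. -/
lemma IsLittlewoodPaleyPair.exists_isFourierSolution {χ φ : ℝ → ℝ} (h : IsLittlewoodPaleyPair χ φ)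
    {s : ℝ} (hs : 3 / 2 < s) :
    ∃ C : ℝ≥0, ∀ (α T : ℝ) (v₀ : 𝓢'(ℝ, ℂ)) (v : ℝ → 𝓢'(ℝ, ℂ)),
      IsCamassaHolmSolution χ φ s α T v₀ v → ∃ f : ℝ → ℝ → ℂ, IsFourierSolution s α T f ∧
        ∀ t ∈ Icc (0:ℝ) T, HasFT (v t) (f t) ∧ MemLp (f t) 2 ∧
          HasFT (camassaHolmE α (v t)) (chForm α (f t) (f t)) ∧
          ∀ R : ℝ≥0, besovNorm χ φ s (v t) ≤ R → bn s (fun ξ => ‖f t ξ‖ₑ) ≤ C * (R + 1) ^ 2 := by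
  obtain ⟨C, hC⟩ := h.exists_hasFT (by linarith : 0 < s)
  refine ⟨C, fun α T v₀ v hv => ?_⟩
  obtain ⟨M, hM⟩ := hv.bounded
  have hex : ∀ t, ∃ f : ℝ → ℂ, t ∈ Icc (0:ℝ) T → Measurable f ∧ MemLp f 2 ∧ HasFT (v t) f ∧
      (∀ ξ, f (-ξ) = starRingEnd ℂ (f ξ)) ∧
      ∀ R : ℝ≥0, besovNorm χ φ s (v t) ≤ R → bn s (fun ξ => ‖f ξ‖ₑ) ≤ C * (R + 1) ^ 2 := fun t => by
    by_cases ht : t ∈ Icc (0:ℝ) T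
    · have hfin : besovNorm χ φ s (v t) ≠ ⊤ := ((hM t ht).trans_lt ENNReal.coe_lt_top).ne
      obtain ⟨f, hm, hf, hu, hb⟩ := hC (v t) _ (ENNReal.coe_toNNReal hfin).ge
      obtain ⟨g, hg, hfg, hsymm⟩ := hu.exists_symm (hv.real t ht) hm hf
      refine ⟨g, fun _ => ⟨hg, (memLp_congr_ae hfg).1 hf, hu.congr_ae hfg, hsymm, fun R hR => ?_⟩⟩
      have hb' : bn s (fun ξ => ‖g ξ‖ₑ) ≤ bn s (fun ξ => ‖f ξ‖ₑ) :=
        bn_mono (by filter_upwards [hfg] with ξ hξ; rw [hξ])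
      refine hb'.trans (hb.trans ?_)
      rw [ENNReal.coe_toNNReal hfin]
      gcongr
    · exact ⟨0, fun ht' => absurd ht' ht⟩
  choose f hf using hex
  have hbd : ∀ t ∈ Icc (0:ℝ) T, bn s (fun ξ => ‖f t ξ‖ₑ) ≤ ((C * (M + 1) ^ 2 : ℝ≥0) : ℝ≥0∞) :=
    fun t ht => by
      push_cast
      exact (hf t ht).2.2.2.2 M (hM t ht)
  have hd : ∀ t ∈ Icc (0:ℝ) T, MemLp (dSym (f t)) 2 ∧ Integrable (f t) ∧
      Integrable (dSym (f t)) := fun t ht => by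
    have hm := (hf t ht).1
    have h1 := (hbd t ht).trans_lt ENNReal.coe_lt_top
    have h2 := bn_dSym_le (s - 1) (f t)
    rw [sub_add_cancel] at h2
    have h3 := h2.trans_lt (ENNReal.mul_lt_top (by norm_num) h1)
    exact ⟨memLp_two_of_bn (by linarith : 0 < s - 1) (measurable_dSym hm) h3,
      integrable_of_bn (by linarith : 1 / 2 < s) hm h1,
      integrable_of_bn (by linarith : 1 / 2 < s - 1) (measurable_dSym hm) h3⟩
  have hR : ∀ t ∈ Icc (0:ℝ) T, HasFT (camassaHolmRHS α (v t)) (chForm α (f t) (f t)) := fun t ht =>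
    (hf t ht).2.2.1.camassaHolmRHS (hf t ht).2.1 (hd t ht).1 (hd t ht).2.1 (hd t ht).2.2 α
  refine ⟨f, ⟨fun t ht => (hf t ht).1, fun t ht => (hf t ht).2.2.2.1, ⟨_, hbd⟩, fun ψ t ht => ?_⟩,
    fun t ht => ⟨(hf t ht).2.2.1, (hf t ht).2.1, ?_, (hf t ht).2.2.2.2⟩⟩
  · have hsub : ∀ τ ∈ uIcc 0 t, τ ∈ Icc (0:ℝ) T := fun τ hτ => by
      rw [uIcc_of_le ht.1] at hτ
      exact ⟨hτ.1, hτ.2.trans ht.2⟩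
    have he : ∀ τ ∈ uIcc 0 t, camassaHolmRHS α (v τ) (𝓕 ψ) =
        ∫ ξ, ψ ξ * chForm α (f τ) (f τ) ξ := fun τ hτ => (hR τ (hsub τ hτ) ψ).2
    have h0 : (0:ℝ) ∈ Icc (0:ℝ) T := hsub 0 left_mem_uIcc
    refine ⟨(hv.integrable (𝓕 ψ) t ht).congr fun τ hτ => he τ (uIoc_subset_uIcc hτ), ?_⟩
    have e0 := hv.equation (𝓕 ψ) 0 h0
    rw [intervalIntegral.integral_same, add_zero] at e0
    rw [← ((hf t ht).2.2.1 ψ).2, ← ((hf 0 h0).2.2.1 ψ).2, hv.equation (𝓕 ψ) t ht, e0,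
      intervalIntegral.integral_congr he]
  · exact (hf t ht).2.2.1.camassaHolmE (hf t ht).2.1 (hd t ht).1 (hd t ht).2.1 (hd t ht).2.2 α

theorem proposition3p2 (χ φ : ℝ → ℝ) (hLP : IsLittlewoodPaleyPair χ φ)
    (s : ℝ) (hs : 3 / 2 < s) (R : ℝ≥0) :
    ∃ T : ℝ, 0 < T ∧ ∃ C : ℝ≥0,
      ∀ v₀ : 𝓢'(ℝ, ℂ), IsRealDistribution v₀ → besovNorm χ φ s v₀ ≤ R →
      ∀ α ∈ Icc (0 : ℝ) 1, ∀ T' ∈ Icc 0 T, ∀ v : ℝ → 𝓢'(ℝ, ℂ),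
        IsCamassaHolmSolution χ φ s α T' v₀ v →
        ∀ t ∈ Icc 0 T',
          besovNorm χ φ (s - 2) (v t - v₀ - (t : ℂ) • camassaHolmE α v₀)
            ≤ ENNReal.ofReal (C * t ^ 2) := by
  obtain ⟨C₁, hC₁⟩ := hLP.exists_isFourierSolution hs
  obtain ⟨T, hT, C₂, hC₂⟩ := IsFourierSolution.exists_expansion hs (C₁ * (R + 1) ^ 2)
  obtain ⟨C₃, hC₃⟩ := hLP.exists_besovNorm_le (s - 2)
  refine ⟨T, hT, NNReal.sqrt (C₃ * C₂), fun v₀ _ hv₀ α hα T' hT' v hv t ht => ?_⟩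
  obtain ⟨f, hfs, hf⟩ := hC₁ α T' v₀ v hv
  have h0 : (0:ℝ) ∈ Icc (0:ℝ) T' := ⟨le_rfl, hT'.1⟩
  have hv0 : v 0 = v₀ := by
    ext ψ
    simpa using hv.equation ψ 0 h0
  obtain ⟨hu₀, hf₀, hE, hR⟩ := hf 0 h0
  obtain ⟨hu, hft, -, -⟩ := hf t ht
  rw [hv0] at hu₀ hE hR
  have hb := hC₂ α hα T' hT'.2 f hfs (by exact_mod_cast hR R hv₀) t ht
  obtain ⟨K, hK⟩ := hfs.exists_speed_bound hs hα
  have key := hC₃ _ _ ((hft.sub hf₀).sub ((hK 0 h0).1.const_mul (t:ℂ)))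
    ((hu.sub hu₀).sub (hE.smul t))
  rw [← ENNReal.pow_le_pow_left_iff two_ne_zero]
  refine key.trans ((mul_le_mul_right hb _).trans (le_of_eq ?_))
  rw [← ENNReal.ofReal_pow (by positivity), mul_pow, ← NNReal.coe_pow, NNReal.sq_sqrt,
    ENNReal.ofReal_mul (by positivity), ENNReal.ofReal_coe_nnreal]
  push_cast
  rw [mul_assoc, ← pow_mul]
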